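/- **Setting.** Let $M,N\in\{1,2,\dots\}\cup\{\infty\}$, and let $\mu^-=\sum_{i=1}^M m_i'\delta_{x_i}$, $\mu^+=\sum_{j=1}^N m_j\delta_{y_j}$ be finite atomic measures on $\mathbb R^d$ of equal mass, with the $x_i$ pairwise distinct, the $y_j$ pairwise distinct and $m'_i,m_j\ge 0$. A rectifiable $1$-current $T=\tau(C,\theta,\xi)$ is $T(\omega)=\int_C\langle\omega,\xi\rangle\theta\,d\mathcal H^1$, where $C\subset\mathbb R^d$ is $\mathcal H^1$-measurable and countably $1$-rectifiable, $\theta>0$ is locally $\mathcal H^1$-integrable on $C$, and $\xi$ is an $\mathcal H^1$-measurable unit vector field spanning the approximate tangent line of $C$ a.e. A transport path from $\mu^-$ to $\mu^+$ is a rectifiable $1$-current $T$ with $\partial T=\mu^+-\mu^-$. A rectifiable $1$-current $S=\tau(D,\varphi,\zeta)$ is on $T$ if $\mathcal H^1(D\setminus C)=0$ and $\varphi\le\theta$ $\mathcal H^1$-a.e. on $D$; $T$ is cycle-free if the only $S$ on $T$ with $\partial S=0$ is $S=0$. Let $\Gamma$ be the space of $1$-Lipschitz, eventually constant curves $\gamma:[0,\infty)\to\mathbb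 R^d$, let $p_0(\gamma)=\gamma(0)$, $p_\infty(\gamma)=\lim_{t\to\infty}\gamma(t)$, $\Gamma_{x,y}=\{\gamma: p_0(\gamma)=x,\ p_\infty(\gamma)=y\}$. A curve is simple if $\gamma(s)\ne\gamma(t)$ whenever $t_0\le s<t\le t_\infty$, where $t_0=\sup\{t:\gamma\text{ is constant on }[0,t]\}$ and $t_\infty=\inf\{t:\gamma\text{ is constant on }[t,\infty)\}$; for simple $\gamma$ put $I_\gamma=\tau(\mathrm{Im}\,\gamma,1,\gamma'/|\gamma'|)$. A finite positive measure $\eta$ on $\Gamma$ is a good decomposition of a $1$-current $T$ that is normal (i.e. $\mathbf M(T)+\mathbf M(\partial T)<\infty$) if it is concentrated on non-constant simple curves, $T=\int_\Gamma I_\gamma\,d\eta$ (tested on smooth compactly supported $1$-forms), $\mathbf M(T)=\int\mathbf M(I_\gamma)\,d\eta=\int\mathcal H^1(\mathrm{Im}\,\gamma)\,d\eta$ and $\mathbf M(\partial T)=\int\mathbf M(\partial I_\gamma)\,d\eta=2\eta(\Gamma)$. For finite measures on $\Gamma$ write $\tilde\eta\preccurlyeq\eta$ if for each $(i,j)$ there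 is $c_{ij}\ge0$ with $\int_{\Gamma_{x_i,y_j}}I_\gamma\,d\tilde\eta=c_{ij}\int_{\Gamma_{x_i,y_j}}I_\gamma\,d\eta$. If $\eta$ is a finite measure on $\Gamma$ with $(p_0)_\#\eta=\mu^-$ and $(p_\infty)_\#\eta=\mu^+$, its representing matrix is the $M\times N$ matrix $[\eta(\Gamma_{x_i,y_j})]_{ij}$. A nonnegative $M\times N$ matrix is stair-shaped if there are nondecreasing sequences $r_k\in[1,M]$, $c_k\in[1,N]$ of integers with $r_k+c_k=k+1$ ($1\le k\le M+N-1$, $k<\infty$) such that all entries outside the positions $(r_k,c_k)$ are zero; $\eta$ is stair-shaped if its representing matrix is; and a transport path $T$ from $\mu^-$ to $\mu^+$ is stair-shaped if it has a stair-shaped good decomposition. **Statement.** Let $T$ be a cycle-free transport path from $\mu^-$ to $\mu^+$, and let $A=[a_{ij}]$ be the representing matrix of a good decomposition $\eta_A$ of $T$. Suppose there is a non-empty finite or infinite list of non-empty sub-matrices $A_k=A[(i_k,j_k),(i_k',j_k')]$ (the entries $a_{ij}$ with $i_k\le i\le i'_k$, $j_k\le j\le j'_k$, where $i_k'\le M$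 and $j'_k\le N$ may be $\infty$) such that (a) $(i_1,j_1)=(1,1)$, and $i_k'\le i_{k+1}\le i_k'+1$, $j_k'\le j_{k+1}\le j_k'+1$ for each $k$ for which $A_{k+1}$ is in the list; (b) all entries of each $A_k$ are positive; (c) all entries of $A$ that lie in none of the $A_k$ are $0$. Then there exists a stair-shaped good decomposition $\eta_B$ of $T$ with $\eta_B\preccurlyeq\eta_A$. Hence $T$ is stair-shaped. -/

import Mathlib

open MeasureTheory Set Filter Topology TopologicalSpace
open scoped NNReal ENNReal Distributions

noncomputable section

namespace TransportPath

/-! ## Currents of dimension zero and one in Euclidean space -/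

/-- The Euclidean space `ℝ^d`. -/
abbrev Euc (d : ℕ) : Type := EuclideanSpace ℝ (Fin d)

/-- Smooth compactly supported `0`-forms on `ℝ^d`. -/
abbrev ZeroForm (d : ℕ) : Type := 𝓓((⊤ : Opens (Euc d)), ℝ)

/-- Smooth compactly supported `1`-forms on `ℝ^d`. -/
abbrev OneForm (d : ℕ) : Type := 𝓓((⊤ : Opens (Euc d)), Euc d →L[ℝ] ℝ)

/-- `0`-currents: the dual of the space of smooth compactly supported `0`-forms. -/
abbrev ZeroCurrent (d : ℕ) : Type := ZeroForm d →L[ℝ] ℝ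

/-- `1`-currents: the dual of the space of smooth compactly supported `1`-forms. -/
abbrev OneCurrent (d : ℕ) : Type := OneForm d →L[ℝ] ℝ

variable {d : ℕ}

/-- The boundary `∂T(f) = T(df)` of a `1`-current. -/
def boundary (T : OneCurrent d) : ZeroCurrent d :=
  T.comp (TestFunction.fderivCLM ℝ ⊤ ⊤)

/-- The mass `sup {T(ω) : ‖ω‖ ≤ 1}` of a `1`-current. -/
def mass (T : OneCurrent d) : ℝ≥0∞ :=
  ⨆ (ω : OneForm d) (_ : ∀ p, ‖ω p‖ ≤ 1), ENNReal.ofReal (T ω)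

/-- The mass `sup {S(f) : |f| ≤ 1}` of a `0`-current. -/
def massZero (S : ZeroCurrent d) : ℝ≥0∞ :=
  ⨆ (f : ZeroForm d) (_ : ∀ p, |f p| ≤ 1), ENNReal.ofReal (S f)

/-- A `1`-current is normal if it and its boundary have finite mass. -/
def IsNormal (T : OneCurrent d) : Prop := mass T + massZero (boundary T) < ∞

/-! ## Rectifiable one-currents -/

/-- `C ⊆ C₀ ∪ ⋃ⱼ Fⱼ(ℝ)` with `ℋ¹(C₀) = 0` and every `Fⱼ : ℝ → ℝ^d` Lipschitz. -/
def IsCountablyRectifiable (C : Set (Euc d)) : Prop :=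
  ∃ (C₀ : Set (Euc d)) (F : ℕ → ℝ → Euc d), Measure.hausdorffMeasure 1 C₀ = 0 ∧
    (∀ j, ∃ K : ℝ≥0, LipschitzWith K (F j)) ∧ C ⊆ C₀ ∪ ⋃ j, range (F j)

/-- `P` is the approximate tangent space at `p` of the set `C` with multiplicity `θ`: the
rescalings about `p` of the measure `θ ℋ¹⌞C` converge to `θ(p) ℋ¹⌞P`. -/
def IsApproxTangentSpace (C : Set (Euc d)) (θ : Euc d → ℝ) (p : Euc d)
    (P : Submodule ℝ (Euc d)) : Prop :=
  ∀ f : Euc d → ℝ, Continuous f → HasCompactSupport f →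
    Tendsto
      (fun r : ℝ => r⁻¹ * ∫ z in C, f (r⁻¹ • (z - p)) * θ z ∂(Measure.hausdorffMeasure 1))
      (𝓝[>] 0)
      (𝓝 (θ p * ∫ z in (P : Set (Euc d)), f z ∂(Measure.hausdorffMeasure 1)))

/-- The `1`-current `τ(C, θ, ξ)`, i.e. `ω ↦ ∫_C ⟨ω(p), ξ(p)⟩ θ(p) dℋ¹(p)` (for `θ ξ` locally
`ℋ¹`-integrable on `C`). -/
def tauCurrent (C : Set (Euc d)) (θ : Euc d → ℝ) (ξ : Euc d → Euc d) : OneCurrent d :=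
  TestFunction.integralAgainstBilinCLM (ContinuousLinearMap.id ℝ (Euc d →L[ℝ] ℝ))
    ((Measure.hausdorffMeasure 1).restrict C) (fun p => θ p • ξ p)

/-- `T = τ(C, θ, ξ)` is a rectifiable `1`-current: `C` is `ℋ¹`-measurable and countably
rectifiable, `θ` is positive and locally `ℋ¹`-integrable on `C`, and `ξ` is an `ℋ¹`-measurable
unit vector field spanning the approximate tangent line of `C` at `ℋ¹`-almost every point. -/
structure IsRectifiableRep (T : OneCurrent d) (C : Set (Euc d)) (θ : Euc d → ℝ)
    (ξ : Euc d → Euc d) : Prop where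
  measurable_carrier : NullMeasurableSet C (Measure.hausdorffMeasure 1)
  rectifiable : IsCountablyRectifiable C
  pos : ∀ p ∈ C, 0 < θ p
  locallyIntegrable : LocallyIntegrable θ ((Measure.hausdorffMeasure 1).restrict C)
  measurable_orientation : AEStronglyMeasurable ξ ((Measure.hausdorffMeasure 1).restrict C)
  tangent : ∀ᵐ p ∂((Measure.hausdorffMeasure 1).restrict C),
    ‖ξ p‖ = 1 ∧ IsApproxTangentSpace C θ p (Submodule.span ℝ {ξ p})
  eq_tau : T = tauCurrent C θ ξ

/-- Rectifiable `1`-currents. -/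
def IsRectifiable (T : OneCurrent d) : Prop := ∃ C θ ξ, IsRectifiableRep T C θ ξ

/-- The rectifiable current `S = τ(D, φ, ζ)` is on the rectifiable current `T = τ(C, θ, ξ)`:
`ℋ¹(D \ C) = 0` and `φ ≤ θ` at `ℋ¹`-almost every point of `D`. -/
def IsOn (S T : OneCurrent d) : Prop :=
  ∃ C θ ξ D φ ζ, IsRectifiableRep T C θ ξ ∧ IsRectifiableRep S D φ ζ ∧
    Measure.hausdorffMeasure 1 (D \ C) = 0 ∧
    ∀ᵐ p ∂((Measure.hausdorffMeasure 1).restrict D), φ p ≤ θ p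

/-- `T` is cycle-free: the only rectifiable current without boundary that is on `T` is `0`. -/
def IsCycleFree (T : OneCurrent d) : Prop :=
  ∀ S : OneCurrent d, IsOn S T → boundary S = 0 → S = 0

/-! ## Curves and good decompositions -/

/-- The space `Γ` of `1`-Lipschitz, eventually constant curves `γ : [0, ∞) → ℝ^d`. It carries the
σ-algebra generated by the evaluations `γ ↦ γ(t)`, which is the Borel σ-algebra of locally
uniform convergence. -/
abbrev Curve (d : ℕ) : Type :=
  {γ : ℝ≥0 → Euc d // LipschitzWith 1 γ ∧ ∃ t₀, ∀ t, t₀ ≤ t → γ t = γ t₀}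

namespace Curve

/-- The starting point `γ(0)`. -/
def start (γ : Curve d) : Euc d := γ.1 0

/-- The end point `γ(∞) = lim_{t → ∞} γ(t)`. -/
def finish (γ : Curve d) : Euc d := limUnder atTop γ.1

/-- `sup {t : γ is constant on [0, t]}` -/
def tStart (γ : Curve d) : ℝ≥0 := sSup {t | ∀ s, s ≤ t → γ.1 s = γ.1 0}

/-- `inf {t : γ is constant on [t, ∞)}` -/
def tFinish (γ : Curve d) : ℝ≥0 := sInf {t | ∀ s, t ≤ s → γ.1 s = γ.1 t}

def IsNonconstant (γ : Curve d) : Prop := ∃ s t, γ.1 s ≠ γ.1 t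

def IsSimple (γ : Curve d) : Prop :=
  ∀ s t, γ.tStart ≤ s → s < t → t ≤ γ.tFinish → γ.1 s ≠ γ.1 t

/-- The unit tangent `γ' / |γ'|` of a simple curve, as a function on its image. It has its
geometric meaning at `ℋ¹`-almost every point of the image. -/
def tangent (γ : Curve d) (p : Euc d) : Euc d :=
  let v := deriv (fun s : ℝ => γ.1 s.toNNReal) (Function.invFun γ.1 p : ℝ≥0)
  ‖v‖⁻¹ • v

/-- The rectifiable `1`-current `I_γ = τ(Im γ, γ' / |γ'|, 1)` of a simple curve. -/
def current (γ : Curve d) : OneCurrent d :=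
  tauCurrent (range γ.1) (fun _ => 1) γ.tangent

lemma tendsto_finish (γ : Curve d) : Tendsto γ.1 atTop (𝓝 γ.finish) := by
  obtain ⟨t₀, h⟩ := γ.2.2
  have : Tendsto γ.1 atTop (𝓝 (γ.1 t₀)) :=
    tendsto_const_nhds.congr' (by
      filter_upwards [eventually_ge_atTop t₀] with t ht using (h t ht).symm)
  exact tendsto_nhds_limUnder ⟨_, this⟩

lemma measurable_start : Measurable (start : Curve d → Euc d) :=
  (measurable_pi_apply 0).comp measurable_subtype_coe

lemma measurable_finish : Measurable (finish : Curve d → Euc d) := by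
  refine measurable_of_tendsto_metrizable (f := fun (n : ℕ) (γ : Curve d) => γ.1 n)
    (fun n => (measurable_pi_apply _).comp measurable_subtype_coe) ?_
  rw [tendsto_pi_nhds]
  intro γ
  exact γ.tendsto_finish.comp tendsto_natCast_atTop_atTop

end Curve

/-- `Γ_{a,b}`: the curves in `Γ` from `a` to `b`. -/
def curvesFromTo (a b : Euc d) : Set (Curve d) := {γ | γ.start = a ∧ γ.finish = b}

/-- `η` is a good decomposition of the normal `1`-current `T`. -/
structure IsGoodDecomposition (T : OneCurrent d) (η : Measure (Curve d)) : Prop where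
  normal : IsNormal T
  finite : IsFiniteMeasure η
  integrable : ∀ ω : OneForm d, Integrable (fun γ : Curve d => γ.current ω) η
  eq_integral : ∀ ω : OneForm d, T ω = ∫ γ : Curve d, γ.current ω ∂η
  simple : ∀ᵐ γ ∂η, γ.IsNonconstant ∧ γ.IsSimple
  mass_eq : mass T = ∫⁻ γ : Curve d, mass γ.current ∂η
  mass_eq_length : mass T = ∫⁻ γ : Curve d, Measure.hausdorffMeasure 1 (range γ.1) ∂η
  mass_boundary_eq : massZero (boundary T) = ∫⁻ γ : Curve d, massZero (boundary γ.current) ∂η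
  mass_boundary_eq_two_mul : massZero (boundary T) = 2 * η univ

/-! ## Atomic measures, transport paths, matrices -/

/-- The index set `{i ∈ ℕ : 1 ≤ i ≤ M}`, for `M ∈ ℕ ∪ {∞}`. -/
abbrev Idx (M : ℕ∞) : Type := {i : ℕ // 1 ≤ i ∧ (i : ℕ∞) ≤ M}

/-- The atomic measure `∑_{i=1}^M wᵢ δ_{xᵢ}`. -/
def atomicMeasure {M : ℕ∞} (x : Idx M → Euc d) (w : Idx M → ℝ≥0) : Measure (Euc d) :=
  Measure.sum fun i => w i • Measure.dirac (x i)

/-- `T ∈ Path(μ⁻, μ⁺)`: `T` is a rectifiable `1`-current with `∂T = μ⁺ - μ⁻`. -/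
def IsTransportPath (μminus μplus : Measure (Euc d)) (T : OneCurrent d) : Prop :=
  IsRectifiable T ∧ ∀ f : ZeroForm d, boundary T f = ∫ p, f p ∂μplus - ∫ p, f p ∂μminus

variable {M N : ℕ∞}

/-- `B` is the representing matrix of the measure `η` on `Γ`, where `η` has marginals
`∑ m'ᵢ δ_{xᵢ}` (starting points) and `∑ mⱼ δ_{yⱼ}` (end points): `bᵢⱼ = η(Γ_{xᵢ,yⱼ})`. -/
structure IsRepresentingMatrix (x : Idx M → Euc d) (y : Idx N → Euc d) (m' : Idx M → ℝ≥0)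
    (m : Idx N → ℝ≥0) (η : Measure (Curve d)) (B : Matrix (Idx M) (Idx N) ℝ≥0) : Prop where
  map_start : η.map Curve.start = atomicMeasure x m'
  map_finish : η.map Curve.finish = atomicMeasure y m
  entry : ∀ i j, η (curvesFromTo (x i) (y j)) = B i j

/-- The indices `k` of a sequence of positions in an `M × N` matrix: `1 ≤ k ≤ M + N - 1`. -/
def stairIndices (M N : ℕ∞) : Set ℕ := {k | 1 ≤ k ∧ (k : ℕ∞) + 1 ≤ M + N}

/-- A nonnegative `M × N` matrix is stair-shaped if it vanishes outside the positions `(rₖ, cₖ)`,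
`1 ≤ k ≤ M + N - 1`, of some nondecreasing sequences `r`, `c` with `rₖ + cₖ = k + 1`. -/
def IsStairShapedMatrix (B : Matrix (Idx M) (Idx N) ℝ≥0) : Prop :=
  ∃ r c : ℕ → ℕ, MonotoneOn r (stairIndices M N) ∧ MonotoneOn c (stairIndices M N) ∧
    (∀ k ∈ stairIndices M N, 1 ≤ r k ∧ (r k : ℕ∞) ≤ M ∧ 1 ≤ c k ∧ (c k : ℕ∞) ≤ N ∧
      r k + c k = k + 1) ∧
    ∀ (i : Idx M) (j : Idx N), (∀ k ∈ stairIndices M N, (r k, c k) ≠ (i.1, j.1)) → B i j = 0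

/-- A measure on `Γ` is stair-shaped if its representing matrix is. -/
def IsStairShapedMeasure (x : Idx M → Euc d) (y : Idx N → Euc d) (m' : Idx M → ℝ≥0)
    (m : Idx N → ℝ≥0) (η : Measure (Curve d)) : Prop :=
  ∃ B : Matrix (Idx M) (Idx N) ℝ≥0, IsRepresentingMatrix x y m' m η B ∧ IsStairShapedMatrix B

/-- A transport path from `∑ m'ᵢ δ_{xᵢ}` to `∑ mⱼ δ_{yⱼ}` is stair-shaped if it has a stair-shaped
good decomposition. -/
def IsStairShapedPath (x : Idx M → Euc d) (y : Idx N → Euc d) (m' : Idx M → ℝ≥0)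
    (m : Idx N → ℝ≥0) (T : OneCurrent d) : Prop :=
  IsTransportPath (atomicMeasure x m') (atomicMeasure y m) T ∧
    ∃ η : Measure (Curve d), IsGoodDecomposition T η ∧ IsStairShapedMeasure x y m' m η

/-- `η' ≼ η`: for each `(i, j)`, the current `∫_{Γ_{xᵢ,yⱼ}} I_γ dη'` is a nonnegative multiple of
`∫_{Γ_{xᵢ,yⱼ}} I_γ dη`. -/
def Precc (x : Idx M → Euc d) (y : Idx N → Euc d) (η' η : Measure (Curve d)) : Prop :=
  ∀ i j, ∃ a : ℝ≥0, ∀ ω : OneForm d,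
    ∫ γ in curvesFromTo (x i) (y j), γ.current ω ∂η' =
      a * ∫ γ in curvesFromTo (x i) (y j), γ.current ω ∂η

/-- The positions of the sub-matrix with upper left corner `p` and lower right corner `q`. -/
def block (M N : ℕ∞) (p : ℕ × ℕ) (q : ℕ∞ × ℕ∞) : Set (Idx M × Idx N) :=
  {s | p.1 ≤ s.1.1 ∧ (s.1.1 : ℕ∞) ≤ q.1 ∧ p.2 ≤ s.2.1 ∧ (s.2.1 : ℕ∞) ≤ q.2}

/-- The sub-matrices of `A` with upper left corners `p k` and lower right corners `q k`,
for `1 ≤ k ≤ K` with `K ∈ ℕ ∪ {∞}`, form a chain of overlapping or adjacent positive blocks that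
starts at `(1, 1)` and outside which `A` vanishes. A corner `q k` may have an infinite
coordinate if the matrix is infinite in that direction. -/
structure IsPositiveBlockChain (A : Matrix (Idx M) (Idx N) ℝ≥0) (K : ℕ∞)
    (p : ℕ → ℕ × ℕ) (q : ℕ → ℕ∞ × ℕ∞) : Prop where
  one_le : 1 ≤ K
  first : p 1 = (1, 1)
  corners : ∀ k : ℕ, 1 ≤ k → (k : ℕ∞) ≤ K →
    ((p k).1 : ℕ∞) ≤ (q k).1 ∧ (q k).1 ≤ M ∧ ((p k).2 : ℕ∞) ≤ (q k).2 ∧ (q k).2 ≤ N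
  step : ∀ k : ℕ, 1 ≤ k → ((k + 1 : ℕ) : ℕ∞) ≤ K →
    (q k).1 ≤ ((p (k + 1)).1 : ℕ∞) ∧ ((p (k + 1)).1 : ℕ∞) ≤ (q k).1 + 1 ∧
    (q k).2 ≤ ((p (k + 1)).2 : ℕ∞) ∧ ((p (k + 1)).2 : ℕ∞) ≤ (q k).2 + 1
  pos : ∀ k : ℕ, 1 ≤ k → (k : ℕ∞) ≤ K → ∀ s ∈ block M N (p k) (q k), 0 < A s.1 s.2
  zero : ∀ s : Idx M × Idx N,
    (∀ k : ℕ, 1 ≤ k → (k : ℕ∞) ≤ K → s ∉ block M N (p k) (q k)) → A s.1 s.2 = 0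

end TransportPath

end

/-!
Why a cycle-free transport path with a block-chain matrix is stair-shaped.

The idea is to redistribute the mass of `η_A` over the cells `Γ_{xᵢ,yⱼ}`, keeping `η_A` up to a
factor within each cell: `η_B = ∑ κᵢⱼ η_A⌞Γ_{xᵢ,yⱼ}` with `κᵢⱼ = bᵢⱼ / aᵢⱼ`, where `B` is the
north-west corner coupling of the row and column sums of `A`. Such a coupling is always
stair-shaped, and `η_B` has the marginals of `η_A` because `B` has those of `A`. What has to be shown
is that `η_B` is again a good decomposition of `T = τ(C, θ, ξ)`.

*Densities.* In a good decomposition there is no cancellation, so by strict convexity of the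
Euclidean norm the curves of each cell carry a current `τ(C, ρᵢⱼ θ, ξ)` with `0 ≤ ρᵢⱼ ≤ 1`
(`exists_density_of_add`, `IsGoodDecomposition.exists_density`), and `∑ ρᵢⱼ = 1` almost everywhere
(`IsGoodDecomposition.ae_tsum_density_eq_one`). The reweighted measure carries the current with
density `∑ κᵢⱼ ρᵢⱼ` (`IsGoodDecomposition.integral_reweight`).

*Cycle-freeness, first use.* Take four cells in the rows `i < i'` and the columns `j < j'` with
positive entries. Since `∂I_γ` only depends on the end points of `γ`
(`Curve.IsSimple.boundary_current`), the current with density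
`ρᵢⱼ/aᵢⱼ + ρᵢ'ⱼ'/aᵢ'ⱼ' - ρᵢⱼ'/aᵢⱼ' - ρᵢ'ⱼ/aᵢ'ⱼ` has no boundary. A small multiple of it is a
rectifiable current on `T` (`IsRectifiableRep.exists_isOn`), so it vanishes: at
almost every point of `C` the matrix `φᵢⱼ = ρᵢⱼ/aᵢⱼ` is modular on every such rectangle
(`IsGoodDecomposition.ae_density_modular`).

*Optimality of the north-west corner coupling.* It minimises `∑ bᵢⱼ φᵢⱼ` among the matrices with
given marginals, for every cost `φ` with the Monge property `φᵢⱼ + φᵢ'ⱼ' ≤ φᵢⱼ' + φᵢ'ⱼ`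
(`tsum_northWest_mul_le`). The hypothesis on the blocks implies that two positive entries of `A` in
antidiagonal position span a positive rectangle (`IsPositiveBlockChain.pos_of_antidiagonal`); hence
a cost that has the Monge property on the positive rectangles keeps it when it is set to `∞` on the
zeros of `A`, and `B` vanishes where `A` does (`exists_isStairShapedMatrix`). Applied pointwise to
`φᵢⱼ = ρᵢⱼ/aᵢⱼ` this gives `∑ κᵢⱼ ρᵢⱼ ≤ ∑ ρᵢⱼ = 1`.

*Cycle-freeness, second use.* So `T - ∫ I_γ dη_B` has the density `1 - ∑ κᵢⱼ ρᵢⱼ ∈ [0, 1]`, is a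
rectifiable current on `T`, and has no boundary, because `η_A` and `η_B` have the same marginals.
Therefore it vanishes and `∑ κᵢⱼ ρᵢⱼ = 1`, from which the properties of a good decomposition follow
(`IsGoodDecomposition.reweight`).
-/

noncomputable section

namespace TransportPath

variable {d : ℕ}

/-! ### The north-west corner coupling and Monge costs -/

/-- Partial sums `s 0 + ⋯ + s (n - 1)`. -/
def cum (s : ℕ → ℝ≥0∞) (n : ℕ) : ℝ≥0∞ := ∑ k ∈ Finset.range n, s k

lemma cum_mono (s : ℕ → ℝ≥0∞) : Monotone (cum s) := fun _ _ h =>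
  Finset.sum_le_sum_of_subset (Finset.range_mono h)

lemma cum_succ (s : ℕ → ℝ≥0∞) (n : ℕ) : cum s (n + 1) = cum s n + s n :=
  Finset.sum_range_succ _ _

lemma cum_zero (s : ℕ → ℝ≥0∞) : cum s 0 = 0 := rfl

lemma cum_le_tsum (s : ℕ → ℝ≥0∞) (n : ℕ) : cum s n ≤ ∑' k, s k := ENNReal.sum_le_tsum _

lemma sum_range_tsub_of_monotone {F : ℕ → ℝ≥0∞} (hF : Monotone F) (n : ℕ) :
    ∑ j ∈ Finset.range n, (F (j + 1) - F j) = F n - F 0 := by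
  induction n with
  | zero => simp
  | succ n ih =>
    rw [Finset.sum_range_succ, ih, add_comm]
    exact tsub_add_tsub_cancel (hF n.le_succ) (hF n.zero_le)

/-- The north-west corner coupling of two sequences of weights: lay the weights `r` and the
weights `c` end to end as consecutive intervals of the half line; the entry `(i, j)` is the length
of the overlap of the `i`-th interval of `r` with the `j`-th interval of `c`. -/
def northWest (r c : ℕ → ℝ≥0∞) (i j : ℕ) : ℝ≥0∞ :=
  min (cum r (i + 1)) (cum c (j + 1)) - max (cum r i) (cum c j)

lemma northWest_comm (r c : ℕ → ℝ≥0∞) (i j : ℕ) : northWest r c i j = northWest c r j i := by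
  simp only [northWest, min_comm, max_comm]

lemma min_sub_max_eq {u v s t : ℝ≥0∞} (huv : u ≤ v) (hst : s ≤ t) :
    min v t - max u s = min v (max u t) - min v (max u s) := by
  rcases le_total v s with h | h
  · have h1 : v ≤ max u s := le_max_of_le_right h
    have h2 : v ≤ max u t := le_max_of_le_right (h.trans hst)
    rw [min_eq_left h1, min_eq_left h2, tsub_self]
    exact tsub_eq_zero_of_le ((min_le_left _ _).trans h1)
  · rw [min_eq_right (max_le huv h)]
    rcases le_total u t with h' | h'
    · rw [max_eq_right h']
    · rw [max_eq_left h', max_eq_left (hst.trans h'), min_eq_right huv, tsub_self]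
      exact tsub_eq_zero_of_le ((min_le_right _ _).trans h')

lemma min_add_sub_eq (u v : ℝ≥0∞) : min u v + (u - v) = u := by
  rcases le_total u v with h | h
  · rw [min_eq_left h, tsub_eq_zero_of_le h, add_zero]
  · rw [min_eq_right h, add_tsub_cancel_of_le h]

lemma tsum_northWest {r c : ℕ → ℝ≥0∞} (h : ∑' k, r k = ∑' k, c k) (hfin : ∑' k, r k ≠ ∞)
    (i : ℕ) : ∑' j, northWest r c i j = r i := by
  set F : ℕ → ℝ≥0∞ := fun j => min (cum r (i + 1)) (max (cum r i) (cum c j)) with hF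
  have hmono : Monotone F := fun a b hab =>
    min_le_min le_rfl (max_le_max le_rfl (cum_mono c hab))
  have hlim : Tendsto F atTop (𝓝 (min (cum r (i + 1)) (max (cum r i) (∑' k, c k)))) :=
    tendsto_const_nhds.min (tendsto_const_nhds.max (ENNReal.tendsto_nat_tsum c))
  have htop : min (cum r (i + 1)) (max (cum r i) (∑' k, c k)) = cum r (i + 1) :=
    min_eq_left (le_max_of_le_right (h ▸ cum_le_tsum r _))
  have h0 : F 0 = cum r i := by
    simp [hF, cum_zero, cum_mono r (Nat.le_succ i)]
  have hsum : ∀ n, ∑ j ∈ Finset.range n, northWest r c i j = F n - F 0 := fun n => by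
    rw [← sum_range_tsub_of_monotone hmono]
    exact Finset.sum_congr rfl fun j _ =>
      min_sub_max_eq (cum_mono r (Nat.le_succ i)) (cum_mono c (Nat.le_succ j))
  have hne : cum r i ≠ ∞ := ne_top_of_le_ne_top hfin (cum_le_tsum r i)
  have hlim' : Tendsto (fun n => F n - F 0) atTop (𝓝 (r i)) := by
    have := ENNReal.Tendsto.sub hlim (tendsto_const_nhds (x := F 0)) (Or.inr (h0 ▸ hne))
    rw [htop, cum_succ] at this
    rwa [h0, ENNReal.add_sub_cancel_left hne, ← h0] at this
  refine tendsto_nhds_unique (ENNReal.tendsto_nat_tsum _) ?_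
  simpa only [hsum] using hlim'

lemma northWest_pos_iff {r c : ℕ → ℝ≥0∞} {i j : ℕ} :
    0 < northWest r c i j ↔ max (cum r i) (cum c j) < min (cum r (i + 1)) (cum c (j + 1)) :=
  tsub_pos_iff_lt

/-- No two positive entries of the north-west corner coupling are in antidiagonal position. -/
lemma northWest_not_antidiagonal {r c : ℕ → ℝ≥0∞} {i j i' j' : ℕ} (hi : i < i') (hj : j < j')
    (h : 0 < northWest r c i j') (h' : 0 < northWest r c i' j) : False := by
  rw [northWest_pos_iff, max_lt_iff, lt_min_iff, lt_min_iff] at h h'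
  have h1 := h.2.1
  have h2 := h'.1.2
  exact absurd (h2.trans_le (cum_mono c hj)) (not_lt.2 ((h1.le).trans (cum_mono r hi)))

lemma northWest_zero_left {r c : ℕ → ℝ≥0∞} (j : ℕ) :
    northWest r c 0 j = min (r 0) (cum c (j + 1)) - min (r 0) (cum c j) := by
  rw [northWest, min_sub_max_eq (cum_mono r (Nat.le_succ 0)) (cum_mono c (Nat.le_succ j))]
  simp [cum]

lemma cum_northWest_zero (r c : ℕ → ℝ≥0∞) (n : ℕ) :
    cum (northWest r c 0) n = min (r 0) (cum c n) := by
  have hmono : Monotone fun n => min (r 0) (cum c n) := fun a b hab =>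
    min_le_min le_rfl (cum_mono c hab)
  change ∑ j ∈ Finset.range n, northWest r c 0 j = _
  simp only [northWest_zero_left]
  rw [sum_range_tsub_of_monotone (F := fun n => min (r 0) (cum c n)) hmono]
  simp [cum]

/-- Removing the first row of the north-west corner coupling leaves the north-west corner coupling
of the remaining weights. -/
lemma northWest_succ {r c c' : ℕ → ℝ≥0∞} (hr : r 0 ≠ ∞)
    (hc : ∀ j, c j = northWest r c 0 j + c' j) (i j : ℕ) :
    northWest (fun k => r (k + 1)) c' i j = northWest r c (i + 1) j := by
  have hR : ∀ n, cum r (n + 1) = r 0 + cum (fun k => r (k + 1)) n := fun n => by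
    simp only [cum, Finset.sum_range_succ', add_comm]
  have hC : ∀ n, cum c n = min (r 0) (cum c n) + cum c' n := fun n => by
    rw [← cum_northWest_zero r c n]
    simp only [cum, ← Finset.sum_add_distrib]
    exact Finset.sum_congr rfl fun j _ => hc j
  have hC0 : ∀ n, cum c n ≤ r 0 → cum c' n = 0 := fun n hn => by
    have h := hC n
    rw [min_eq_right hn] at h
    have hne : cum c n ≠ ∞ := ne_top_of_le_ne_top hr hn
    simpa using (ENNReal.add_right_inj hne).1 ((add_zero _).trans h).symm
  have hC1 : ∀ n, r 0 ≤ cum c n → cum c n = r 0 + cum c' n := fun n hn => by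
    have h := hC n
    rwa [min_eq_left hn] at h
  have hmax : max (cum r (i + 1)) (cum c j) =
      r 0 + max (cum (fun k => r (k + 1)) i) (cum c' j) := by
    rw [hR]
    rcases le_total (cum c j) (r 0) with h | h
    · rw [hC0 j h, max_eq_left (h.trans le_self_add), max_eq_left zero_le]
    · rw [hC1 j h, ← max_add_add_left]
  rw [northWest, northWest, hmax, hR]
  rcases le_total (cum c (j + 1)) (r 0) with h | h
  · rw [hC0 _ h, tsub_eq_zero_of_le ((min_le_right _ _).trans zero_le)]
    exact (tsub_eq_zero_of_le ((min_le_right _ _).trans (h.trans le_self_add))).symm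
  · rw [hC1 _ h, min_add_add_left, ENNReal.add_sub_add_eq_sub_left hr]

/-- A cost satisfies the Monge condition if untangling an antidiagonal pair of positions does not
increase it. The value `∞` marks forbidden positions. -/
def IsMonge (c : ℕ → ℕ → ℝ≥0∞) : Prop :=
  ∀ ⦃i i' j j'⦄, i < i' → j < j' → c i j + c i' j' ≤ c i j' + c i' j

/-- One step of the north-west corner rule: a matrix `a` can be changed by exchanges of mass
between antidiagonal and diagonal positions, which do not increase a Monge cost, so that its first
row becomes the first row of the north-west corner coupling. The matrix `a'` is what remains below
that row. -/
lemma exists_peel_row {a : ℕ → ℕ → ℝ≥0∞} (hfin : ∑' i, ∑' j, a i j ≠ ∞)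
    {cost : ℕ → ℕ → ℝ≥0∞} (hcost : IsMonge cost) :
    ∃ a' : ℕ → ℕ → ℝ≥0∞, (∀ i, ∑' j, a' i j = ∑' j, a (i + 1) j) ∧
      (∀ j, ∑' i, a i j =
        northWest (fun i => ∑' j, a i j) (fun j => ∑' i, a i j) 0 j + ∑' i, a' i j) ∧
      ∑' j, northWest (fun i => ∑' j, a i j) (fun j => ∑' i, a i j) 0 j * cost 0 j +
        ∑' i, ∑' j, a' i j * cost (i + 1) j ≤ ∑' i, ∑' j, a i j * cost i j := by
  set r : ℕ → ℝ≥0∞ := fun i => ∑' j, a i j with hr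
  set c : ℕ → ℝ≥0∞ := fun j => ∑' i, a i j with hc
  have hrc : ∑' i, r i = ∑' j, c j := ENNReal.tsum_comm
  set b : ℕ → ℝ≥0∞ := northWest r c 0 with hb
  have hrfin : ∑' i, r i ≠ ∞ := hfin
  have hr0 : r 0 ≠ ∞ := ne_top_of_le_ne_top hfin (ENNReal.le_tsum 0)
  have hbsum : ∑' j, b j = r 0 := tsum_northWest hrc hrfin 0
  set h : ℕ → ℝ≥0∞ := fun j => ∑' i, a (i + 1) j with hh
  have hch : ∀ j, c j = a 0 j + h j := fun j => tsum_eq_zero_add' ENNReal.summable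
  have hcfin : ∀ j, c j ≠ ∞ := fun j => ne_top_of_le_ne_top (hrc ▸ hfin) (ENNReal.le_tsum j)
  have hhfin : ∀ j, h j ≠ ∞ := fun j =>
    ne_top_of_le_ne_top (hcfin j) (by rw [hch]; exact le_add_self)
  have ha0fin : ∀ j, a 0 j ≠ ∞ := fun j =>
    ne_top_of_le_ne_top (hcfin j) (by rw [hch]; exact le_self_add)
  have hbc : ∀ j, b j ≤ c j := fun j => by
    rw [← tsum_northWest hrc.symm (hrc ▸ hrfin) j]
    simp only [northWest_comm c r j]
    exact ENNReal.le_tsum (f := fun i => northWest r c i j) 0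
  -- the deficit and the surplus of the first row against its target `b`; both have the total `g`
  set G : ℕ → ℝ≥0∞ := fun j => b j - a 0 j with hG
  set D : ℕ → ℝ≥0∞ := fun j => a 0 j - b j with hD
  have hGD : ∀ j, a 0 j + G j = b j + D j := fun j => by
    simp only [hG, hD, add_tsub_eq_max, max_comm]
  have hGh : ∀ j, G j ≤ h j := fun j => tsub_le_iff_left.2 (hch j ▸ hbc j)
  have hGfin : ∀ j, G j ≠ ∞ := fun j => ne_top_of_le_ne_top (hhfin j) (hGh j)
  set g := ∑' j, G j with hg
  have hgD : g = ∑' j, D j := by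
    have h1 : r 0 + g = r 0 + ∑' j, D j := by
      conv_rhs => rw [← hbsum, ← ENNReal.tsum_add]
      rw [hr, hg, ← ENNReal.tsum_add]
      exact tsum_congr hGD
    exact (ENNReal.add_right_inj hr0).1 h1
  have hgfin : g ≠ ∞ := by
    refine ne_top_of_le_ne_top hr0 ?_
    rw [← hbsum]
    exact ENNReal.tsum_le_tsum fun j => tsub_le_self
  -- the share of column `j` in the surplus
  set e : ℕ → ℝ≥0∞ := fun j => D j / g with he
  have hge : ∀ j, g * e j = D j := fun j => by
    rcases eq_or_ne g 0 with h0 | h0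
    · have : D j = 0 := ENNReal.tsum_eq_zero.1 (hgD ▸ h0) j
      simp [h0, this]
    · exact ENNReal.mul_div_cancel h0 hgfin
  have hsume : ∀ x, x ≤ g → x * ∑' j, e j = x := fun x hx => by
    rcases eq_or_ne g 0 with h0 | h0
    · have : x = 0 := le_antisymm (h0 ▸ hx) zero_le
      simp [this]
    · simp only [he, div_eq_mul_inv]
      rw [ENNReal.tsum_mul_right, ← hgD, ENNReal.mul_inv_cancel h0 hgfin, mul_one]
  -- the rows below cover the deficit of each column in proportion to their entries in it; the row
  -- that gives up the total `s i` gets it back from the surplus, divided according to `e`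
  set q : ℕ → ℕ → ℝ≥0∞ := fun i j => a (i + 1) j * (G j / h j) with hq
  have hqsum : ∀ j, ∑' i, q i j = G j := fun j => by
    rw [ENNReal.tsum_mul_right]
    rcases eq_or_ne (h j) 0 with h0 | h0
    · have : G j = 0 := le_antisymm (h0 ▸ hGh j) zero_le
      simp [this]
    · exact ENNReal.mul_div_cancel h0 (hhfin j)
  have hqa : ∀ i j, q i j ≤ a (i + 1) j := fun i j =>
    mul_le_of_le_one_right' (ENNReal.div_le_of_le_mul (by simpa using hGh j))
  set s : ℕ → ℝ≥0∞ := fun i => ∑' k, q i k with hs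
  have hssum : ∑' i, s i = g := by
    rw [hs, ENNReal.tsum_comm]
    exact tsum_congr hqsum
  refine ⟨fun i j => (a (i + 1) j - q i j) + s i * e j, fun i => ?_, fun j => ?_, ?_⟩
  · rw [ENNReal.tsum_add, ENNReal.tsum_mul_left, hsume _ (hssum ▸ ENNReal.le_tsum i), hs,
      ← ENNReal.tsum_add]
    exact tsum_congr fun j => tsub_add_cancel_of_le (hqa i j)
  · have h1 : ∑' i, (a (i + 1) j - q i j) = h j - G j := by
      rw [ENNReal.tsum_sub (by rw [hqsum]; exact hGfin j) (fun i => hqa i j), hqsum]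
    rw [ENNReal.tsum_add, ENNReal.tsum_mul_right, hssum, hge, h1, ← add_assoc, add_right_comm,
      ← hGD, add_assoc, add_tsub_cancel_of_le (hGh j)]
    exact hch j
  · have hkey : ∀ i k j, q i k * e j * cost 0 k + q i k * e j * cost (i + 1) j ≤
        q i k * e j * cost 0 j + q i k * e j * cost (i + 1) k := fun i k j => by
      rw [← mul_add, ← mul_add]
      rcases eq_or_ne (q i k * e j) 0 with h0 | h0
      · simp [h0]
      -- mass leaves the first row in column `j` only beyond every column `k` where it arrives
      · have hGk : 0 < b k - a 0 k := pos_iff_ne_zero.2 fun hz => h0 (by simp [hq, hG, hz])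
        have hDj : 0 < a 0 j - b j := pos_iff_ne_zero.2 fun hz => h0 (by simp [he, hD, hz])
        rw [tsub_pos_iff_lt] at hGk hDj
        have hck : cum c k < r 0 := by
          have : 0 < b k := zero_le.trans_lt hGk
          rw [hb, northWest_pos_iff, max_lt_iff, lt_min_iff, lt_min_iff] at this
          simpa [cum] using this.2.1
        have hcj : r 0 < cum c (j + 1) := by
          by_contra hcon
          rw [not_lt] at hcon
          have hbj : b j = c j := by
            have hne : cum c j ≠ ∞ := ne_top_of_le_ne_top hr0
              ((cum_mono c (Nat.le_succ j)).trans hcon)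
            rw [hb, northWest_zero_left, min_eq_right hcon,
              min_eq_right ((cum_mono c (Nat.le_succ j)).trans hcon), cum_succ,
              ENNReal.add_sub_cancel_left hne]
          exact absurd hDj (not_lt.2 (by rw [hbj, hch]; exact le_self_add))
        have hkj : k ≤ j := by
          by_contra hcon
          exact absurd (hck.trans hcj) (not_lt.2 (cum_mono c (not_le.1 hcon)))
        have hne : k ≠ j := fun hkj' => lt_asymm hGk (hkj' ▸ hDj)
        exact mul_le_mul_right (hcost (Nat.succ_pos i) (lt_of_le_of_ne hkj hne)) _
    have hA : ∑' i, ∑' j, a i j * cost i j =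
        ∑' j, a 0 j * cost 0 j + ∑' i, ∑' j, a (i + 1) j * cost (i + 1) j :=
      tsum_eq_zero_add' ENNReal.summable
    have hsplit0 : ∀ j, a 0 j * cost 0 j = min (a 0 j) (b j) * cost 0 j + D j * cost 0 j :=
      fun j => by rw [← add_mul, hD]; congr 1; exact (min_add_sub_eq _ _).symm
    have hsplitb : ∀ j, b j * cost 0 j = min (a 0 j) (b j) * cost 0 j + G j * cost 0 j :=
      fun j => by rw [← add_mul, hG, min_comm]; congr 1; exact (min_add_sub_eq _ _).symm
    have hsplit1 : ∀ i j, a (i + 1) j * cost (i + 1) j =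
        (a (i + 1) j - q i j) * cost (i + 1) j + q i j * cost (i + 1) j :=
      fun i j => by rw [← add_mul, tsub_add_cancel_of_le (hqa i j)]
    -- the four sums over all exchanges
    have h1 : ∑' i, ∑' k, ∑' j, q i k * e j * cost 0 k = ∑' k, G k * cost 0 k := by
      rw [ENNReal.tsum_comm]
      refine tsum_congr fun k => ?_
      calc _ = (∑' i, q i k) * (∑' j, e j) * cost 0 k := by
            rw [← ENNReal.tsum_mul_right, ← ENNReal.tsum_mul_right]
            exact tsum_congr fun i => by rw [ENNReal.tsum_mul_right, ENNReal.tsum_mul_left]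
        _ = _ := by rw [hqsum, hsume _ (ENNReal.le_tsum k)]
    have h2 : ∑' i, ∑' k, ∑' j, q i k * e j * cost (i + 1) j =
        ∑' i, ∑' j, s i * e j * cost (i + 1) j := by
      refine tsum_congr fun i => ?_
      rw [ENNReal.tsum_comm]
      simp_rw [ENNReal.tsum_mul_right, hs]
    have h3 : ∑' i, ∑' k, ∑' j, q i k * e j * cost 0 j = ∑' j, D j * cost 0 j := by
      simp_rw [mul_assoc, ENNReal.tsum_mul_left, ENNReal.tsum_mul_right]
      change (∑' i, s i) * _ = _
      rw [hssum, ← ENNReal.tsum_mul_left]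
      simp_rw [← mul_assoc, hge]
    have h4 : ∑' i, ∑' k, ∑' j, q i k * e j * cost (i + 1) k =
        ∑' i, ∑' k, q i k * cost (i + 1) k := by
      refine tsum_congr fun i => tsum_congr fun k => ?_
      rw [ENNReal.tsum_mul_right, ENNReal.tsum_mul_left, hsume]
      exact (ENNReal.le_tsum (f := fun i => q i k) i).trans
        ((hqsum k).le.trans (ENNReal.le_tsum k))
    have hsum : ∑' k, G k * cost 0 k + ∑' i, ∑' j, s i * e j * cost (i + 1) j ≤
        ∑' j, D j * cost 0 j + ∑' i, ∑' k, q i k * cost (i + 1) k := by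
      rw [← h1, ← h2, ← h3, ← h4]
      simp_rw [← ENNReal.tsum_add]
      exact ENNReal.tsum_le_tsum fun i => ENNReal.tsum_le_tsum fun k =>
        ENNReal.tsum_le_tsum fun j => hkey i k j
    rw [hA]
    simp_rw [hsplit0, hsplitb, hsplit1, add_mul, ENNReal.tsum_add]
    calc _ = (∑' j, min (a 0 j) (b j) * cost 0 j +
            ∑' i, ∑' j, (a (i + 1) j - q i j) * cost (i + 1) j) +
          (∑' k, G k * cost 0 k + ∑' i, ∑' j, s i * e j * cost (i + 1) j) := by abel
      _ ≤ _ := add_le_add_right hsum _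
      _ = _ := by abel

/-- Iteration of `exists_peel_row`: the first `n` rows of the north-west corner coupling cost at
most as much as the whole matrix. -/
lemma sum_northWest_mul_le (n : ℕ) : ∀ (a cost : ℕ → ℕ → ℝ≥0∞), ∑' i, ∑' j, a i j ≠ ∞ →
    IsMonge cost → ∑ i ∈ Finset.range n,
      ∑' j, northWest (fun i => ∑' j, a i j) (fun j => ∑' i, a i j) i j * cost i j ≤
      ∑' i, ∑' j, a i j * cost i j := by
  induction n with
  | zero => intro a cost _ _; simp
  | succ n ih =>
    intro a cost hfin hcost
    obtain ⟨a', hrow, hcol, hle⟩ := exists_peel_row hfin hcost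
    have hfin' : ∑' i, ∑' j, a' i j ≠ ∞ := by
      simp_rw [hrow]
      exact ne_top_of_le_ne_top hfin
        (ENNReal.tsum_comp_le_tsum_of_injective (add_left_injective 1) _)
    have hr0 : (∑' j, a 0 j) ≠ ∞ :=
      ne_top_of_le_ne_top hfin (ENNReal.le_tsum (f := fun i => ∑' j, a i j) 0)
    have hih := ih a' (fun i j => cost (i + 1) j) hfin' fun i i' j j' hi hj =>
      hcost (Nat.succ_lt_succ hi) hj
    rw [Finset.sum_range_succ', add_comm]
    refine le_trans (add_le_add_right ?_ _) hle
    refine le_trans (le_of_eq ?_) hih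
    refine Finset.sum_congr rfl fun i _ => tsum_congr fun j => ?_
    congr 1
    simp_rw [hrow]
    exact (northWest_succ (r := fun i => ∑' j, a i j) hr0 hcol i j).symm

/-- The north-west corner coupling has the least cost among all matrices with the same marginals,
for every Monge cost. -/
theorem tsum_northWest_mul_le {a cost : ℕ → ℕ → ℝ≥0∞} (hfin : ∑' i, ∑' j, a i j ≠ ∞)
    (hcost : IsMonge cost) :
    ∑' i, ∑' j, northWest (fun i => ∑' j, a i j) (fun j => ∑' i, a i j) i j * cost i j ≤
      ∑' i, ∑' j, a i j * cost i j := by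
  rw [ENNReal.tsum_eq_iSup_nat]
  exact iSup_le fun n => sum_northWest_mul_le n a cost hfin hcost

/-! ### Stair-shaped matrices and block chains -/

/-- One step of the stair path through a set `P` of positions: down if no position of `P` is left
in the current row to the right of the current column, and to the right otherwise. -/
def stairStep (M : ℕ∞) (P : ℕ → ℕ → Prop) (s : ℕ × ℕ) : ℕ × ℕ :=
  open scoped Classical in
  if ((s.1 + 1 : ℕ) : ℕ∞) ≤ M ∧ ∀ j, s.2 < j → ¬ P s.1 j then (s.1 + 1, s.2) else (s.1, s.2 + 1)

/-- The stair path through `P` that starts at the position `(1, 1)`. -/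
def stairPath (M : ℕ∞) (P : ℕ → ℕ → Prop) (n : ℕ) : ℕ × ℕ := (stairStep M P)^[n] (1, 1)

lemma stairPath_succ (M : ℕ∞) (P : ℕ → ℕ → Prop) (n : ℕ) :
    stairPath M P (n + 1) = stairStep M P (stairPath M P n) :=
  Function.iterate_succ_apply' _ _ _

lemma stairPath_mono (M : ℕ∞) (P : ℕ → ℕ → Prop) : Monotone (stairPath M P) :=
  monotone_nat_of_le_succ fun n => by
    rw [stairPath_succ, stairStep]
    split_ifs
    · exact ⟨Nat.le_succ _, le_rfl⟩
    · exact ⟨le_rfl, Nat.le_succ _⟩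

/-- As long as it has not left the `M × N` matrix, the stair path has passed no position of `P`
on its upper right or lower left side, provided that `P` has no antidiagonal pairs. -/
lemma stairPath_spec {M N : ℕ∞} {P : ℕ → ℕ → Prop} (hM : 1 ≤ M) (hN : 1 ≤ N)
    (hP : ∀ i j, P i j → 1 ≤ i ∧ (i : ℕ∞) ≤ M ∧ 1 ≤ j ∧ (j : ℕ∞) ≤ N)
    (hanti : ∀ i j i' j', i < i' → j < j' → P i j' → P i' j → False) (n : ℕ)
    (hn : ((n + 2 : ℕ) : ℕ∞) ≤ M + N) :
    1 ≤ (stairPath M P n).1 ∧ ((stairPath M P n).1 : ℕ∞) ≤ M ∧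
    1 ≤ (stairPath M P n).2 ∧ ((stairPath M P n).2 : ℕ∞) ≤ N ∧
    (stairPath M P n).1 + (stairPath M P n).2 = n + 2 ∧
    ∀ i j, P i j → (i < (stairPath M P n).1 → j ≤ (stairPath M P n).2) ∧
      (j < (stairPath M P n).2 → i ≤ (stairPath M P n).1) := by
  induction n with
  | zero =>
    refine ⟨le_rfl, by simpa [stairPath] using hM, le_rfl, by simpa [stairPath] using hN, rfl, ?_⟩
    intro i j hij
    have hi := (hP i j hij).1
    have hj := (hP i j hij).2.2.1
    simp only [stairPath, Function.iterate_zero, id]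
    omega
  | succ n ih =>
    have hn' : ((n + 2 : ℕ) : ℕ∞) ≤ M + N := le_trans (by exact_mod_cast Nat.le_succ _) hn
    obtain ⟨h1, h2, h3, h4, h5, h6⟩ := ih hn'
    rw [stairPath_succ]
    generalize stairPath M P n = s at h1 h2 h3 h4 h5 h6
    obtain ⟨r, c⟩ := s
    simp only at h1 h2 h3 h4 h5 h6
    rw [stairStep]
    split_ifs with h
    · refine ⟨by simp, h.1, h3, h4, by simp only; omega,
        fun i j hij => ⟨fun hi => ?_, fun hj => ?_⟩⟩
      · rcases Nat.lt_succ_iff_lt_or_eq.1 hi with hi | rfl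
        · exact (h6 i j hij).1 hi
        · by_contra hcon
          exact h.2 j (not_le.1 hcon) hij
      · exact ((h6 i j hij).2 hj).trans (Nat.le_succ _)
    · have hcN : ((c + 1 : ℕ) : ℕ∞) ≤ N := by
        rw [not_and_or] at h
        rcases h with h | h
        · have hr : M = r := le_antisymm (by
            rw [not_le] at h
            exact (ENat.lt_add_one_iff (ENat.natCast_ne_top r)).1 (by exact_mod_cast h)) h2
          rw [hr] at hn
          have : ((r + (c + 1) : ℕ) : ℕ∞) ≤ r + N := le_trans (by norm_cast; omega) hn
          push_cast at this
          have := (ENat.add_le_add_iff_left (ENat.natCast_ne_top r)).1 this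
          exact_mod_cast this
        · push Not at h
          obtain ⟨j, hj, hPj⟩ := h
          exact le_trans (by exact_mod_cast hj) (hP _ _ hPj).2.2.2
      refine ⟨h1, h2, by simp, hcN, by simp only; omega,
        fun i j hij => ⟨fun hi => ?_, fun hj => ?_⟩⟩
      · exact ((h6 i j hij).1 hi).trans (Nat.le_succ _)
      · rcases Nat.lt_succ_iff_lt_or_eq.1 hj with hj | rfl
        · exact (h6 i j hij).2 hj
        · by_contra hcon
          rw [not_le] at hcon
          rw [not_and_or] at h
          rcases h with h | h
          · exact h (le_trans (by exact_mod_cast hcon) (hP _ _ hij).2.1)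
          · push Not at h
            obtain ⟨j', hj', hPj'⟩ := h
            exact hanti _ _ _ _ hcon hj' hPj' hij

/-- A matrix whose support has no antidiagonal pairs is stair-shaped. -/
lemma isStairShapedMatrix_of_not_antidiagonal {M N : ℕ∞} (hM : 1 ≤ M) (hN : 1 ≤ N)
    {B : Matrix (Idx M) (Idx N) ℝ≥0}
    (hB : ∀ i j i' j', i < i' → j < j' → 0 < B i j' → 0 < B i' j → False) :
    IsStairShapedMatrix B := by
  set P : ℕ → ℕ → Prop := fun i j => ∃ (i' : Idx M) (j' : Idx N), i'.1 = i ∧ j'.1 = j ∧ 0 < B i' j'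
    with hPdef
  have hP : ∀ i j, P i j → 1 ≤ i ∧ (i : ℕ∞) ≤ M ∧ 1 ≤ j ∧ (j : ℕ∞) ≤ N := by
    rintro _ _ ⟨i, j, rfl, rfl, _⟩
    exact ⟨i.2.1, i.2.2, j.2.1, j.2.2⟩
  have hanti : ∀ i j i' j', i < i' → j < j' → P i j' → P i' j → False := by
    rintro _ _ _ _ hi hj ⟨i, j', rfl, rfl, h⟩ ⟨i', j, rfl, rfl, h'⟩
    exact hB i j i' j' hi hj h h'
  have hspec : ∀ k ∈ stairIndices M N, _ := fun k hk =>
    stairPath_spec (P := P) hM hN hP hanti (k - 1) (by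
      have h1 : 1 ≤ k := hk.1
      have h2 : ((k + 1 : ℕ) : ℕ∞) ≤ M + N := by exact_mod_cast hk.2
      rwa [show k - 1 + 2 = k + 1 by omega])
  refine ⟨fun k => (stairPath M P (k - 1)).1, fun k => (stairPath M P (k - 1)).2,
    fun a _ b _ hab => (stairPath_mono M P (Nat.sub_le_sub_right hab 1)).1,
    fun a _ b _ hab => (stairPath_mono M P (Nat.sub_le_sub_right hab 1)).2,
    fun k hk => ?_, fun i j hij => ?_⟩
  · obtain ⟨h1, h2, h3, h4, h5, -⟩ := hspec k hk
    have := hk.1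
    exact ⟨h1, h2, h3, h4, by simp only; omega⟩
  · by_contra hne
    have hi := i.2.1
    have hj := j.2.1
    have hk : i.1 + j.1 - 1 ∈ stairIndices M N := by
      refine ⟨by omega, ?_⟩
      have : ((i.1 + j.1 - 1 + 1 : ℕ) : ℕ∞) ≤ M + N := by
        rw [show i.1 + j.1 - 1 + 1 = i.1 + j.1 by omega]
        push_cast
        exact add_le_add i.2.2 j.2.2
      exact_mod_cast this
    obtain ⟨-, -, -, -, h5, h6⟩ := hspec _ hk
    have h7 := h6 i.1 j.1 ⟨i, j, rfl, rfl, pos_iff_ne_zero.2 hne⟩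
    refine hij _ hk (Prod.ext ?_ ?_) <;> simp only <;> omega

/-- In a chain of positive blocks, the corners of the rectangle spanned by an antidiagonal pair of
positive entries are positive, because such a pair lies in a single block. -/
lemma IsPositiveBlockChain.pos_of_antidiagonal {M N : ℕ∞} {A : Matrix (Idx M) (Idx N) ℝ≥0}
    {K : ℕ∞} {p : ℕ → ℕ × ℕ} {q : ℕ → ℕ∞ × ℕ∞} (h : IsPositiveBlockChain A K p q)
    {i i' : Idx M} {j j' : Idx N} (hi : i < i') (hj : j < j') (h1 : 0 < A i j')
    (h2 : 0 < A i' j) : 0 < A i j ∧ 0 < A i' j' := by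
  have hmono : ∀ k l : ℕ, 1 ≤ k → k + 1 ≤ l → (l : ℕ∞) ≤ K →
      (q k).1 ≤ ((p l).1 : ℕ∞) ∧ (q k).2 ≤ ((p l).2 : ℕ∞) := by
    intro k l hk hkl
    induction l, hkl using Nat.le_induction with
    | base => exact fun hl => ⟨(h.step k hk hl).1, (h.step k hk hl).2.2.1⟩
    | succ l hl ih =>
      intro hlK
      have hlK' : (l : ℕ∞) ≤ K := le_trans (by exact_mod_cast Nat.le_succ l) hlK
      have ih' := ih hlK'
      have hc := h.corners l (by omega) hlK'
      have hs := h.step l (by omega) hlK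
      exact ⟨ih'.1.trans (hc.1.trans hs.1), ih'.2.trans (hc.2.2.1.trans hs.2.2.1)⟩
  have hex : ∀ s : Idx M × Idx N, 0 < A s.1 s.2 →
      ∃ k : ℕ, 1 ≤ k ∧ (k : ℕ∞) ≤ K ∧ s ∈ block M N (p k) (q k) := by
    intro s hs
    by_contra hcon
    push Not at hcon
    exact hs.ne' (h.zero s hcon)
  obtain ⟨k, hk, hkK, hk1, hk2, hk3, hk4⟩ := hex (i, j') h1
  obtain ⟨l, hl, hlK, hl1, hl2, hl3, hl4⟩ := hex (i', j) h2
  simp only at hk1 hk2 hk3 hk4 hl1 hl2 hl3 hl4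
  have hi' : i.1 < i'.1 := hi
  have hj' : j.1 < j'.1 := hj
  obtain hkl | rfl | hkl := lt_trichotomy k l
  · have h3 : (j'.1 : ℕ∞) ≤ (j.1 : ℕ∞) :=
      hk4.trans ((hmono k l hk hkl hlK).2.trans (by exact_mod_cast hl3))
    have h4 : j'.1 ≤ j.1 := by exact_mod_cast h3
    omega
  · refine ⟨h.pos k hk hkK (i, j) ⟨hk1, hk2, hl3, hl4⟩,
      h.pos k hk hkK (i', j') ⟨hl1, hl2, hk3, hk4⟩⟩
  · have h3 : (i'.1 : ℕ∞) ≤ (i.1 : ℕ∞) :=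
      hl2.trans ((hmono l k hl hkl hkK).1.trans (by exact_mod_cast hk1))
    have h4 : i'.1 ≤ i.1 := by exact_mod_cast h3
    omega

/-- A family indexed by `Idx M`, extended by zero to all of `ℕ`. -/
def extendZero {M : ℕ∞} {α : Type*} [Zero α] (f : Idx M → α) : ℕ → α :=
  Function.extend Subtype.val f 0

lemma extendZero_coe {M : ℕ∞} {α : Type*} [Zero α] (f : Idx M → α) (i : Idx M) :
    extendZero f i.1 = f i := Subtype.val_injective.extend_apply _ _ _

lemma extendZero_of_not {M : ℕ∞} {α : Type*} [Zero α] (f : Idx M → α) {i : ℕ}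
    (h : ¬ ∃ k : Idx M, k.1 = i) : extendZero f i = 0 := Function.extend_apply' _ _ _ h

lemma tsum_nat_eq_tsum_idx {M : ℕ∞} {F : ℕ → ℝ≥0∞} (h : ∀ i, (¬ ∃ k : Idx M, k.1 = i) → F i = 0) :
    ∑' i, F i = ∑' i : Idx M, F i.1 := by
  refine (Subtype.val_injective.tsum_eq fun i hi => ?_).symm
  by_contra hcon
  exact hi (h i fun ⟨k, hk⟩ => hcon ⟨k, hk⟩)

/-- A nonnegative matrix of finite total mass in which antidiagonal pairs of positive entries span
positive rectangles can be replaced by a stair-shaped matrix with the same marginals and a smaller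
support, which does not increase any cost that is Monge on the support. -/
theorem exists_isStairShapedMatrix {M N : ℕ∞} (hM : 1 ≤ M) (hN : 1 ≤ N)
    {A : Matrix (Idx M) (Idx N) ℝ≥0} (hfin : ∑' i, ∑' j, (A i j : ℝ≥0∞) ≠ ∞)
    (hA : ∀ i i' j j', i < i' → j < j' → 0 < A i j' → 0 < A i' j → 0 < A i j ∧ 0 < A i' j') :
    ∃ B : Matrix (Idx M) (Idx N) ℝ≥0, IsStairShapedMatrix B ∧
      (∀ i, ∑' j, (B i j : ℝ≥0∞) = ∑' j, (A i j : ℝ≥0∞)) ∧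
      (∀ j, ∑' i, (B i j : ℝ≥0∞) = ∑' i, (A i j : ℝ≥0∞)) ∧
      (∀ i j, A i j = 0 → B i j = 0) ∧
      ∀ φ : Idx M → Idx N → ℝ≥0∞,
        (∀ i i' j j', i < i' → j < j' → 0 < A i j → 0 < A i j' → 0 < A i' j → 0 < A i' j' →
          φ i j + φ i' j' ≤ φ i j' + φ i' j) →
        ∑' i, ∑' j, B i j * φ i j ≤ ∑' i, ∑' j, A i j * φ i j := by
  set a : ℕ → ℕ → ℝ≥0∞ := extendZero fun i => extendZero fun j => (A i j : ℝ≥0∞) with ha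
  have ha1 : ∀ (i : Idx M) (j : Idx N), a i.1 j.1 = A i j := fun i j => by
    rw [ha, extendZero_coe, extendZero_coe]
  have hai : ∀ i j, (¬ ∃ k : Idx M, k.1 = i) → a i j = 0 := fun i j h => by
    rw [ha, extendZero_of_not _ h]; rfl
  have haj : ∀ i j, (¬ ∃ k : Idx N, k.1 = j) → a i j = 0 := fun i j h => by
    by_cases hi : ∃ k : Idx M, k.1 = i
    · obtain ⟨k, rfl⟩ := hi
      rw [ha, extendZero_coe, extendZero_of_not _ h]
    · exact hai i j hi
  have hrow : ∀ i : Idx M, ∑' j, a i.1 j = ∑' j, (A i j : ℝ≥0∞) := fun i => by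
    rw [tsum_nat_eq_tsum_idx fun j hj => haj i.1 j hj]
    exact tsum_congr fun j => ha1 i j
  have hcol : ∀ j : Idx N, ∑' i, a i j.1 = ∑' i, (A i j : ℝ≥0∞) := fun j => by
    rw [tsum_nat_eq_tsum_idx fun i hi => hai i j.1 hi]
    exact tsum_congr fun i => ha1 i j
  have htot : ∑' i, ∑' j, a i j ≠ ∞ := by
    rw [tsum_nat_eq_tsum_idx (M := M) fun i hi => by simp [hai i _ hi]]
    simp_rw [hrow]
    exact hfin
  set r : ℕ → ℝ≥0∞ := fun i => ∑' j, a i j with hr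
  set c : ℕ → ℝ≥0∞ := fun j => ∑' i, a i j with hc
  have hrc : ∑' i, r i = ∑' j, c j := ENNReal.tsum_comm
  have hbr : ∀ i, ∑' j, northWest r c i j = r i := fun i => tsum_northWest hrc htot i
  have hbc : ∀ j, ∑' i, northWest r c i j = c j := fun j => by
    simp_rw [northWest_comm r c]
    exact tsum_northWest hrc.symm (hrc ▸ htot) j
  have hbfin : ∀ i j, northWest r c i j ≠ ∞ := fun i j =>
    ne_top_of_le_ne_top htot (((ENNReal.le_tsum j).trans (hbr i).le).trans (ENNReal.le_tsum i))
  have hb0 : ∀ i j, (¬ ∃ k : Idx M, k.1 = i) → northWest r c i j = 0 := fun i j hi => by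
    have h0 : r i = 0 := by simp [hr, hai i _ hi]
    exact ENNReal.tsum_eq_zero.1 ((hbr i).trans h0) j
  have hb0' : ∀ i j, (¬ ∃ k : Idx N, k.1 = j) → northWest r c i j = 0 := fun i j hj => by
    have h0 : c j = 0 := by simp [hc, haj _ j hj]
    exact ENNReal.tsum_eq_zero.1 ((hbc j).trans h0) i
  -- positions outside the support get infinite cost, so that an optimal coupling avoids them
  have hopt : ∀ φ : ℕ → ℕ → ℝ≥0∞,
      (∀ (i i' : Idx M) (j j' : Idx N), i < i' → j < j' → 0 < A i j → 0 < A i j' → 0 < A i' j →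
        0 < A i' j' → φ i.1 j.1 + φ i'.1 j'.1 ≤ φ i.1 j'.1 + φ i'.1 j.1) →
      ∑' i, ∑' j, northWest r c i j * (if 0 < a i j then φ i j else ∞) ≤
        ∑' i, ∑' j, a i j * φ i j := by
    intro φ hφ
    have hmonge : IsMonge fun i j => if 0 < a i j then φ i j else ∞ := by
      intro i i' j j' hi hj
      by_cases h1 : 0 < a i j'
      · by_cases h2 : 0 < a i' j
        · obtain ⟨k, rfl⟩ : ∃ k : Idx M, k.1 = i := by
            by_contra hcon; exact h1.ne' (hai i _ hcon)
          obtain ⟨k', rfl⟩ : ∃ k : Idx M, k.1 = i' := by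
            by_contra hcon; exact h2.ne' (hai i' _ hcon)
          obtain ⟨l, rfl⟩ : ∃ l : Idx N, l.1 = j := by
            by_contra hcon; exact h2.ne' (haj _ j hcon)
          obtain ⟨l', rfl⟩ : ∃ l : Idx N, l.1 = j' := by
            by_contra hcon; exact h1.ne' (haj _ j' hcon)
          rw [ha1, ENNReal.coe_pos] at h1 h2
          have h3 := hA k k' l l' hi hj h1 h2
          simp only [ha1, ENNReal.coe_pos, h1, h2, h3.1, h3.2, if_true]
          exact hφ k k' l l' hi hj h3.1 h1 h2 h3.2
        · simp [if_neg h2]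
      · simp [if_neg h1]
    refine (tsum_northWest_mul_le htot hmonge).trans (le_of_eq ?_)
    refine tsum_congr fun i => tsum_congr fun j => ?_
    split_ifs with h
    · rfl
    · simp [le_antisymm (not_lt.1 h) zero_le]
  have hsupp : ∀ i j, a i j = 0 → northWest r c i j = 0 := by
    intro i j hij
    have h0 := hopt (fun _ _ => 0) (fun _ _ _ _ _ _ _ _ _ _ => le_rfl)
    simp only [mul_zero, tsum_zero, nonpos_iff_eq_zero, ENNReal.tsum_eq_zero] at h0
    have := h0 i j
    simpa [hij] using this
  refine ⟨fun i j => (northWest r c i.1 j.1).toNNReal, ?_, fun i => ?_, fun j => ?_,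
    fun i j hij => ?_, fun φ hφ => ?_⟩
  · refine isStairShapedMatrix_of_not_antidiagonal hM hN fun i j i' j' hi hj h h' => ?_
    rw [← ENNReal.coe_pos, ENNReal.coe_toNNReal (hbfin _ _)] at h h'
    exact northWest_not_antidiagonal hi hj h h'
  · simp_rw [ENNReal.coe_toNNReal (hbfin _ _)]
    rw [← hrow, ← tsum_nat_eq_tsum_idx (M := N) (F := northWest r c i.1) fun j hj => hb0' i.1 j hj]
    exact hbr i.1
  · simp_rw [ENNReal.coe_toNNReal (hbfin _ _)]
    rw [← hcol, ← tsum_nat_eq_tsum_idx (M := M) (F := fun i => northWest r c i j.1)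
      fun i hi => hb0 i j.1 hi]
    exact hbc j.1
  · change (northWest r c i.1 j.1).toNNReal = 0
    rw [hsupp _ _ (by rw [ha1, hij, ENNReal.coe_zero])]
    rfl
  · set φ' : ℕ → ℕ → ℝ≥0∞ := extendZero fun i => extendZero fun j => φ i j with hφ'
    have hφ1 : ∀ (i : Idx M) (j : Idx N), φ' i.1 j.1 = φ i j := fun i j => by
      rw [hφ', extendZero_coe, extendZero_coe]
    have h1 := hopt φ' (by simpa only [hφ1] using hφ)
    have h2 : ∑' i, ∑' j, a i j * φ' i j = ∑' i, ∑' j, A i j * φ i j := by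
      rw [tsum_nat_eq_tsum_idx (M := M) fun i hi => by simp [hai i _ hi]]
      refine tsum_congr fun i => ?_
      rw [tsum_nat_eq_tsum_idx (M := N) fun j hj => by simp [haj _ j hj]]
      exact tsum_congr fun j => by rw [ha1, hφ1]
    have h3 : ∑' (i : Idx M) (j : Idx N), ((northWest r c i.1 j.1).toNNReal : ℝ≥0∞) * φ i j =
        ∑' i, ∑' j, northWest r c i j * (if 0 < a i j then φ' i j else ∞) := by
      rw [tsum_nat_eq_tsum_idx (M := M) fun i hi => by simp [hb0 i _ hi]]
      refine tsum_congr fun i => ?_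
      rw [tsum_nat_eq_tsum_idx (M := N) fun j hj => by simp [hb0' _ j hj]]
      refine tsum_congr fun j => ?_
      rw [ENNReal.coe_toNNReal (hbfin _ _), hφ1]
      split_ifs with h
      · rfl
      · simp [hsupp _ _ (le_antisymm (not_lt.1 h) zero_le)]
    rw [h3, ← h2]
    exact h1

/-! ### Approximation by test forms -/

/-- Smooth selection: a family of convex sets on `ℝ^d` that admits locally constant local
selections admits a smooth selection. -/
lemma exists_contDiff_forall_mem {F : Type*} [NormedAddCommGroup F] [NormedSpace ℝ F]
    {t : Euc d → Set F} (ht : ∀ p, Convex ℝ (t p)) (hloc : ∀ p, ∃ c, ∀ᶠ q in 𝓝 p, c ∈ t q) :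
    ∃ h : Euc d → F, ContDiff ℝ (⊤ : ℕ∞) h ∧ ∀ p, h p ∈ t p := by
  obtain ⟨g, hg⟩ := exists_contMDiffMap_forall_mem_convex_of_local_const
    (modelWithCornersSelf ℝ (Euc d)) (n := ⊤) ht hloc
  exact ⟨g, g.contMDiff.contDiff, hg⟩

/-- Smoothing of a compactly supported continuous function with values in the unit ball. -/
lemma exists_contDiff_norm_sub_lt {F : Type*} [NormedAddCommGroup F] [NormedSpace ℝ F]
    {g : Euc d → F} (hg : Continuous g) (hgc : HasCompactSupport g) (hg1 : ∀ p, ‖g p‖ ≤ 1)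
    {U : Set (Euc d)} (hU : IsOpen U) (hgU : tsupport g ⊆ U) {δ : ℝ} (hδ : 0 < δ) :
    ∃ h : Euc d → F, ContDiff ℝ (⊤ : ℕ∞) h ∧ HasCompactSupport h ∧ tsupport h ⊆ U ∧
      (∀ p, ‖h p‖ ≤ 1) ∧ ∀ p, ‖h p - g p‖ < δ := by
  obtain ⟨L, hLc, hgL, hLU⟩ := exists_compact_between hgc hU hgU
  obtain ⟨h, hh, ht⟩ := exists_contDiff_forall_mem
    (t := fun p => Metric.closedBall 0 1 ∩ Metric.ball (g p) δ ∩ {c | p ∉ L → c = 0})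
    (fun p => by
      refine ((convex_closedBall _ _).inter (convex_ball _ _)).inter ?_
      by_cases hp : p ∈ L
      · simp [hp, convex_univ]
      · simp [hp])
    (fun p => by
      refine ⟨g p, ?_⟩
      have hball : ∀ᶠ q in 𝓝 p, g p ∈ Metric.ball (g q) δ := by
        filter_upwards [hg.continuousAt.eventually (Metric.ball_mem_nhds (g p) hδ)] with q hq
        rwa [Metric.mem_ball, dist_comm]
      have h1 : g p ∈ Metric.closedBall (0 : F) 1 := by simpa using hg1 p
      by_cases hp : p ∈ tsupport g
      · filter_upwards [hball, isOpen_interior.mem_nhds (hgL hp)] with q hq hqL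
        exact ⟨⟨h1, hq⟩, fun hn => absurd (interior_subset hqL) hn⟩
      · filter_upwards [hball] with q hq
        exact ⟨⟨h1, hq⟩, fun _ => image_eq_zero_of_notMem_tsupport hp⟩)
  have hsupp : tsupport h ⊆ L :=
    closure_minimal (fun p hp => by by_contra hpL; exact hp ((ht p).2 hpL)) hLc.isClosed
  exact ⟨h, hh, hLc.of_isClosed_subset (isClosed_tsupport h) hsupp, hsupp.trans hLU,
    fun p => by simpa using (ht p).1.1, fun p => by simpa [dist_eq_norm] using (ht p).1.2⟩

lemma norm_inv_max_smul_le {F : Type*} [NormedAddCommGroup F] [NormedSpace ℝ F] (x : F) :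
    ‖(max 1 ‖x‖)⁻¹ • x‖ ≤ 1 := by
  rw [norm_smul, norm_inv, Real.norm_of_nonneg (by positivity)]
  exact inv_mul_le_one_of_le₀ (le_max_right _ _) (by positivity)

lemma norm_inv_max_smul_sub_le {F : Type*} [NormedAddCommGroup F] [NormedSpace ℝ F] (x w : F)
    (hw : ‖w‖ ≤ 1) : ‖(max 1 ‖x‖)⁻¹ • x - w‖ ≤ 2 * ‖x - w‖ := by
  have h0 : 0 < max 1 ‖x‖ := by positivity
  have h1 : ‖(max 1 ‖x‖)⁻¹ • x - x‖ ≤ ‖x - w‖ := by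
    rcases le_total ‖x‖ 1 with h | h
    · rw [max_eq_left h]; simp
    · have hx : 0 < ‖x‖ := one_pos.trans_le h
      rw [max_eq_right h]
      have : ‖x‖⁻¹ • x - x = (‖x‖⁻¹ - 1) • x := by rw [sub_smul, one_smul]
      rw [this, norm_smul, Real.norm_eq_abs, abs_sub_comm,
        abs_of_nonneg (sub_nonneg.2 (inv_le_one_of_one_le₀ h)), sub_mul, one_mul,
        inv_mul_cancel₀ hx.ne']
      linarith [norm_sub_norm_le x w]
  calc _ = ‖((max 1 ‖x‖)⁻¹ • x - x) + (x - w)‖ := by congr 1; abel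
    _ ≤ _ := norm_add_le _ _
    _ ≤ _ := by linarith

/-- Functions with values in the unit ball that vanish off a compact subset of an open set `U` can
be approximated in `L¹(U)` by smooth ones of the same kind. -/
lemma exists_contDiff_integral_norm_sub_le {F : Type*} [NormedAddCommGroup F] [NormedSpace ℝ F]
    {m : Measure (Euc d)} {K U : Set (Euc d)} (hK : IsCompact K) (hU : IsOpen U) (hKU : K ⊆ U)
    (hmU : m U ≠ ∞) {w : Euc d → F} (hw : AEStronglyMeasurable w m)
    (hw1 : ∀ p, ‖w p‖ ≤ 1) (hwK : ∀ p ∉ K, w p = 0) {ε : ℝ} (hε : 0 < ε) :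
    ∃ h : Euc d → F, ContDiff ℝ (⊤ : ℕ∞) h ∧ HasCompactSupport h ∧ tsupport h ⊆ U ∧
      (∀ p, ‖h p‖ ≤ 1) ∧ ∫ p in U, ‖h p - w p‖ ∂m ≤ ε := by
  have : IsFiniteMeasure (m.restrict U) := ⟨by simpa using hmU.lt_top⟩
  have hwi : Integrable w (m.restrict U) :=
    Integrable.of_bound hw.restrict 1 (Eventually.of_forall hw1)
  obtain ⟨g, -, hgε, hg, hgi⟩ := hwi.exists_hasCompactSupport_integral_sub_le
    (show (0 : ℝ) < ε / 4 by positivity)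
  obtain ⟨L, hLc, hKL, hLU⟩ := exists_compact_between hK hU hKU
  obtain ⟨χ, hχ0, hχ1, hχ⟩ := exists_continuous_zero_one_of_isCompact hK
    (isOpen_interior (s := L)).isClosed_compl (disjoint_compl_right_iff_subset.2 hKL)
  set g₁ : Euc d → F := fun p => (1 - χ p) • g p with hg₁
  set g₂ : Euc d → F := fun p => (max 1 ‖g₁ p‖)⁻¹ • g₁ p with hg₂
  have hg₁c : Continuous g₁ := (continuous_const.sub χ.continuous).smul hg
  have hg₂c : Continuous g₂ :=
    ((continuous_const.max hg₁c.norm).inv₀ fun p => by positivity).smul hg₁c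
  have hg₂L : tsupport g₂ ⊆ L := by
    refine closure_minimal (fun p hp => ?_) hLc.isClosed
    by_contra hpL
    refine hp ?_
    have : χ p = 1 := hχ1 fun h => hpL (interior_subset h)
    simp [hg₂, hg₁, this]
  have hg₂cs : HasCompactSupport g₂ := hLc.of_isClosed_subset (isClosed_tsupport _) hg₂L
  have hbound : ∀ p, ‖g₂ p - w p‖ ≤ 2 * ‖w p - g p‖ := fun p => by
    refine (norm_inv_max_smul_sub_le _ _ (hw1 p)).trans ?_
    gcongr
    by_cases hp : p ∈ K
    · have : χ p = 0 := hχ0 hp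
      rw [hg₁]; simp [this, norm_sub_rev]
    · rw [hwK p hp, sub_zero, zero_sub, norm_neg, hg₁, norm_smul, Real.norm_eq_abs,
        abs_of_nonneg (sub_nonneg.2 (hχ p).2)]
      exact mul_le_of_le_one_left (norm_nonneg _) (by linarith [(hχ p).1])
  set V : ℝ := (m U).toReal
  have hV : 0 ≤ V := ENNReal.toReal_nonneg
  obtain ⟨h, hh, hhc, hhU, hh1, hhg⟩ := exists_contDiff_norm_sub_lt hg₂c hg₂cs
    (fun p => norm_inv_max_smul_le _) hU (hg₂L.trans hLU)
    (show (0 : ℝ) < ε / (2 * (V + 1)) by positivity)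
  refine ⟨h, hh, hhc, hhU, hh1, ?_⟩
  have hI1 : Integrable (fun _ : Euc d => ε / (2 * (V + 1))) (m.restrict U) := integrable_const _
  have hI2 : Integrable (fun p => 2 * ‖w p - g p‖) (m.restrict U) :=
    (hwi.sub hgi).norm.const_mul 2
  calc ∫ p in U, ‖h p - w p‖ ∂m
      ≤ ∫ p in U, (ε / (2 * (V + 1)) + 2 * ‖w p - g p‖) ∂m := by
        refine integral_mono_of_nonneg (Eventually.of_forall fun p => norm_nonneg _)
          (hI1.add hI2) (Eventually.of_forall fun p => ?_)
        calc ‖h p - w p‖ = ‖(h p - g₂ p) + (g₂ p - w p)‖ := by congr 1; abel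
          _ ≤ _ := norm_add_le _ _
          _ ≤ _ := add_le_add (hhg p).le (hbound p)
    _ = V * (ε / (2 * (V + 1))) + 2 * ∫ p in U, ‖w p - g p‖ ∂m := by
        rw [integral_add hI1 hI2, integral_const_mul, integral_const, smul_eq_mul,
          measureReal_restrict_apply_univ]
        rfl
    _ ≤ ε / 2 + 2 * (ε / 4) := by
        gcongr
        rw [mul_div_assoc', div_le_div_iff₀ (by positivity) (by positivity)]
        nlinarith
    _ = ε := by ring

/-- A smooth compactly supported function with values in the dual space, as a test form. -/
def OneForm.of (h : Euc d → Euc d →L[ℝ] ℝ) (hh : ContDiff ℝ (⊤ : ℕ∞) h)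
    (hc : HasCompactSupport h) : OneForm d := ⟨h, hh, hc, fun _ _ => mem_univ _⟩

lemma OneForm.of_apply (h : Euc d → Euc d →L[ℝ] ℝ) (hh : ContDiff ℝ (⊤ : ℕ∞) h)
    (hc : HasCompactSupport h) (p : Euc d) : OneForm.of h hh hc p = h p := rfl

lemma OneForm.exists_bound (ω : OneForm d) : ∃ C, 0 ≤ C ∧ ∀ p, ‖ω p‖ ≤ C := by
  obtain ⟨C, hC⟩ := ω.continuous.bounded_above_of_compact_support ω.hasCompactSupport
  exact ⟨C, (norm_nonneg _).trans (hC 0), hC⟩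

lemma OneForm.integrable_apply {m : Measure (Euc d)} {v : Euc d → Euc d}
    (hv : LocallyIntegrable v m) (ω : OneForm d) : Integrable (fun p => ω p (v p)) m := by
  have hK := ω.hasCompactSupport
  obtain ⟨C, -, hC⟩ := ω.exists_bound
  have h1 : IntegrableOn (fun p => ω p (v p)) (tsupport ω) m := by
    have hvi := hv.integrableOn_isCompact hK
    refine (hvi.norm.const_mul C).mono' ?_ ?_
    · exact (ContinuousLinearMap.apply ℝ ℝ).aestronglyMeasurable_comp₂ hvi.1
        ω.continuous.aestronglyMeasurable
    · exact Eventually.of_forall fun p => (ω p).le_of_opNorm_le (hC p) _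
  refine (integrableOn_iff_integrable_of_support_subset fun p hp => ?_).1 h1
  by_contra hpK
  have h0 : ω p = 0 := image_eq_zero_of_notMem_tsupport hpK
  exact hp (by simp [h0])

/-- The total variation of the vector measure `u m`, with `u` a unit vector field, is attained
by test forms. -/
lemma exists_form_le_integral {m : Measure (Euc d)} [IsFiniteMeasureOnCompacts m]
    {u : Euc d → Euc d} (hu : AEStronglyMeasurable u m) (hu1 : ∀ᵐ p ∂m, ‖u p‖ = 1)
    {K : Set (Euc d)} (hK : IsCompact K) {ε : ℝ} (hε : 0 < ε) :
    ∃ ω : OneForm d, (∀ p, ‖ω p‖ ≤ 1) ∧ (m K).toReal - ε ≤ ∫ p, ω p (u p) ∂m := by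
  obtain ⟨L, hL, hKL⟩ := exists_compact_superset hK
  set U := interior L
  have hU : IsOpen U := isOpen_interior
  have hmU : m U ≠ ∞ := ne_top_of_le_ne_top hL.measure_lt_top.ne (measure_mono interior_subset)
  set w : Euc d → Euc d →L[ℝ] ℝ := K.indicator fun p => (max 1 ‖u p‖)⁻¹ • innerSL ℝ (u p) with hw
  have hwm : AEStronglyMeasurable w m := by
    refine AEStronglyMeasurable.indicator ?_ hK.measurableSet
    exact ((aemeasurable_const.max hu.norm.aemeasurable).inv.aestronglyMeasurable).smul
      ((innerSL ℝ (E := Euc d)).continuous.comp_aestronglyMeasurable hu)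
  have hw1 : ∀ p, ‖w p‖ ≤ 1 := fun p => by
    by_cases hp : p ∈ K
    · rw [hw, indicator_of_mem hp, ← innerSL_apply_norm ℝ (u p)]
      exact norm_inv_max_smul_le _
    · rw [hw, indicator_of_notMem hp]; simp
  obtain ⟨h, hh, hhc, hhU, hh1, hhw⟩ := exists_contDiff_integral_norm_sub_le hK hU hKL hmU hwm hw1
    (fun p hp => indicator_of_notMem hp _) hε
  refine ⟨OneForm.of h hh hhc, hh1, ?_⟩
  have hui : LocallyIntegrable u m := (locallyIntegrable_iff).2 fun k hk =>
    Measure.integrableOn_of_bounded hk.measure_lt_top.ne hu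
      (ae_restrict_of_ae (hu1.mono fun p hp => hp.le))
  have hhi : Integrable (fun p => h p (u p)) m := (OneForm.of h hh hhc).integrable_apply hui
  have hwi : ∀ᵐ p ∂m, w p (u p) = K.indicator 1 p := by
    filter_upwards [hu1] with p hp
    by_cases hpK : p ∈ K
    · rw [hw, indicator_of_mem hpK, indicator_of_mem hpK, hp, max_self, inv_one, one_smul,
        innerSL_apply_apply, real_inner_self_eq_norm_sq, hp]; simp
    · rw [hw, indicator_of_notMem hpK, indicator_of_notMem hpK]; rfl
  have : IsFiniteMeasure (m.restrict U) := ⟨by simpa using hmU.lt_top⟩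
  have hIw : ∫ p in U, w p (u p) ∂m = (m K).toReal := by
    rw [integral_congr_ae (ae_restrict_of_ae hwi), integral_indicator_one hK.measurableSet,
      measureReal_def, Measure.restrict_apply hK.measurableSet, inter_eq_left.2 hKL]
  have hwint : Integrable (fun p => w p (u p)) (m.restrict U) := by
    refine Integrable.congr ?_ (ae_restrict_of_ae (hwi.mono fun p hp => hp.symm))
    exact (integrable_const (1 : ℝ)).indicator hK.measurableSet
  have hhw' : Integrable (fun p => ‖h p - w p‖) (m.restrict U) := by
    refine (Integrable.of_bound (hh.continuous.aestronglyMeasurable.sub hwm.restrict) 2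
      (Eventually.of_forall fun p => ?_)).norm
    exact (norm_sub_le _ _).trans (by linarith [hh1 p, hw1 p])
  have h1 : ∫ p, h p (u p) ∂m = ∫ p in U, h p (u p) ∂m := by
    refine (setIntegral_eq_integral_of_forall_compl_eq_zero fun p hp => ?_).symm
    rw [image_eq_zero_of_notMem_tsupport fun hp' => hp (hhU hp')]; rfl
  have h2 : ∫ p in U, (w p (u p) - h p (u p)) ∂m ≤ ∫ p in U, ‖h p - w p‖ ∂m := by
    refine integral_mono_ae (hwint.sub hhi.restrict) hhw' (ae_restrict_of_ae ?_)
    filter_upwards [hu1] with p hp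
    calc w p (u p) - h p (u p) = (w p - h p) (u p) := rfl
      _ ≤ ‖(w p - h p) (u p)‖ := Real.le_norm_self _
      _ ≤ ‖w p - h p‖ * ‖u p‖ := (w p - h p).le_opNorm _
      _ = ‖h p - w p‖ := by rw [hp, mul_one, norm_sub_rev]
  rw [integral_sub hwint hhi.restrict, hIw, ← h1] at h2
  simp only [OneForm.of_apply]
  linarith

lemma measure_univ_le_iSup_form {m : Measure (Euc d)} [IsFiniteMeasureOnCompacts m]
    {u : Euc d → Euc d} (hu : AEStronglyMeasurable u m) (hu1 : ∀ᵐ p ∂m, ‖u p‖ = 1) :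
    m univ ≤ ⨆ (ω : OneForm d) (_ : ∀ p, ‖ω p‖ ≤ 1), ENNReal.ofReal (∫ p, ω p (u p) ∂m) := by
  set s := ⨆ (ω : OneForm d) (_ : ∀ p, ‖ω p‖ ≤ 1), ENNReal.ofReal (∫ p, ω p (u p) ∂m)
  have hK : ∀ K : Set (Euc d), IsCompact K → m K ≤ s := by
    intro K hK
    refine ENNReal.le_of_forall_pos_le_add fun ε hε _ => ?_
    obtain ⟨ω, hω, hle⟩ := exists_form_le_integral hu hu1 hK (ε := ε) (by exact_mod_cast hε)
    calc m K = ENNReal.ofReal (m K).toReal := (ENNReal.ofReal_toReal hK.measure_lt_top.ne).symm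
      _ ≤ ENNReal.ofReal (∫ p, ω p (u p) ∂m + ε) := ENNReal.ofReal_le_ofReal (by linarith)
      _ ≤ ENNReal.ofReal (∫ p, ω p (u p) ∂m) + ENNReal.ofReal ε := ENNReal.ofReal_add_le
      _ ≤ s + ε := by
        rw [ENNReal.ofReal_coe_nnreal]
        gcongr
        exact le_iSup₂_of_le ω hω le_rfl
  have hmono : Monotone fun n : ℕ => Metric.closedBall (0 : Euc d) n := fun a b hab =>
    Metric.closedBall_subset_closedBall (by exact_mod_cast hab)
  rw [← Metric.iUnion_closedBall_nat (0 : Euc d), hmono.measure_iUnion]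
  exact iSup_le fun n => hK _ (isCompact_closedBall _ _)

/-! ### Densities of functionals on test forms -/

/-- A vector density is determined by its action on test forms. -/
lemma ae_eq_zero_of_forall_form {m : Measure (Euc d)} {v : Euc d → Euc d}
    (hv : LocallyIntegrable v m) (h : ∀ ω : OneForm d, ∫ p, ω p (v p) ∂m = 0) :
    ∀ᵐ p ∂m, v p = 0 := by
  refine ae_eq_zero_of_integral_contDiff_smul_eq_zero hv fun g hg hgc => ?_
  refine ext_inner_left ℝ fun e => ?_
  have hi := hv.integrable_smul_left_of_hasCompactSupport hg.continuous hgc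
  rw [inner_zero_right, ← integral_inner hi]
  have hc : HasCompactSupport fun p => g p • innerSL ℝ e := hgc.smul_right
  have := h (OneForm.of (fun p => g p • innerSL ℝ e) (hg.smul contDiff_const) hc)
  simp only [OneForm.of_apply] at this
  simpa [inner_smul_right] using this

/-- The mass of the vector measure `v m` is at most the norm of the functional it defines on test
forms. -/
lemma integral_norm_le_of_forall_form {m : Measure (Euc d)} {v : Euc d → Euc d}
    (hv : Integrable v m) {l : ℝ}
    (h : ∀ ω : OneForm d, (∀ p, ‖ω p‖ ≤ 1) → ∫ p, ω p (v p) ∂m ≤ l) : ∫ p, ‖v p‖ ∂m ≤ l := by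
  -- replace `v` by a measurable representative and pass to the polar decomposition of `v m`
  obtain ⟨v', hv'm, hvv'⟩ := hv.1
  have hv' : Integrable v' m := hv.congr hvv'
  set m' := m.withDensity fun p => (‖v' p‖₊ : ℝ≥0∞) with hm'
  have hfin : IsFiniteMeasure m' := by
    refine ⟨?_⟩
    rw [hm', withDensity_apply _ MeasurableSet.univ, Measure.restrict_univ]
    exact hv'.2
  have hn : Measurable fun p => ‖v' p‖₊ := hv'm.measurable.nnnorm
  set u : Euc d → Euc d := fun p => ‖v' p‖⁻¹ • v' p with hu
  have hum : AEStronglyMeasurable u m' :=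
    (hv'm.measurable.norm.inv.smul hv'm.measurable).aestronglyMeasurable
  have hu1 : ∀ᵐ p ∂m', ‖u p‖ = 1 := by
    rw [hm', ae_withDensity_iff hn.coe_nnreal_ennreal]
    refine Eventually.of_forall fun p hp => ?_
    have : ‖v' p‖ ≠ 0 := by simpa using hp
    rw [hu, norm_smul, norm_inv, norm_norm, inv_mul_cancel₀ this]
  have heq : ∀ ω : OneForm d, ∫ p, ω p (u p) ∂m' = ∫ p, ω p (v p) ∂m := by
    intro ω
    rw [hm', integral_withDensity_eq_integral_smul hn]
    refine integral_congr_ae ?_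
    filter_upwards [hvv'] with p hp
    rw [hp, hu, map_smul, NNReal.smul_def, coe_nnnorm, smul_smul]
    rcases eq_or_ne (v' p) 0 with h0 | h0
    · simp [h0]
    · rw [mul_inv_cancel₀ (norm_ne_zero_iff.2 h0), one_smul]
  have h1 := measure_univ_le_iSup_form hum hu1
  have h2 : m' univ = ENNReal.ofReal (∫ p, ‖v p‖ ∂m) := by
    rw [hm', withDensity_apply _ MeasurableSet.univ, Measure.restrict_univ,
      ofReal_integral_norm_eq_lintegral_enorm hv]
    refine lintegral_congr_ae ?_
    filter_upwards [hvv'] with p hp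
    rw [hp]; rfl
  have h0 : 0 ≤ l := by simpa using h 0 (by simp)
  rw [h2] at h1
  refine (ENNReal.ofReal_le_ofReal_iff h0).1 (h1.trans ?_)
  refine iSup₂_le fun ω hω => ?_
  rw [heq]
  exact ENNReal.ofReal_le_ofReal (h ω hω)

/-- The scalar function `ψ` times the form `ω`. -/
def OneForm.smulFun (ψ : Euc d → ℝ) (hψ : ContDiff ℝ (⊤ : ℕ∞) ψ) (ω : OneForm d) : OneForm d :=
  OneForm.of (fun p => ψ p • ω p) (hψ.smul ω.contDiff)
    (HasCompactSupport.smul_left (f := ψ) (f' := ω) ω.hasCompactSupport)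

/-- If a functional splits into two parts without loss of mass, then each part is dominated by
the total variation measure of the whole. -/
lemma le_integral_norm_of_add {m : Measure (Euc d)} [IsFiniteMeasure m] {ξ : Euc d → Euc d}
    (hξ : AEStronglyMeasurable ξ m) (hξ1 : ∀ᵐ p ∂m, ‖ξ p‖ = 1) {S S' : OneForm d →ₗ[ℝ] ℝ}
    (hS : ∀ ω, S ω + S' ω = ∫ p, ω p (ξ p) ∂m) {l l' : ℝ}
    (hl : ∀ ω : OneForm d, (∀ p, ‖ω p‖ ≤ 1) → S ω ≤ l)
    (hl' : ∀ ω : OneForm d, (∀ p, ‖ω p‖ ≤ 1) → S' ω ≤ l')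
    (hll' : l + l' ≤ (m univ).toReal) (ω : OneForm d) : S ω ≤ ∫ p, ‖ω p‖ ∂m := by
  have hξi : Integrable ξ m := Integrable.of_bound hξ 1 (hξ1.mono fun p hp => hp.le)
  have hT : ∀ (α : OneForm d), Integrable (fun p => α p (ξ p)) m := fun α =>
    α.integrable_apply hξi.locallyIntegrable
  have hmass : ∀ ε > 0, ∃ α : OneForm d, (∀ p, ‖α p‖ ≤ 1) ∧
      (m univ).toReal - ε ≤ ∫ p, α p (ξ p) ∂m := by
    intro ε hε
    by_contra! hcon
    have h1 : ∫ p, ‖ξ p‖ ∂m ≤ (m univ).toReal - ε :=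
      integral_norm_le_of_forall_form hξi fun ω hω => (hcon ω hω).le
    rw [integral_congr_ae hξ1, integral_const, smul_eq_mul, mul_one, measureReal_def] at h1
    linarith
  -- first a form `β` dominated by a smooth function `ψ ≤ 1`: take `α` almost optimal for the mass
  -- of the whole, test `S` with `(1 - ψ) α + β` and `S'` with `(1 - ψ) α`, and compare with `α`
  have hdom : ∀ (ψ : Euc d → ℝ), ContDiff ℝ (⊤ : ℕ∞) ψ → (∀ p, ψ p ≤ 1) → ∀ β : OneForm d,
      (∀ p, ‖β p‖ ≤ ψ p) → S β ≤ ∫ p, ψ p ∂m := by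
    intro ψ hψ hψ1 β hβ
    have hψ0 : ∀ p, 0 ≤ ψ p := fun p => (norm_nonneg _).trans (hβ p)
    refine le_of_forall_pos_le_add fun ε hε => ?_
    obtain ⟨α, hα, hαε⟩ := hmass (ε / 2) (by positivity)
    have hψα : ∀ p, OneForm.smulFun ψ hψ α p = ψ p • α p := fun p => rfl
    have hrest : ∀ p, ‖(α - OneForm.smulFun ψ hψ α) p‖ ≤ 1 - ψ p := fun p => by
      have : (α - OneForm.smulFun ψ hψ α) p = (1 - ψ p) • α p := by
        rw [sub_apply, hψα]
        module
      rw [this, norm_smul, Real.norm_of_nonneg (by linarith [hψ1 p])]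
      exact mul_le_of_le_one_right (by linarith [hψ1 p]) (hα p)
    have h1 : S (α - OneForm.smulFun ψ hψ α + β) ≤ l := hl _ fun p => by
      rw [add_apply]
      refine (norm_add_le _ _).trans ?_
      linarith [hrest p, hβ p]
    have h2 : S' (α - OneForm.smulFun ψ hψ α) ≤ l' := hl' _ fun p => by
      linarith [hrest p, hψ0 p]
    have h3 : ∫ p, OneForm.smulFun ψ hψ α p (ξ p) ∂m ≤ ∫ p, ψ p ∂m := by
      refine integral_mono_ae (hT _) ?_ ?_
      · exact Integrable.of_bound hψ.continuous.aestronglyMeasurable 1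
          (Eventually.of_forall fun p => by rw [Real.norm_of_nonneg (hψ0 p)]; exact hψ1 p)
      · filter_upwards [hξ1] with p hp
        rw [hψα, smul_apply, smul_eq_mul]
        refine mul_le_of_le_one_right (hψ0 p) ((Real.le_norm_self _).trans ?_)
        exact ((α p).le_opNorm _).trans (by rw [hp, mul_one]; exact hα p)
    have h4 := hS α
    have h5 := hS (OneForm.smulFun ψ hψ α)
    have h6 := hl' α hα
    simp only [map_add, map_sub] at h1 h2
    have h7 := hl α hα
    linarith
  -- then forms of norm at most `1 / 2`, by smooth upper approximation of the norm
  have hhalf : ∀ β : OneForm d, (∀ p, ‖β p‖ ≤ 1 / 2) → S β ≤ ∫ p, ‖β p‖ ∂m := by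
    intro β hβ
    refine le_of_forall_pos_le_add fun ε hε => ?_
    set V := (m univ).toReal
    have hV : 0 ≤ V := ENNReal.toReal_nonneg
    set δ : ℝ := min (1 / 2) (ε / (V + 1)) with hδ
    have hδ0 : 0 < δ := lt_min (by norm_num) (by positivity)
    obtain ⟨ψ, hψ, hψt⟩ := exists_contDiff_forall_mem (t := fun p => Ioo ‖β p‖ (‖β p‖ + δ))
      (fun p => convex_Ioo _ _) (fun p => by
        refine ⟨‖β p‖ + δ / 2, ?_⟩
        have hc : Continuous fun q => ‖β q‖ := β.continuous.norm
        filter_upwards [hc.continuousAt.eventually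
          (Ioo_mem_nhds (show ‖β p‖ - δ / 2 < ‖β p‖ by linarith)
            (show ‖β p‖ < ‖β p‖ + δ / 2 by linarith))] with q hq
        exact ⟨by linarith [hq.2], by linarith [hq.1]⟩)
    have hβi : Integrable (fun p => ‖β p‖) m :=
      Integrable.of_bound β.continuous.norm.aestronglyMeasurable (1 / 2)
        (Eventually.of_forall fun p => by rw [norm_norm]; exact hβ p)
    refine (hdom ψ hψ (fun p => ?_) β fun p => (hψt p).1.le).trans ?_
    · linarith [(hψt p).2, hβ p, min_le_left (1 / 2) (ε / (V + 1))]
    · have : ∫ p, ψ p ∂m ≤ ∫ p, (‖β p‖ + δ) ∂m := by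
        refine integral_mono_of_nonneg (Eventually.of_forall fun p =>
          (norm_nonneg _).trans (hψt p).1.le) (hβi.add (integrable_const _))
          (Eventually.of_forall fun p => (hψt p).2.le)
      rw [integral_add hβi (integrable_const _), integral_const, smul_eq_mul,
        measureReal_def] at this
      refine this.trans ?_
      gcongr
      calc V * δ ≤ V * (ε / (V + 1)) := by gcongr; exact min_le_right _ _
        _ ≤ ε := by rw [mul_div_assoc', div_le_iff₀ (by positivity)]; nlinarith
  obtain ⟨C, hC0, hC⟩ := ω.exists_bound
  set c : ℝ := (2 * (C + 1))⁻¹ with hc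
  have hc0 : 0 < c := by positivity
  have h1 := hhalf (c • ω) fun p => by
    rw [FunLike.coe_smul, Pi.smul_apply, norm_smul, Real.norm_of_nonneg hc0.le, hc,
      inv_mul_le_iff₀ (by positivity)]
    linarith [hC p]
  have h2 : ∀ p, ‖(c • ω) p‖ = c * ‖ω p‖ := fun p => by
    rw [FunLike.coe_smul, Pi.smul_apply, norm_smul, Real.norm_of_nonneg hc0.le]
  simp_rw [h2] at h1
  rw [map_smul, integral_const_mul, smul_eq_mul] at h1
  exact le_of_mul_le_mul_left h1 hc0

/-- A functional on test forms that is dominated by a finite measure `m` is given by a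
square-integrable vector density with respect to `m`: extend it to `L²(m)` and represent it
there. -/
lemma exists_memLp_density {m : Measure (Euc d)} [IsFiniteMeasure m] {S : OneForm d →ₗ[ℝ] ℝ}
    (hS : ∀ ω : OneForm d, S ω ≤ ∫ p, ‖ω p‖ ∂m) :
    ∃ v : Euc d → Euc d, MemLp v 2 m ∧ ∀ ω, S ω = ∫ p, ω p (v p) ∂m := by
  set D := InnerProductSpace.toDual ℝ (Euc d)
  have hmem : ∀ ω : OneForm d, MemLp (fun p => D.symm (ω p)) 2 m := fun ω => by
    obtain ⟨C, -, hC⟩ := ω.exists_bound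
    exact MemLp.of_bound (D.symm.continuous.comp ω.continuous).aestronglyMeasurable C
      (Eventually.of_forall fun p => by rw [LinearIsometryEquiv.norm_map]; exact hC p)
  let e : OneForm d →ₗ[ℝ] Lp (Euc d) 2 m :=
    { toFun := fun ω => (hmem ω).toLp
      map_add' := fun ω ω' => by
        rw [← MemLp.toLp_add]
        congr 1
        ext p : 1
        simp [add_apply]
      map_smul' := fun c ω => by
        rw [RingHom.id_apply, ← MemLp.toLp_const_smul]
        congr 1
        ext p : 1
        simp }
  have hbound : ∃ C : ℝ, ∀ ω, ‖S ω‖ ≤ C * ‖e ω‖ := by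
    refine ⟨(m univ ^ (1 / 2 : ℝ)).toReal, fun ω => ?_⟩
    have h1 : ‖S ω‖ ≤ ∫ p, ‖ω p‖ ∂m := by
      refine abs_le.2 ⟨?_, hS ω⟩
      have := hS (-ω)
      simp only [map_neg, neg_apply, norm_neg] at this
      linarith
    have h2 : ∫ p, ‖ω p‖ ∂m = (eLpNorm (fun p => D.symm (ω p)) 1 m).toReal := by
      rw [eLpNorm_one_eq_lintegral_enorm, ← integral_norm_eq_lintegral_enorm (hmem ω).1]
      simp
    have h3 := eLpNorm_le_eLpNorm_mul_rpow_measure_univ (μ := m) (p := 1) (q := 2)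
      (by norm_num) (hmem ω).1
    have h4 : ‖e ω‖ = (eLpNorm (fun p => D.symm (ω p)) 2 m).toReal := Lp.norm_toLp _ (hmem ω)
    have hexp : (1 / (1 : ℝ≥0∞).toReal - 1 / (2 : ℝ≥0∞).toReal) = 1 / 2 := by norm_num
    rw [hexp] at h3
    rw [h4, mul_comm, ← ENNReal.toReal_mul]
    refine h1.trans (h2.le.trans (ENNReal.toReal_mono ?_ h3))
    exact ENNReal.mul_ne_top (hmem ω).2.ne
      (ENNReal.rpow_ne_top_of_nonneg (by norm_num) (measure_ne_top m univ))
  obtain ⟨F, hF, -⟩ := exists_extension_norm_eq (𝕜 := ℝ) (LinearMap.range e) (S.compLeftInverse e)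
  have hFe : ∀ ω, F (e ω) = S ω := fun ω => by
    rw [← LinearMap.compLeftInverse_apply_of_bdd S e hbound ω (e ω) rfl]
    exact hF ⟨e ω, LinearMap.mem_range_self e ω⟩
  set v := (InnerProductSpace.toDual ℝ (Lp (Euc d) 2 m)).symm F
  refine ⟨v, Lp.memLp v, fun ω => ?_⟩
  rw [← hFe, ← InnerProductSpace.toDual_symm_apply, real_inner_comm, L2.inner_def]
  refine integral_congr_ae ?_
  filter_upwards [(hmem ω).coeFn_toLp] with p hp
  change inner ℝ (((hmem ω).toLp : Lp (Euc d) 2 m) p) (v p) = _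
  rw [hp, InnerProductSpace.toDual_symm_apply]

/-- If a functional with polar density `ξ m` splits into two parts without loss of mass, then each
part is `ρ ξ m` for a scalar density `0 ≤ ρ ≤ 1`, by strict convexity of the Euclidean norm. -/
theorem exists_density_of_add {m : Measure (Euc d)} [IsFiniteMeasure m] {ξ : Euc d → Euc d}
    (hξ : AEStronglyMeasurable ξ m) (hξ1 : ∀ᵐ p ∂m, ‖ξ p‖ = 1) {S S' : OneForm d →ₗ[ℝ] ℝ}
    (hS : ∀ ω, S ω + S' ω = ∫ p, ω p (ξ p) ∂m) {l l' : ℝ}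
    (hl : ∀ ω : OneForm d, (∀ p, ‖ω p‖ ≤ 1) → S ω ≤ l)
    (hl' : ∀ ω : OneForm d, (∀ p, ‖ω p‖ ≤ 1) → S' ω ≤ l')
    (hll' : l + l' ≤ (m univ).toReal) :
    ∃ ρ : Euc d → ℝ≥0, Measurable ρ ∧ (∀ p, ρ p ≤ 1) ∧
      (∀ ω : OneForm d, S ω = ∫ p, ρ p * ω p (ξ p) ∂m) ∧
      ∫⁻ p, ρ p ∂m = ENNReal.ofReal l := by
  obtain ⟨v, hv2, hvS⟩ := exists_memLp_density (m := m) (S := S)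
    (le_integral_norm_of_add hξ hξ1 hS hl hl' hll')
  have hvi : Integrable v m := hv2.integrable (by norm_num)
  have hξi : Integrable ξ m := Integrable.of_bound hξ 1 (hξ1.mono fun p hp => hp.le)
  have hvS' : ∀ ω, S' ω = ∫ p, ω p ((ξ - v) p) ∂m := fun ω => by
    have h1 := ω.integrable_apply hξi.locallyIntegrable
    have h2 := ω.integrable_apply hvi.locallyIntegrable
    simp only [Pi.sub_apply, map_sub]
    rw [integral_sub h1 h2, ← hS, ← hvS]; ring
  have hm1 : ∫ p, ‖v p‖ ∂m ≤ l :=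
    integral_norm_le_of_forall_form hvi fun ω hω => (hvS ω) ▸ hl ω hω
  have hm2 : ∫ p, ‖(ξ - v) p‖ ∂m ≤ l' :=
    integral_norm_le_of_forall_form (hξi.sub hvi) fun ω hω => (hvS' ω) ▸ hl' ω hω
  have hm3 : ∫ p, ‖ξ p‖ ∂m = (m univ).toReal := by
    rw [integral_congr_ae hξ1, integral_const, smul_eq_mul, mul_one, measureReal_def]
  have hi1 := hvi.norm
  have hi2 := (hξi.sub hvi).norm
  have hnn : 0 ≤ fun p => ‖v p‖ + ‖(ξ - v) p‖ - ‖ξ p‖ := fun p => by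
    have h := norm_add_le (v p) ((ξ - v) p)
    rw [Pi.sub_apply, add_sub_cancel] at h
    simpa using h
  have hint : ∫ p, (‖v p‖ + ‖(ξ - v) p‖ - ‖ξ p‖) ∂m =
      ∫ p, ‖v p‖ ∂m + ∫ p, ‖(ξ - v) p‖ ∂m - ∫ p, ‖ξ p‖ ∂m := by
    rw [integral_sub (f := fun p => ‖v p‖ + ‖(ξ - v) p‖) (hi1.add hi2) hξi.norm,
      integral_add hi1 hi2]
  have hzero : ∫ p, (‖v p‖ + ‖(ξ - v) p‖ - ‖ξ p‖) ∂m = 0 :=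
    le_antisymm (by linarith) (integral_nonneg hnn)
  rw [integral_eq_zero_iff_of_nonneg hnn ((hi1.add hi2).sub hξi.norm)] at hzero
  have hpar : ∀ᵐ p ∂m, ‖v p‖ ≤ 1 ∧ v p = ‖v p‖ • ξ p := by
    filter_upwards [hzero, hξ1] with p hp hp1
    have hsum : ‖v p‖ + ‖(ξ - v) p‖ = 1 := by
      have : ‖v p‖ + ‖(ξ - v) p‖ - ‖ξ p‖ = 0 := hp
      linarith
    refine ⟨by linarith [norm_nonneg ((ξ - v) p)], ?_⟩
    have hray : SameRay ℝ (v p) ((ξ - v) p) := by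
      rw [sameRay_iff_norm_add, hsum, Pi.sub_apply, add_sub_cancel, hp1]
    have h1 := hray.norm_smul_eq
    have h2 : ‖v p‖ • ξ p = (‖v p‖ + ‖(ξ - v) p‖) • v p := by
      rw [add_smul, ← h1, ← smul_add, Pi.sub_apply, add_sub_cancel]
    rw [h2, hsum, one_smul]
  obtain ⟨v', hv'm, hvv'⟩ := hvi.1
  set ρ : Euc d → ℝ≥0 := fun p => min ‖v' p‖₊ 1 with hρ
  have hρv : ∀ᵐ p ∂m, (ρ p : ℝ) = ‖v p‖ := by
    filter_upwards [hpar, hvv'] with p hp hp'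
    simp only [hρ]
    rw [← hp']
    have : ‖v p‖₊ ≤ 1 := hp.1
    rw [min_eq_left this, coe_nnnorm]
  have hρm : Measurable ρ := hv'm.measurable.nnnorm.min measurable_const
  refine ⟨ρ, hρm, fun p => min_le_right _ _, fun ω => ?_, ?_⟩
  · rw [hvS]
    refine integral_congr_ae ?_
    filter_upwards [hρv, hpar] with p hp hp'
    rw [hp]
    conv_lhs => rw [hp'.2]
    rw [map_smul, smul_eq_mul]
  · have h1 : ∫⁻ p, ρ p ∂m = ∫⁻ p, ‖v p‖ₑ ∂m := by
      refine lintegral_congr_ae ?_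
      filter_upwards [hρv] with p hp
      rw [← ofReal_norm, ← hp, ENNReal.ofReal_coe_nnreal]
    rw [h1, ← ofReal_integral_norm_eq_lintegral_enorm hvi]
    congr 1
    have : ∫ p, ‖ξ p‖ ∂m ≤ ∫ p, ‖v p‖ ∂m + ∫ p, ‖(ξ - v) p‖ ∂m := by
      have h2 : 0 ≤ ∫ p, (‖v p‖ + ‖(ξ - v) p‖ - ‖ξ p‖) ∂m := integral_nonneg hnn
      rw [hint] at h2
      linarith
    linarith

/-! ### Length and Hausdorff measure of Lipschitz curves -/

lemma intervalIntegrable_norm_deriv {g : ℝ → Euc d} {K : ℝ≥0} (hg : LipschitzWith K g)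
    (u v : ℝ) : IntervalIntegrable (fun t => ‖deriv g t‖) volume u v := by
  refine (intervalIntegrable_const (c := (K : ℝ))).mono_fun
    (measurable_deriv g).norm.aestronglyMeasurable ?_
  filter_upwards with t
  simpa using norm_deriv_le_of_lipschitz hg

lemma norm_sub_le_integral_norm_deriv {g : ℝ → Euc d} {K : ℝ≥0} (hg : LipschitzWith K g)
    {u v : ℝ} (huv : u ≤ v) : ‖g v - g u‖ ≤ ∫ t in u..v, ‖deriv g t‖ := by
  set w := g v - g u with hw
  have hL : LipschitzWith (‖innerSL ℝ w‖₊ * K) fun t => inner ℝ w (g t) :=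
    (innerSL ℝ w).lipschitz.comp hg
  have hAC := (hL.lipschitzOnWith (s := uIcc u v)).absolutelyContinuousOnInterval
  have hFTC := hAC.integral_deriv_eq_sub
  rw [← inner_sub_right, ← hw, real_inner_self_eq_norm_sq] at hFTC
  have hle : ∫ t in u..v, deriv (fun t => inner ℝ w (g t)) t ≤ ∫ t in u..v, ‖w‖ * ‖deriv g t‖ := by
    refine intervalIntegral.integral_mono_ae huv ?_ ?_ ?_
    · exact hAC.intervalIntegrable_deriv
    · exact (intervalIntegrable_norm_deriv hg u v).const_mul _
    · filter_upwards [hg.ae_differentiableAt_real] with t ht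
      have h1 : HasDerivAt (fun t => inner ℝ w (g t)) (inner ℝ w (deriv g t)) t :=
        (innerSL ℝ w).hasFDerivAt.comp_hasDerivAt t ht.hasDerivAt
      rw [h1.deriv]
      exact real_inner_le_norm _ _
  rw [hFTC, intervalIntegral.integral_const_mul, sq] at hle
  rcases (norm_nonneg w).eq_or_lt with h0 | h0
  · rw [← h0]
    exact intervalIntegral.integral_nonneg huv fun _ _ => norm_nonneg _
  · exact le_of_mul_le_mul_left hle h0

/-- Upper bound for the Hausdorff measure of a curve, by covering it with the images of a fine
partition of the parameter interval. -/
lemma hausdorffMeasure_image_Icc_le {g : ℝ → Euc d} {K : ℝ≥0} (hg : LipschitzWith K g)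
    {u v : ℝ} (huv : u ≤ v) :
    Measure.hausdorffMeasure 1 (g '' Icc u v) ≤ ENNReal.ofReal (∫ t in u..v, ‖deriv g t‖) := by
  set s : ℕ → ℕ → ℝ := fun n k => u + (v - u) * (k / (n + 1 : ℕ)) with hs
  have hstep : ∀ n k, s n k ≤ s n (k + 1) := fun n k => by
    simp only [hs]
    have : 0 ≤ v - u := sub_nonneg.2 huv
    gcongr
    norm_num
  have hs0 : ∀ n, s n 0 = u := fun n => by simp [hs]
  have hs1 : ∀ n, s n (n + 1) = v := fun n => by
    simp only [hs]
    rw [div_self (by positivity)]; ring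
  have hdiff : ∀ n k, s n (k + 1) - s n k = (v - u) / (n + 1 : ℕ) := fun n k => by
    simp only [hs]; push_cast; field_simp; ring
  have hdiam : ∀ p q, p ≤ q → Metric.ediam (g '' Icc p q) ≤
      ENNReal.ofReal (∫ t in p..q, ‖deriv g t‖) := by
    intro p q hpq
    have key : ∀ x ∈ Icc p q, ∀ y ∈ Icc p q, x ≤ y →
        edist (g x) (g y) ≤ ENNReal.ofReal (∫ t in p..q, ‖deriv g t‖) := by
      intro x hx y hy hxy
      rw [edist_dist, dist_comm, dist_eq_norm]
      refine ENNReal.ofReal_le_ofReal ((norm_sub_le_integral_norm_deriv hg hxy).trans ?_)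
      exact intervalIntegral.integral_mono_interval hx.1 hxy hy.2
        (Eventually.of_forall fun _ => norm_nonneg _) (intervalIntegrable_norm_deriv hg p q)
    refine Metric.ediam_le ?_
    rintro _ ⟨x, hx, rfl⟩ _ ⟨y, hy, rfl⟩
    rcases le_total x y with h | h
    · exact key x hx y hy h
    · rw [edist_comm]; exact key y hy x hx h
  have hr : Tendsto (fun n : ℕ => (K : ℝ≥0∞) * ENNReal.ofReal ((v - u) / (n + 1 : ℕ))) atTop
      (𝓝 0) := by
    have h1 : Tendsto (fun n : ℕ => (v - u) / ((n + 1 : ℕ) : ℝ)) atTop (𝓝 0) :=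
      (tendsto_const_div_atTop_nhds_zero_nat (v - u)).comp (tendsto_add_atTop_nat 1)
    have h2 := ENNReal.Tendsto.const_mul (ENNReal.tendsto_ofReal h1) (a := (K : ℝ≥0∞))
      (Or.inr ENNReal.coe_ne_top)
    simpa using h2
  refine (Measure.hausdorffMeasure_le_liminf_sum (ι := fun n : ℕ => Fin (n + 1)) 1 _ _ hr
    (fun n k => g '' Icc (s n k) (s n (k + 1))) ?_ ?_).trans ?_
  · refine Eventually.of_forall fun n k => ?_
    refine (hg.ediam_image_le _).trans ?_
    rw [Real.ediam_Icc, hdiff]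
  · refine Eventually.of_forall fun n => ?_
    rintro _ ⟨t, ht, rfl⟩
    have hex : ∃ k : ℕ, k ≤ n ∧ t ≤ s n (k + 1) := ⟨n, le_rfl, by rw [hs1]; exact ht.2⟩
    classical
    obtain ⟨k, ⟨hk1, hk2⟩, hmin⟩ : ∃ k, (k ≤ n ∧ t ≤ s n (k + 1)) ∧
        ∀ m < k, ¬ (m ≤ n ∧ t ≤ s n (m + 1)) :=
      ⟨Nat.find hex, Nat.find_spec hex, fun m hm => Nat.find_min hex hm⟩
    refine mem_iUnion.2 ⟨⟨k, Nat.lt_succ_of_le hk1⟩, t, ⟨?_, hk2⟩, rfl⟩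
    cases k with
    | zero => exact (hs0 n).le.trans ht.1
    | succ k =>
      have := hmin k (Nat.lt_succ_self k)
      rw [not_and, not_le] at this
      exact (this (by omega)).le
  · refine liminf_le_of_frequently_le' (Frequently.of_forall fun n => ?_)
    calc ∑ k : Fin (n + 1), Metric.ediam (g '' Icc (s n k) (s n (k + 1))) ^ (1 : ℝ)
        ≤ ∑ k : Fin (n + 1), ENNReal.ofReal (∫ t in s n k..s n (k + 1), ‖deriv g t‖) :=
          Finset.sum_le_sum fun k _ => by
            rw [ENNReal.rpow_one]; exact hdiam _ _ (hstep n k)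
      _ = ∑ k ∈ Finset.range (n + 1), ENNReal.ofReal (∫ t in s n k..s n (k + 1), ‖deriv g t‖) :=
          Fin.sum_univ_eq_sum_range
            (fun k => ENNReal.ofReal (∫ t in s n k..s n (k + 1), ‖deriv g t‖)) (n + 1)
      _ = ENNReal.ofReal (∫ t in u..v, ‖deriv g t‖) := by
          rw [← ENNReal.ofReal_sum_of_nonneg fun k _ =>
            intervalIntegral.integral_nonneg (hstep n k) fun _ _ => norm_nonneg _,
            intervalIntegral.sum_integral_adjacent_intervals fun k _ =>
              intervalIntegrable_norm_deriv hg _ _, hs0, hs1]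
      _ ≤ _ := le_rfl

lemma hausdorffMeasure_singleton (p : Euc d) : Measure.hausdorffMeasure 1 {p} = 0 :=
  haveI := Measure.nullSingletonClass_hausdorff (Euc d) one_pos
  measure_singleton p

/-- A curve is at least as long as the distance of its end points, because the distance to one of
them maps it onto an interval. -/
lemma edist_le_hausdorffMeasure_image {g : ℝ → Euc d} {s t : ℝ} (hst : s ≤ t)
    (hg : ContinuousOn g (Icc s t)) :
    edist (g s) (g t) ≤ Measure.hausdorffMeasure 1 (g '' Icc s t) := by
  set f : Euc d → ℝ := fun p => dist p (g s) with hf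
  have hfL : LipschitzWith 1 f := LipschitzWith.dist_left (g s)
  have h1 : Icc 0 (dist (g t) (g s)) ⊆ f '' (g '' Icc s t) := by
    have := intermediate_value_Icc hst (hfL.continuous.comp_continuousOn hg)
    rw [← image_comp]
    simpa [hf] using this
  have h2 := (measure_mono h1).trans
    ((hfL.lipschitzOnWith (s := g '' Icc s t)).hausdorffMeasure_image_le zero_le_one)
  rw [hausdorffMeasure_real, Real.volume_Icc, sub_zero, ← edist_dist, edist_comm] at h2
  simpa using h2

lemma hausdorffMeasure_image_le_of_lipschitz {g : ℝ → Euc d} {K : ℝ≥0} (hg : LipschitzWith K g)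
    (S : Set ℝ) : Measure.hausdorffMeasure 1 (g '' S) ≤ K * volume S := by
  have := (hg.lipschitzOnWith (s := S)).hausdorffMeasure_image_le zero_le_one
  rwa [hausdorffMeasure_real, ENNReal.rpow_one] at this

/-- Lower bound for the Hausdorff measure of an injective curve: the measure `l t` of the arc up to
the parameter `t` increases at least as fast as the curve moves, so `‖g'‖ ≤ l'`. -/
lemma le_hausdorffMeasure_image_Icc {g : ℝ → Euc d} {K : ℝ≥0} (hg : LipschitzWith K g)
    {a b : ℝ} (hab : a ≤ b) (hinj : InjOn g (Icc a b)) :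
    ENNReal.ofReal (∫ t in a..b, ‖deriv g t‖) ≤ Measure.hausdorffMeasure 1 (g '' Icc a b) := by
  set H : Set (Euc d) → ℝ≥0∞ := fun S => Measure.hausdorffMeasure 1 S with hH
  have hfin : ∀ s t, H (g '' Icc s t) ≠ ∞ := fun s t =>
    ne_top_of_le_ne_top (ENNReal.mul_ne_top ENNReal.coe_ne_top (by simp))
      (hausdorffMeasure_image_le_of_lipschitz hg (Icc s t))
  set l : ℝ → ℝ := fun t => (H (g '' Icc a t)).toReal with hl
  have hadd : ∀ s t, a ≤ s → s ≤ t → t ≤ b →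
      H (g '' Icc a t) = H (g '' Icc a s) + H (g '' Ioc s t) := by
    intro s t has hst htb
    rw [hH, ← Icc_union_Ioc_eq_Icc has hst, image_union]
    refine measure_union' ?_ (isCompact_Icc.image hg.continuous).measurableSet
    refine (disjoint_image_image fun x hx y hy hxy => ?_)
    have := hinj ⟨hx.1, hx.2.trans (hst.trans htb)⟩ ⟨(has.trans hy.1.le), hy.2.trans htb⟩ hxy
    exact absurd hx.2 (not_le.2 (this ▸ hy.1))
  have hlow : ∀ s t, a ≤ s → s ≤ t → t ≤ b → ‖g t - g s‖ ≤ l t - l s := by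
    intro s t has hst htb
    have h1 : edist (g s) (g t) ≤ H (g '' Ioc s t) := by
      refine (edist_le_hausdorffMeasure_image hst hg.continuous.continuousOn).trans ?_
      rw [← Ioc_insert_left hst, image_insert_eq]
      refine (measure_union_le {g s} _).trans ?_
      rw [hausdorffMeasure_singleton, zero_add]
    have h2 := hadd s t has hst htb
    have h3 : H (g '' Ioc s t) ≠ ∞ :=
      ne_top_of_le_ne_top (hfin s t) (measure_mono (image_mono Ioc_subset_Icc_self))
    simp only [hl]
    rw [h2, ENNReal.toReal_add (hfin a s) h3, add_sub_cancel_left, ← dist_eq_norm, dist_comm,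
      dist_edist]
    exact ENNReal.toReal_mono h3 h1
  have hup : ∀ s t, a ≤ s → s ≤ t → t ≤ b → l t - l s ≤ K * (t - s) := by
    intro s t has hst htb
    have h2 := hadd s t has hst htb
    have h4 := hausdorffMeasure_image_le_of_lipschitz hg (Ioc s t)
    rw [Real.volume_Ioc] at h4
    have h3 : H (g '' Ioc s t) ≠ ∞ := ne_top_of_le_ne_top (by finiteness) h4
    simp only [hl]
    rw [h2, ENNReal.toReal_add (hfin a s) h3, add_sub_cancel_left]
    refine (ENNReal.toReal_mono (by finiteness) h4).trans (le_of_eq ?_)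
    rw [ENNReal.toReal_mul, ENNReal.coe_toReal, ENNReal.toReal_ofReal (sub_nonneg.2 hst)]
  have hlL : LipschitzOnWith K l (uIcc a b) := by
    rw [uIcc_of_le hab]
    have key : ∀ s ∈ Icc a b, ∀ t ∈ Icc a b, s ≤ t → dist (l s) (l t) ≤ K * dist s t := by
      intro s hs t ht hst
      rw [dist_comm, dist_comm s, Real.dist_eq, Real.dist_eq,
        abs_of_nonneg ((norm_nonneg _).trans (hlow s t hs.1 hst ht.2)),
        abs_of_nonneg (sub_nonneg.2 hst)]
      exact hup s t hs.1 hst ht.2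
    refine LipschitzOnWith.of_dist_le_mul fun s hs t ht => ?_
    rcases le_total s t with h | h
    · exact key s hs t ht h
    · rw [dist_comm, dist_comm s]; exact key t ht s hs h
  have hAC := hlL.absolutelyContinuousOnInterval
  have hFTC := hAC.integral_deriv_eq_sub
  have hla : l a = 0 := by simp [hl, hH, hausdorffMeasure_singleton]
  have hle : ∫ t in a..b, ‖deriv g t‖ ≤ ∫ t in a..b, deriv l t := by
    refine intervalIntegral.integral_mono_ae_restrict hab (intervalIntegrable_norm_deriv hg a b)
      hAC.intervalIntegrable_deriv ?_
    have hb : ∀ᵐ t : ℝ, t ≠ b := by simp [ae_iff]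
    refine (ae_restrict_iff' measurableSet_Icc).2 ?_
    filter_upwards [hg.ae_differentiableAt_real, hAC.ae_differentiableAt, hb] with t hgt hlt htb ht
    rw [uIcc_of_le hab] at hlt
    have h1 := (hasDerivAt_iff_tendsto_slope.1 hgt.hasDerivAt).mono_left
      (nhdsWithin_mono t fun s (hs : s ∈ Ioi t) => ne_of_gt hs)
    have h2 := (hasDerivAt_iff_tendsto_slope.1 (hlt ht).hasDerivAt).mono_left
      (nhdsWithin_mono t fun s (hs : s ∈ Ioi t) => ne_of_gt hs)
    refine le_of_tendsto_of_tendsto h1.norm h2 ?_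
    filter_upwards [Ioo_mem_nhdsGT (lt_of_le_of_ne ht.2 htb)] with s hs
    have hpos : 0 < s - t := sub_pos.2 hs.1
    rw [slope_def_module, slope_def_module, norm_smul, norm_inv, Real.norm_of_nonneg hpos.le,
      smul_eq_mul]
    exact mul_le_mul_of_nonneg_left (hlow t s ht.1 hs.1.le hs.2.le) (inv_nonneg.2 hpos.le)
  rw [hFTC, hla, sub_zero] at hle
  refine (ENNReal.ofReal_le_ofReal hle).trans ?_
  rw [hl, ENNReal.ofReal_toReal (hfin a b)]

lemma hausdorffMeasure_image_Icc {g : ℝ → Euc d} {K : ℝ≥0} (hg : LipschitzWith K g)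
    {a b : ℝ} (hab : a ≤ b) (hinj : InjOn g (Icc a b)) :
    Measure.hausdorffMeasure 1 (g '' Icc a b) = ∫⁻ t in Icc a b, ‖deriv g t‖ₑ := by
  rw [le_antisymm (hausdorffMeasure_image_Icc_le hg hab)
      (le_hausdorffMeasure_image_Icc hg hab hinj),
    intervalIntegral.integral_of_le hab, ← integral_Icc_eq_integral_Ioc,
    ofReal_integral_norm_eq_lintegral_enorm]
  have h := (intervalIntegrable_norm_deriv hg a b).1
  rw [← integrableOn_Icc_iff_integrableOn_Ioc] at h
  exact (integrable_norm_iff (measurable_deriv g).aestronglyMeasurable).1 h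

/-- Area formula for an injective Lipschitz curve: the Hausdorff measure on its image corresponds
to the measure with density `‖g'‖` on the parameter interval. -/
lemma comap_hausdorffMeasure {g : ℝ → Euc d} {K : ℝ≥0} (hg : LipschitzWith K g)
    {a b : ℝ} (hinj : InjOn g (Icc a b)) :
    (Measure.hausdorffMeasure 1).comap ((Icc a b).domRestrict g) =
      ((volume : Measure ℝ).comap Subtype.val).withDensity fun t : Icc a b => ‖deriv g t‖ₑ := by
  have hemb : MeasurableEmbedding ((Icc a b).domRestrict g) :=
    ((continuous_id.comp hg.continuous).comp continuous_subtype_val).isClosedEmbedding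
      (injOn_iff_injective.1 hinj) |>.measurableEmbedding
  have hval : MeasurableEmbedding (Subtype.val : Icc a b → ℝ) :=
    MeasurableEmbedding.subtype_coe measurableSet_Icc
  set μ₁ := (Measure.hausdorffMeasure 1).comap ((Icc a b).domRestrict g)
  set μ₂ := ((volume : Measure ℝ).comap Subtype.val).withDensity fun t : Icc a b => ‖deriv g t‖ₑ
  have h1 : ∀ S : Set ℝ, μ₁.map Subtype.val S =
      Measure.hausdorffMeasure 1 (g '' (Icc a b ∩ S)) := fun S => by
    rw [hval.map_apply, hemb.comap_apply, domRestrict_eq, image_comp, Subtype.image_preimage_coe]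
  have h2 : ∀ S : Set ℝ, MeasurableSet S → μ₂.map Subtype.val S =
      ∫⁻ t in Icc a b ∩ S, ‖deriv g t‖ₑ := fun S hS => by
    rw [hval.map_apply, withDensity_apply _ (hval.measurable hS),
      setLIntegral_subtype measurableSet_Icc _ fun t => ‖deriv g t‖ₑ, Subtype.image_preimage_coe]
  have hfin : IsFiniteMeasure (μ₁.map (Subtype.val : Icc a b → ℝ)) := by
    refine ⟨?_⟩
    rw [h1]
    refine (hausdorffMeasure_image_le_of_lipschitz hg _).trans_lt ?_
    rw [inter_univ, Real.volume_Icc]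
    finiteness
  have heq : μ₁.map Subtype.val = μ₂.map Subtype.val := by
    refine Measure.ext_of_Ici _ _ fun u => ?_
    rw [h1, h2 _ measurableSet_Ici]
    have hI : Icc a b ∩ Ici u = Icc (max a u) b := by
      ext t; simp only [mem_inter_iff, mem_Icc, mem_Ici, sup_le_iff]; tauto
    rw [hI]
    rcases le_or_gt (max a u) b with h | h
    · exact hausdorffMeasure_image_Icc hg h
        (hinj.mono (Icc_subset_Icc_left (le_max_left _ _)))
    · simp [Icc_eq_empty_of_lt h]
  rw [← hval.comap_map μ₁, heq, hval.comap_map]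

/-! ### The boundary of the current of a simple curve -/

namespace Curve

/-- A curve as a function on the real line, constant on `(-∞, 0]`. -/
def onReal (γ : Curve d) (s : ℝ) : Euc d := γ.1 s.toNNReal

lemma lipschitz_onReal (γ : Curve d) : LipschitzWith 1 γ.onReal := by
  have := γ.2.1.comp Real.lipschitzWith_toNNReal
  rwa [mul_one] at this

lemma continuous_val (γ : Curve d) : Continuous γ.1 := γ.2.1.continuous

lemma eq_start (γ : Curve d) {s : ℝ≥0} (hs : s ≤ γ.tStart) :
    γ.1 s = γ.start := by
  have hclosed : IsClosed {s | γ.1 s = γ.1 0} := isClosed_eq γ.continuous_val continuous_const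
  have h0 : (0 : ℝ≥0) ∈ {t | ∀ s, s ≤ t → γ.1 s = γ.1 0} := fun s hs => by
    rw [nonpos_iff_eq_zero.1 hs]
  have hlt : ∀ s < γ.tStart, γ.1 s = γ.1 0 := fun s hs => by
    obtain ⟨t, ht, hst⟩ := exists_lt_of_lt_csSup ⟨0, h0⟩ hs
    exact ht s hst.le
  rcases hs.lt_or_eq with h | h
  · exact hlt s h
  rcases eq_or_ne s 0 with h' | h'
  · rw [h']; rfl
  · have h1 : closure (Iio s) ⊆ {s | γ.1 s = γ.1 0} :=
      hclosed.closure_subset_iff.2 fun u hu => hlt u (h ▸ hu)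
    rw [closure_Iio' ⟨0, pos_iff_ne_zero.2 h'⟩] at h1
    exact h1 (mem_Iic.2 le_rfl)

lemma eq_tFinish (γ : Curve d) {s : ℝ≥0} (hs : γ.tFinish ≤ s) : γ.1 s = γ.1 γ.tFinish := by
  obtain ⟨t₀, ht₀⟩ := γ.2.2
  have hne : {t | ∀ s, t ≤ s → γ.1 s = γ.1 t}.Nonempty := ⟨t₀, ht₀⟩
  have hgt : ∀ u, γ.tFinish < u → ∀ v, u ≤ v → γ.1 v = γ.1 u := fun u hu v huv => by
    obtain ⟨t, ht, htu⟩ := exists_lt_of_csInf_lt hne hu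
    rw [ht u htu.le, ht v (htu.le.trans huv)]
  rcases hs.eq_or_lt with h | h
  · rw [h]
  · have hclosed : IsClosed {u | γ.1 s = γ.1 u} := isClosed_eq continuous_const γ.continuous_val
    have h1 : closure (Ioc γ.tFinish s) ⊆ {u | γ.1 s = γ.1 u} :=
      hclosed.closure_subset_iff.2 fun u hu => hgt u hu.1 s hu.2
    rw [closure_Ioc h.ne] at h1
    exact h1 (left_mem_Icc.2 h.le)

lemma eq_finish (γ : Curve d) {s : ℝ≥0} (hs : γ.tFinish ≤ s) : γ.1 s = γ.finish := by
  refine tendsto_nhds_unique (tendsto_const_nhds.congr' ?_) γ.tendsto_finish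
  filter_upwards [eventually_ge_atTop γ.tFinish] with t ht
  rw [γ.eq_tFinish hs, γ.eq_tFinish ht]

lemma IsNonconstant.tStart_lt_tFinish {γ : Curve d} (hγ : γ.IsNonconstant) :
    γ.tStart < γ.tFinish := by
  by_contra hcon
  rw [not_lt] at hcon
  have h : ∀ s, γ.1 s = γ.start := fun s => by
    rcases le_total s γ.tStart with h | h
    · exact γ.eq_start h
    · rw [γ.eq_finish (hcon.trans h), ← γ.eq_finish hcon, γ.eq_start le_rfl]
  obtain ⟨s, t, hst⟩ := hγ
  exact hst ((h s).trans (h t).symm)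

lemma onReal_coe (γ : Curve d) (s : ℝ≥0) : γ.onReal s = γ.1 s := by
  rw [onReal, Real.toNNReal_coe]

lemma IsSimple.injOn_onReal {γ : Curve d} (hγ : γ.IsSimple) :
    InjOn γ.onReal (Icc (γ.tStart : ℝ) γ.tFinish) := by
  have key : ∀ s ∈ Icc (γ.tStart : ℝ) γ.tFinish, ∀ t ∈ Icc (γ.tStart : ℝ) γ.tFinish, s < t →
      γ.onReal s ≠ γ.onReal t := by
    intro s hs t ht hst
    have hs0 : 0 ≤ s := γ.tStart.2.trans hs.1
    have ht0 : 0 ≤ t := hs0.trans hst.le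
    lift s to ℝ≥0 using hs0
    lift t to ℝ≥0 using ht0
    rw [onReal_coe, onReal_coe]
    exact hγ s t (by exact_mod_cast hs.1) (by exact_mod_cast hst) (by exact_mod_cast ht.2)
  intro s hs t ht hst
  rcases lt_trichotomy s t with h | h | h
  · exact absurd hst (key s hs t ht h)
  · exact h
  · exact absurd hst.symm (key t ht s hs h)

lemma IsNonconstant.range_eq {γ : Curve d} (hγ : γ.IsNonconstant) :
    range γ.1 = γ.onReal '' Icc (γ.tStart : ℝ) γ.tFinish := by
  refine Subset.antisymm ?_ ?_
  · rintro _ ⟨s, rfl⟩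
    have hlt := hγ.tStart_lt_tFinish
    refine ⟨((max γ.tStart (min s γ.tFinish) : ℝ≥0) : ℝ), ⟨?_, ?_⟩, ?_⟩
    · exact_mod_cast le_max_left _ _
    · exact_mod_cast max_le hlt.le (min_le_right _ _)
    · rw [onReal_coe]
      rcases le_total s γ.tFinish with h | h
      · rw [min_eq_left h]
        rcases le_total s γ.tStart with h' | h'
        · rw [max_eq_left h', γ.eq_start h', γ.eq_start le_rfl]
        · rw [max_eq_right h']
      · rw [min_eq_right h, max_eq_right hlt.le, γ.eq_tFinish h]
  · rintro _ ⟨s, _, rfl⟩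
    exact ⟨_, rfl⟩

/-- In the interior of its parameter interval a simple curve passes each point only once, so the
preimage chosen in the definition of the tangent is the expected one. -/
lemma IsSimple.tangent_onReal {γ : Curve d} (hγ : γ.IsSimple) {t : ℝ}
    (ht : t ∈ Ioo (γ.tStart : ℝ) γ.tFinish) :
    γ.tangent (γ.onReal t) = ‖deriv γ.onReal t‖⁻¹ • deriv γ.onReal t := by
  have ht0 : 0 ≤ t := γ.tStart.2.trans ht.1.le
  lift t to ℝ≥0 using ht0
  have h1 : γ.tStart < t := by exact_mod_cast ht.1
  have h2 : t < γ.tFinish := by exact_mod_cast ht.2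
  have hinv : Function.invFun γ.1 (γ.onReal t) = t := by
    rw [onReal_coe]
    have hs : γ.1 (Function.invFun γ.1 (γ.1 t)) = γ.1 t := Function.invFun_eq ⟨t, rfl⟩
    generalize Function.invFun γ.1 (γ.1 t) = s at hs
    rcases le_total s γ.tStart with h | h
    · rw [γ.eq_start h, ← γ.eq_start le_rfl] at hs
      exact absurd hs (hγ _ _ le_rfl h1 h2.le)
    · rcases le_total γ.tFinish s with h' | h'
      · rw [γ.eq_tFinish h'] at hs
        exact absurd hs.symm (hγ _ _ h1.le h2 le_rfl)
      · rcases lt_trichotomy s t with h3 | h3 | h3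
        · exact absurd hs (hγ _ _ h h3 h2.le)
        · exact h3
        · exact absurd hs.symm (hγ _ _ h1.le h3 h')
  rw [tangent, hinv]
  rfl

lemma norm_tangent_le (γ : Curve d) (p : Euc d) : ‖γ.tangent p‖ ≤ 1 := by
  simp only [tangent, norm_smul, norm_inv, norm_norm]
  exact inv_mul_le_one

/-- The current of a simple curve, expressed through its parametrisation. -/
lemma IsSimple.current_apply {γ : Curve d} (hγ : γ.IsSimple) (hc : γ.IsNonconstant)
    (ω : OneForm d) : γ.current ω =
      ∫ t in (γ.tStart : ℝ)..γ.tFinish, ω (γ.onReal t) (deriv γ.onReal t) := by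
  set a : ℝ := (γ.tStart).toReal
  set b : ℝ := (γ.tFinish).toReal
  have hab : a ≤ b := by exact_mod_cast hc.tStart_lt_tFinish.le
  have hL := γ.lipschitz_onReal
  have hemb : MeasurableEmbedding ((Icc a b).domRestrict γ.onReal) :=
    (hL.continuous.comp continuous_subtype_val).isClosedEmbedding
      (injOn_iff_injective.1 hγ.injOn_onReal) |>.measurableEmbedding
  have hcomap := comap_hausdorffMeasure hL hγ.injOn_onReal
  have hmap : (Measure.hausdorffMeasure 1).restrict (range γ.1) =
      (((volume : Measure ℝ).comap Subtype.val).withDensity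
        fun t : Icc a b => ‖deriv γ.onReal t‖ₑ).map ((Icc a b).domRestrict γ.onReal) := by
    rw [← hcomap, hemb.map_comap, hc.range_eq, range_domRestrict]
  have hval : MeasurableEmbedding (Subtype.val : Icc a b → ℝ) :=
    MeasurableEmbedding.subtype_coe measurableSet_Icc
  have hvol : ∀ᵐ t ∂((volume : Measure ℝ).comap (Subtype.val : Icc a b → ℝ)),
      t.1 ∈ Ioo a b := by
    rw [← hval.ae_map_iff (p := fun t => t ∈ Ioo a b), hval.map_comap, Subtype.range_coe,
      ← Measure.restrict_congr_set (Ioo_ae_eq_Icc (μ := volume))]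
    exact ae_restrict_mem measurableSet_Ioo
  have hdm : Measurable fun t : Icc a b => deriv γ.onReal t :=
    (measurable_deriv _).comp measurable_subtype_coe
  have htan : ∀ᵐ t ∂((volume : Measure ℝ).comap (Subtype.val : Icc a b → ℝ)),
      γ.tangent (γ.onReal t.1) = ‖deriv γ.onReal t.1‖⁻¹ • deriv γ.onReal t.1 := by
    filter_upwards [hvol] with t ht using hγ.tangent_onReal ht
  have hmeas : AEStronglyMeasurable γ.tangent
      ((Measure.hausdorffMeasure 1).restrict (range γ.1)) := by
    rw [hmap, hemb.aestronglyMeasurable_map_iff]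
    refine AEStronglyMeasurable.congr (f := fun t : Icc a b =>
      ‖deriv γ.onReal t‖⁻¹ • deriv γ.onReal t) (hdm.norm.inv.smul hdm).aestronglyMeasurable ?_
    exact (withDensity_absolutelyContinuous _ _).ae_le (htan.mono fun t ht => ht.symm)
  have hfin : IsFiniteMeasure ((Measure.hausdorffMeasure 1).restrict (range γ.1)) := by
    refine ⟨?_⟩
    rw [Measure.restrict_apply_univ, hc.range_eq]
    refine (hausdorffMeasure_image_le_of_lipschitz hL _).trans_lt ?_
    rw [Real.volume_Icc]
    finiteness
  have hint : LocallyIntegrableOn (fun p => (1 : ℝ) • γ.tangent p)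
      ((⊤ : Opens (Euc d)) : Set (Euc d)) ((Measure.hausdorffMeasure 1).restrict (range γ.1)) := by
    simp only [one_smul]
    exact (Integrable.of_bound hmeas 1
      (Eventually.of_forall γ.norm_tangent_le)).locallyIntegrable.locallyIntegrableOn _
  rw [current, tauCurrent, TestFunction.integralAgainstBilinCLM_eq_integral hint, hmap,
    hemb.integral_map, integral_withDensity_eq_integral_toReal_smul hdm.enorm
      (Eventually.of_forall fun _ => enorm_lt_top),
    intervalIntegral.integral_of_le hab, ← integral_Icc_eq_integral_Ioc,
    ← integral_subtype_comap measurableSet_Icc fun t => ω (γ.onReal t) (deriv γ.onReal t)]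
  refine integral_congr_ae ?_
  filter_upwards [htan] with t ht
  simp only [domRestrict_apply, ContinuousLinearMap.id_apply, one_smul, ht, map_smul, smul_eq_mul,
    toReal_enorm]
  rcases eq_or_ne (deriv γ.onReal t) 0 with h0 | h0
  · simp [h0]
  · rw [← mul_assoc, mul_inv_cancel₀ (norm_ne_zero_iff.2 h0), one_mul]

end Curve

lemma boundary_apply (T : OneCurrent d) (f : ZeroForm d) :
    boundary T f = T (TestFunction.fderivCLM ℝ ⊤ ⊤ f) := rfl

/-- The boundary of the current of a simple curve is the difference of the Dirac masses at its end
points. -/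
lemma Curve.IsSimple.boundary_current {γ : Curve d} (hγ : γ.IsSimple) (hc : γ.IsNonconstant)
    (f : ZeroForm d) : boundary γ.current f = f γ.finish - f γ.start := by
  have hab : (γ.tStart : ℝ) ≤ γ.tFinish := by exact_mod_cast hc.tStart_lt_tFinish.le
  have hL := γ.lipschitz_onReal
  have hf1 : ContDiff ℝ 1 f := f.contDiff.of_le (by exact_mod_cast le_top)
  obtain ⟨C, hC⟩ := hf1.lipschitzWith_of_hasCompactSupport f.hasCompactSupport (by norm_num)
  have hAC := ((hC.comp hL).lipschitzOnWith
    (s := uIcc (γ.tStart : ℝ) γ.tFinish)).absolutelyContinuousOnInterval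
  rw [boundary_apply, hγ.current_apply hc, ← γ.eq_start le_rfl, ← γ.eq_finish le_rfl,
    ← γ.onReal_coe, ← γ.onReal_coe]
  refine Eq.trans ?_ hAC.integral_deriv_eq_sub
  refine intervalIntegral.integral_congr_ae ?_
  filter_upwards [hL.ae_differentiableAt_real] with t ht _
  have h1 : DifferentiableAt ℝ f (γ.onReal t) := hf1.differentiable (by norm_num) _
  rw [TestFunction.fderivCLM_apply_of_le (𝕜 := ℝ) f (by simp)]
  exact (h1.hasFDerivAt.comp_hasDerivAt t ht.hasDerivAt).deriv.symm

lemma massZero_boundary_current_le {γ : Curve d} (hγ : γ.IsSimple) (hc : γ.IsNonconstant) :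
    massZero (boundary γ.current) ≤ 2 := by
  refine iSup₂_le fun f hf => ?_
  rw [hγ.boundary_current hc]
  refine ENNReal.ofReal_le_of_le_toReal ?_
  rw [ENNReal.toReal_ofNat]
  have h1 := abs_le.1 (hf γ.finish)
  have h2 := abs_le.1 (hf γ.start)
  linarith

lemma mass_current_le (γ : Curve d) :
    mass γ.current ≤ Measure.hausdorffMeasure 1 (range γ.1) := by
  refine iSup₂_le fun ω hω => ?_
  rw [Curve.current, tauCurrent, TestFunction.integralAgainstBilinCLM_apply]
  split_ifs
  · refine (ENNReal.ofReal_le_ofReal (Real.le_norm_self _)).trans ?_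
    rw [ofReal_norm]
    refine (enorm_integral_le_lintegral_enorm _).trans ?_
    rw [← Measure.restrict_apply_univ, ← lintegral_one]
    refine lintegral_mono fun p => ?_
    simp only [one_smul, ContinuousLinearMap.id_apply]
    rw [← ofReal_norm, ← ENNReal.ofReal_one]
    refine ENNReal.ofReal_le_ofReal (((ω p).le_opNorm _).trans ?_)
    exact mul_le_one₀ (hω p) (norm_nonneg _) (γ.norm_tangent_le p)
  · simp

/-! ### Rectifiable currents and currents on them -/

/-- The mass measure `θ ℋ¹⌞C` of the rectifiable current `τ(C, θ, ξ)`. -/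
def massMeasure (C : Set (Euc d)) (θ : Euc d → ℝ) : Measure (Euc d) :=
  ((Measure.hausdorffMeasure 1).restrict C).withDensity fun p => ENNReal.ofReal (θ p)

namespace IsRectifiableRep

variable {T : OneCurrent d} {C : Set (Euc d)} {θ : Euc d → ℝ} {ξ : Euc d → Euc d}

lemma aemeasurable_weight (h : IsRectifiableRep T C θ ξ) :
    AEMeasurable θ ((Measure.hausdorffMeasure 1).restrict C) :=
  h.locallyIntegrable.aestronglyMeasurable.aemeasurable

lemma ae_pos (h : IsRectifiableRep T C θ ξ) :
    ∀ᵐ p ∂((Measure.hausdorffMeasure 1).restrict C), 0 < θ p := by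
  filter_upwards [ae_restrict_mem₀ h.measurable_carrier] with p hp using h.pos p hp

lemma isFiniteMeasureOnCompacts (h : IsRectifiableRep T C θ ξ) :
    IsFiniteMeasureOnCompacts (massMeasure C θ) := by
  refine ⟨fun K hK => ?_⟩
  rw [massMeasure, withDensity_apply _ hK.measurableSet]
  refine lt_of_le_of_lt (lintegral_mono fun p => ?_)
    (h.locallyIntegrable.integrableOn_isCompact hK).2
  rw [← ofReal_norm]
  exact ENNReal.ofReal_le_ofReal (Real.le_norm_self _)

lemma absolutelyContinuous (h : IsRectifiableRep T C θ ξ) :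
    (Measure.hausdorffMeasure 1).restrict C ≪ massMeasure C θ :=
  withDensity_absolutelyContinuous' h.aemeasurable_weight.ennreal_ofReal
    (h.ae_pos.mono fun p hp => by simpa using hp)

lemma absolutelyContinuous' (C : Set (Euc d)) (θ : Euc d → ℝ) :
    massMeasure C θ ≪ (Measure.hausdorffMeasure 1).restrict C :=
  withDensity_absolutelyContinuous _ _

lemma integral_massMeasure (h : IsRectifiableRep T C θ ξ) {F : Type*} [NormedAddCommGroup F]
    [NormedSpace ℝ F] (g : Euc d → F) :
    ∫ p, g p ∂(massMeasure C θ) = ∫ p in C, θ p • g p ∂(Measure.hausdorffMeasure 1) := by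
  rw [massMeasure, integral_withDensity_eq_integral_toReal_smul₀
    h.aemeasurable_weight.ennreal_ofReal (Eventually.of_forall fun _ => ENNReal.ofReal_lt_top)]
  refine integral_congr_ae ?_
  filter_upwards [h.ae_pos] with p hp
  rw [ENNReal.toReal_ofReal hp.le]

lemma aestronglyMeasurable_orientation (h : IsRectifiableRep T C θ ξ) :
    AEStronglyMeasurable ξ (massMeasure C θ) :=
  h.measurable_orientation.mono_ac (absolutelyContinuous' C θ)

lemma ae_norm_orientation (h : IsRectifiableRep T C θ ξ) :
    ∀ᵐ p ∂(massMeasure C θ), ‖ξ p‖ = 1 :=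
  (absolutelyContinuous' C θ).ae_le (h.tangent.mono fun _ hp => hp.1)

lemma apply (h : IsRectifiableRep T C θ ξ) (ω : OneForm d) :
    T ω = ∫ p, ω p (ξ p) ∂(massMeasure C θ) := by
  have hloc : LocallyIntegrableOn (fun p => θ p • ξ p) ((⊤ : Opens (Euc d)) : Set (Euc d))
      ((Measure.hausdorffMeasure 1).restrict C) := by
    refine LocallyIntegrable.locallyIntegrableOn ?_ _
    refine h.locallyIntegrable.mono
      (h.locallyIntegrable.aestronglyMeasurable.smul h.measurable_orientation) ?_
    filter_upwards [h.tangent] with p hp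
    rw [norm_smul, hp.1, mul_one]
  rw [h.integral_massMeasure, h.eq_tau, tauCurrent,
    TestFunction.integralAgainstBilinCLM_eq_integral hloc]
  simp

lemma locallyIntegrable_orientation (h : IsRectifiableRep T C θ ξ) :
    LocallyIntegrable ξ (massMeasure C θ) := by
  have := h.isFiniteMeasureOnCompacts
  exact locallyIntegrable_iff.2 fun k hk => Measure.integrableOn_of_bounded hk.measure_lt_top.ne
    h.aestronglyMeasurable_orientation
      (ae_restrict_of_ae (h.ae_norm_orientation.mono fun p hp => hp.le))

lemma mass_eq (h : IsRectifiableRep T C θ ξ) : mass T = massMeasure C θ univ := by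
  have := h.isFiniteMeasureOnCompacts
  refine le_antisymm (iSup₂_le fun ω hω => ?_) ?_
  · rw [h.apply]
    refine (ENNReal.ofReal_le_ofReal (Real.le_norm_self _)).trans ?_
    rw [ofReal_norm]
    refine (enorm_integral_le_lintegral_enorm _).trans ?_
    rw [← lintegral_one]
    refine lintegral_mono_ae ?_
    filter_upwards [h.ae_norm_orientation] with p hp
    rw [← ofReal_norm, ← ENNReal.ofReal_one]
    refine ENNReal.ofReal_le_ofReal (((ω p).le_opNorm _).trans ?_)
    rw [hp, mul_one]
    exact hω p
  · refine (measure_univ_le_iSup_form h.aestronglyMeasurable_orientation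
      h.ae_norm_orientation).trans (le_of_eq ?_)
    simp only [mass, h.apply]

/-- Multiplying the multiplicity by a bounded function preserves approximate tangent spaces at
almost every point, by the Lebesgue differentiation theorem for the mass measure. -/
lemma ae_isApproxTangentSpace_mul (h : IsRectifiableRep T C θ ξ) {ρ : Euc d → ℝ}
    (hρ : Measurable ρ) (hρ0 : ∀ p, 0 ≤ ρ p) (hρ1 : ∀ p, ρ p ≤ 1) :
    ∀ᵐ p ∂((Measure.hausdorffMeasure 1).restrict C), IsApproxTangentSpace (C ∩ {p | ρ p ≠ 0})
      (fun z => ρ z * θ z) p (Submodule.span ℝ {ξ p}) := by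
  have := h.isFiniteMeasureOnCompacts
  set μ := massMeasure C θ with hμ
  have hρb : ∀ p, ‖ρ p‖ ≤ 1 := fun p => by
    rw [Real.norm_of_nonneg (hρ0 p)]; exact hρ1 p
  have hρi : LocallyIntegrable ρ μ := locallyIntegrable_iff.2 fun k hk =>
    Measure.integrableOn_of_bounded hk.measure_lt_top.ne hρ.aestronglyMeasurable
      (Eventually.of_forall hρb)
  have hleb := h.absolutelyContinuous.ae_le
    ((Besicovitch.vitaliFamily μ).ae_tendsto_average_norm_sub hρi)
  filter_upwards [h.tangent, hleb] with p hp hpl f hf hfc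
  set P := Submodule.span ℝ {ξ p}
  -- rewrite the rescaled integrals in terms of the mass measure
  have hC : ∀ g : Euc d → ℝ, ∫ z in C, g z * θ z ∂(Measure.hausdorffMeasure 1) = ∫ z, g z ∂μ :=
    fun g => by
      rw [h.integral_massMeasure]
      simp only [smul_eq_mul, mul_comm]
  have hD : ∀ g : Euc d → ℝ, ∫ z in C ∩ {p | ρ p ≠ 0}, g z * (ρ z * θ z)
      ∂(Measure.hausdorffMeasure 1) = ∫ z, g z * ρ z ∂μ := fun g => by
    have hms : MeasurableSet {p | ρ p ≠ 0} := hρ (measurableSet_singleton 0).compl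
    rw [← hC, inter_comm, ← Measure.restrict_restrict hms]
    simp only [mul_assoc]
    exact setIntegral_eq_integral_of_forall_compl_eq_zero fun z hz => by
      have : ρ z = 0 := not_not.1 hz
      simp [this]
  simp only [hD]
  obtain ⟨R, hR0, hR⟩ : ∃ R, 0 < R ∧ ∀ z, R < ‖z‖ → f z = 0 := by
    obtain ⟨R, hR⟩ := hfc.isBounded.subset_closedBall 0
    refine ⟨max R 1, by positivity, fun z hz => image_eq_zero_of_notMem_tsupport fun hz' => ?_⟩
    have := hR hz'
    rw [mem_closedBall_zero_iff] at this
    exact absurd (hz.trans_le this) (not_lt.2 (le_max_left _ _))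
  obtain ⟨M, hM⟩ := hf.bounded_above_of_compact_support hfc
  have hM0 : 0 ≤ M := (norm_nonneg _).trans (hM 0)
  -- a test function that is at least one on the ball of radius `R`, so that the convergence of its
  -- rescaled integrals bounds the mass of the balls `B(p, R r)` by a multiple of `r`
  set χ : Euc d → ℝ := fun z => max 0 (R + 1 - ‖z‖) with hχ
  have hχc : Continuous χ := continuous_const.max (continuous_const.sub continuous_norm)
  have hχs : HasCompactSupport χ := by
    refine HasCompactSupport.intro (isCompact_closedBall (0 : Euc d) (R + 1)) fun z hz => ?_
    rw [mem_closedBall_zero_iff, not_le] at hz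
    exact max_eq_left (by linarith)
  have hlimf := hp.2 f hf hfc
  have hlimχ := hp.2 χ hχc hχs
  simp only [hC] at hlimf hlimχ
  have hscale : ∀ r : ℝ, 0 < r → ∀ z, ‖r⁻¹ • (z - p)‖ ≤ R ↔ z ∈ Metric.closedBall p (R * r) := by
    intro r hr z
    rw [norm_smul, norm_inv, Real.norm_of_nonneg hr.le, mem_closedBall_iff_norm,
      inv_mul_le_iff₀ hr, mul_comm]
  have hcomp : ∀ {g : Euc d → ℝ}, Continuous g → HasCompactSupport g → ∀ r : ℝ, 0 < r →
      Integrable (fun z => g (r⁻¹ • (z - p))) μ := by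
    intro g hg hgc r hr
    refine (hg.comp (by fun_prop)).integrable_of_hasCompactSupport ?_
    exact hgc.comp_homeomorph
      ((Homeomorph.subRight p).trans (Homeomorph.smulOfNeZero r⁻¹ (inv_ne_zero hr.ne')))
  have hball : Tendsto (fun r : ℝ => ⨍ z in Metric.closedBall p (R * r), ‖ρ z - ρ p‖ ∂μ)
      (𝓝[>] 0) (𝓝 0) := by
    refine (hpl.comp (Besicovitch.tendsto_filterAt μ p)).comp ?_
    refine tendsto_nhdsWithin_iff.2 ⟨?_, ?_⟩
    · have : Tendsto (fun r : ℝ => R * r) (𝓝 0) (𝓝 (R * 0)) := tendsto_id.const_mul R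
      rw [mul_zero] at this
      exact this.mono_left nhdsWithin_le_nhds
    · filter_upwards [self_mem_nhdsWithin] with r hr using mul_pos hR0 hr
  have herr : Tendsto (fun r : ℝ => r⁻¹ * ∫ z, f (r⁻¹ • (z - p)) * (ρ z - ρ p) ∂μ) (𝓝[>] 0)
      (𝓝 0) := by
    have hprod := (hlimχ.mul hball).const_mul M
    rw [mul_zero, mul_zero] at hprod
    refine squeeze_zero_norm' ?_ hprod
    filter_upwards [self_mem_nhdsWithin] with r (hr : 0 < r)
    set B := Metric.closedBall p (R * r)
    have hBfin : μ B ≠ ∞ := (isCompact_closedBall p (R * r)).measure_lt_top.ne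
    have hBm : MeasurableSet B := Metric.isClosed_closedBall.measurableSet
    have hρB : IntegrableOn (fun z => ‖ρ z - ρ p‖) B μ :=
      ((hρi.integrableOn_isCompact (isCompact_closedBall p (R * r))).sub
        (integrableOn_const hBfin)).norm
    have h1 : ‖∫ z, f (r⁻¹ • (z - p)) * (ρ z - ρ p) ∂μ‖ ≤ M * ∫ z in B, ‖ρ z - ρ p‖ ∂μ := by
      rw [← setIntegral_eq_integral_of_forall_compl_eq_zero (s := B), ← integral_const_mul]
      · refine norm_integral_le_of_norm_le (hρB.const_mul M) (Eventually.of_forall fun z => ?_)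
        rw [norm_mul]
        exact mul_le_mul_of_nonneg_right (hM _) (norm_nonneg _)
      · intro z hz
        rw [hR _ (not_le.1 fun hz' => hz ((hscale r hr z).1 hz')), zero_mul]
    have h2 : ∫ z in B, ‖ρ z - ρ p‖ ∂μ = μ.real B * ⨍ z in B, ‖ρ z - ρ p‖ ∂μ := by
      rw [← smul_eq_mul, measure_smul_setAverage _ hBfin]
    have h3 : μ.real B ≤ ∫ z, χ (r⁻¹ • (z - p)) ∂μ := by
      rw [← integral_indicator_one hBm]
      refine integral_mono ((integrable_indicator_iff hBm).2 (integrableOn_const hBfin))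
        (hcomp hχc hχs r hr) fun z => ?_
      by_cases hz : z ∈ B
      · rw [indicator_of_mem hz]
        refine le_max_of_le_right ?_
        have := (hscale r hr z).2 hz
        simp only [Pi.one_apply]
        linarith
      · rw [indicator_of_notMem hz]
        exact le_max_left _ _
    have h4 : 0 ≤ ⨍ z in B, ‖ρ z - ρ p‖ ∂μ := by
      rw [setAverage_eq]
      exact smul_nonneg (inv_nonneg.2 measureReal_nonneg) (integral_nonneg fun _ => norm_nonneg _)
    rw [norm_mul, norm_inv, Real.norm_of_nonneg hr.le]
    calc r⁻¹ * ‖∫ z, f (r⁻¹ • (z - p)) * (ρ z - ρ p) ∂μ‖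
        ≤ r⁻¹ * (M * ((∫ z, χ (r⁻¹ • (z - p)) ∂μ) * ⨍ z in B, ‖ρ z - ρ p‖ ∂μ)) := by
          refine mul_le_mul_of_nonneg_left (h1.trans ?_) (inv_nonneg.2 hr.le)
          rw [h2]
          gcongr
      _ = _ := by ring
  have hmain := (hlimf.const_mul (ρ p)).add herr
  rw [add_zero, ← mul_assoc] at hmain
  refine hmain.congr' ?_
  filter_upwards [self_mem_nhdsWithin] with r (hr : 0 < r)
  have hfi := hcomp hf hfc r hr
  have hfρ : Integrable (fun z => f (r⁻¹ • (z - p)) * ρ z) μ :=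
    hfi.mul_bdd (c := 1) hρ.aestronglyMeasurable (Eventually.of_forall hρb)
  have : ∀ z, f (r⁻¹ • (z - p)) * (ρ z - ρ p) =
      f (r⁻¹ • (z - p)) * ρ z - ρ p * f (r⁻¹ • (z - p)) := fun z => by ring
  simp_rw [this]
  rw [integral_sub hfρ (hfi.const_mul _), integral_const_mul]
  ring

/-- A signed density `ψ` bounded by one with respect to a rectifiable current defines a rectifiable
current on it: the carrier is cut down to `{ψ ≠ 0}`, the multiplicity is `|ψ| θ`, and the sign of
`ψ` goes into the orientation. -/
lemma exists_isOn (h : IsRectifiableRep T C θ ξ) {ψ : Euc d → ℝ} (hψ : Measurable ψ)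
    (hψ1 : ∀ p, |ψ p| ≤ 1) :
    ∃ S : OneCurrent d, IsOn S T ∧ ∀ ω, S ω = ∫ p, ψ p * ω p (ξ p) ∂(massMeasure C θ) := by
  set ρ : Euc d → ℝ := fun p => |ψ p| with hρ
  have hρm : Measurable ρ := hψ.abs
  set D : Set (Euc d) := C ∩ {p | ρ p ≠ 0} with hD
  have hDs : MeasurableSet {p | ρ p ≠ 0} := hρm (measurableSet_singleton 0).compl
  have hDC : D ⊆ C := inter_subset_left
  have hDm : NullMeasurableSet D (Measure.hausdorffMeasure 1) :=
    h.measurable_carrier.inter hDs.nullMeasurableSet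
  set φ : Euc d → ℝ := fun p => ρ p * θ p with hφ
  set ζ : Euc d → Euc d := fun p => (if 0 ≤ ψ p then (1 : ℝ) else -1) • ξ p with hζ
  have hsm : Measurable fun p => if 0 ≤ ψ p then (1 : ℝ) else -1 :=
    Measurable.ite (measurableSet_le measurable_const hψ) measurable_const measurable_const
  have hres := Measure.restrict_mono_set (Measure.hausdorffMeasure 1) hDC
  have hspan : ∀ p, Submodule.span ℝ {ζ p} = Submodule.span ℝ {ξ p} := fun p => by
    refine Submodule.span_singleton_smul_eq (R := ℝ) ?_ (ξ p)
    split_ifs <;> norm_num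
  have hφζ : ∀ p, φ p • ζ p = (ψ p * θ p) • ξ p := fun p => by
    simp only [hφ, hζ, hρ, smul_smul]
    congr 1
    split_ifs with h0
    · rw [abs_of_nonneg h0]; ring
    · rw [abs_of_neg (not_le.1 h0)]; ring
  have hrep : IsRectifiableRep (tauCurrent D φ ζ) D φ ζ := by
    refine ⟨hDm, ?_, fun p hp => ?_, ?_, ?_, ?_, rfl⟩
    · obtain ⟨C₀, F, h1, h2, h3⟩ := h.rectifiable
      exact ⟨C₀, F, h1, h2, hDC.trans h3⟩
    · exact mul_pos (lt_of_le_of_ne (abs_nonneg _) (Ne.symm hp.2)) (h.pos p hp.1)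
    · refine (h.locallyIntegrable.mono_measure hres).mono ?_ ?_
      · exact hρm.aestronglyMeasurable.mul
          (h.locallyIntegrable.aestronglyMeasurable.mono_measure hres)
      · refine Eventually.of_forall fun p => ?_
        rw [hφ, norm_mul, Real.norm_of_nonneg (abs_nonneg (ψ p))]
        exact mul_le_of_le_one_left (norm_nonneg _) (hψ1 p)
    · exact hsm.aestronglyMeasurable.smul (h.measurable_orientation.mono_measure hres)
    · have h1 := h.ae_isApproxTangentSpace_mul hρm (fun p => abs_nonneg _) hψ1
      have h2 := ae_mono hres (h1.and h.tangent)
      filter_upwards [h2] with p hp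
      refine ⟨?_, by rw [hspan]; exact hp.1⟩
      rw [hζ, norm_smul, hp.2.1, mul_one]
      split_ifs <;> simp
  refine ⟨tauCurrent D φ ζ, ⟨C, θ, ξ, D, φ, ζ, h, hrep, ?_, ?_⟩, fun ω => ?_⟩
  · rw [sdiff_eq_empty.2 hDC, measure_empty]
  · filter_upwards [ae_restrict_mem₀ hDm] with p hp
    exact mul_le_of_le_one_left (h.pos p hp.1).le (hψ1 p)
  · rw [hrep.apply, hrep.integral_massMeasure, h.integral_massMeasure, hD, inter_comm,
      ← Measure.restrict_restrict hDs]
    have h1 : ∀ p, φ p • ω p (ζ p) = θ p • (ψ p * ω p (ξ p)) := fun p => by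
      rw [← map_smul, hφζ, map_smul, smul_eq_mul, smul_eq_mul]; ring
    simp only [h1]
    refine setIntegral_eq_integral_of_forall_compl_eq_zero fun p hp => ?_
    have : ψ p = 0 := abs_eq_zero.1 (not_not.1 hp)
    simp [this]

end IsRectifiableRep

/-! ### Mass and parts of a decomposition -/

lemma enorm_apply_le_mass (S : OneCurrent d) (ω : OneForm d) {C : ℝ} (hC0 : 0 < C)
    (hC : ∀ p, ‖ω p‖ ≤ C) : ‖S ω‖ₑ ≤ ENNReal.ofReal C * mass S := by
  have key : ∀ ω : OneForm d, (∀ p, ‖ω p‖ ≤ C) →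
      ENNReal.ofReal (S ω) ≤ ENNReal.ofReal C * mass S := by
    intro ω hω
    have h1 : ENNReal.ofReal (S (C⁻¹ • ω)) ≤ mass S := by
      refine le_iSup₂_of_le (C⁻¹ • ω) (fun p => ?_) le_rfl
      rw [FunLike.coe_smul, Pi.smul_apply, norm_smul, norm_inv, Real.norm_of_nonneg hC0.le,
        inv_mul_le_iff₀ hC0, mul_one]
      exact hω p
    calc ENNReal.ofReal (S ω) = ENNReal.ofReal (C * S (C⁻¹ • ω)) := by
          rw [map_smul, smul_eq_mul, mul_inv_cancel_left₀ hC0.ne']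
      _ = ENNReal.ofReal C * ENNReal.ofReal (S (C⁻¹ • ω)) := ENNReal.ofReal_mul hC0.le
      _ ≤ _ := by gcongr
  rw [← ofReal_norm]
  rcases le_total 0 (S ω) with h | h
  · rw [Real.norm_of_nonneg h]; exact key ω hC
  · rw [Real.norm_of_nonpos h, ← map_neg]
    exact key (-ω) fun p => by rw [neg_apply, norm_neg]; exact hC p

namespace IsGoodDecomposition

variable {T : OneCurrent d} {η : Measure (Curve d)}

lemma mass_ne_top (h : IsGoodDecomposition T η) : mass T ≠ ∞ :=
  ne_top_of_le_ne_top h.normal.ne le_self_add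

/-- The functional `ω ↦ ∫_G I_γ(ω) dη(γ)`. -/
def part (h : IsGoodDecomposition T η) (G : Set (Curve d)) : OneForm d →ₗ[ℝ] ℝ where
  toFun ω := ∫ γ in G, γ.current ω ∂η
  map_add' ω ω' := by
    simp only [map_add]
    exact integral_add (h.integrable ω).restrict (h.integrable ω').restrict
  map_smul' c ω := by
    simp only [map_smul, RingHom.id_apply]
    exact integral_smul _ _

lemma part_apply (h : IsGoodDecomposition T η) (G : Set (Curve d)) (ω : OneForm d) :
    h.part G ω = ∫ γ in G, γ.current ω ∂η := rfl

lemma setLIntegral_mass_ne_top (h : IsGoodDecomposition T η) (G : Set (Curve d)) :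
    ∫⁻ γ in G, mass γ.current ∂η ≠ ∞ :=
  ne_top_of_le_ne_top h.mass_ne_top (h.mass_eq ▸ setLIntegral_le_lintegral _ _)

lemma part_le (h : IsGoodDecomposition T η) (G : Set (Curve d)) (ω : OneForm d)
    (hω : ∀ p, ‖ω p‖ ≤ 1) : h.part G ω ≤ (∫⁻ γ in G, mass γ.current ∂η).toReal := by
  rw [part_apply]
  refine (Real.le_norm_self _).trans ?_
  rw [← toReal_enorm]
  refine ENNReal.toReal_mono (h.setLIntegral_mass_ne_top G)
    ((enorm_integral_le_lintegral_enorm _).trans (lintegral_mono fun γ => ?_))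
  simpa using enorm_apply_le_mass γ.current ω one_pos hω

end IsGoodDecomposition

/-- `ρ` is the density of the part in `G` of a decomposition `η` of `τ(C, θ, ξ)`: the curves in `G`
carry the current `τ(C, ρ θ, ξ)`, with `0 ≤ ρ ≤ 1`, and no mass is lost in the superposition. -/
structure IsPartDensity (η : Measure (Curve d)) (C : Set (Euc d)) (θ : Euc d → ℝ)
    (ξ : Euc d → Euc d) (G : Set (Curve d)) (ρ : Euc d → ℝ≥0) : Prop where
  measurable : Measurable ρ
  le_one : ∀ p, ρ p ≤ 1
  integral_eq : ∀ ω : OneForm d,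
    ∫ γ in G, γ.current ω ∂η = ∫ p, ρ p * ω p (ξ p) ∂(massMeasure C θ)
  lintegral_eq : ∫⁻ p, ρ p ∂(massMeasure C θ) = ∫⁻ γ in G, mass γ.current ∂η

namespace IsGoodDecomposition

variable {T : OneCurrent d} {η : Measure (Curve d)}

/-- There is no cancellation in a good decomposition: each part of it is carried by a scalar
multiple `0 ≤ ρ ≤ 1` of the multiplicity. -/
theorem exists_density (h : IsGoodDecomposition T η) {C : Set (Euc d)} {θ : Euc d → ℝ}
    {ξ : Euc d → Euc d} (hT : IsRectifiableRep T C θ ξ) {G : Set (Curve d)}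
    (hG : MeasurableSet G) :
    ∃ ρ : Euc d → ℝ≥0, IsPartDensity η C θ ξ G ρ := by
  have hfin : IsFiniteMeasure (massMeasure C θ) :=
    ⟨by rw [← hT.mass_eq]; exact h.mass_ne_top.lt_top⟩
  obtain ⟨ρ, h1, h2, h3, h4⟩ := exists_density_of_add hT.aestronglyMeasurable_orientation
    hT.ae_norm_orientation (S := h.part G) (S' := h.part Gᶜ)
    (l := (∫⁻ γ in G, mass γ.current ∂η).toReal) (l' := (∫⁻ γ in Gᶜ, mass γ.current ∂η).toReal)
    (fun ω => by
      rw [part_apply, part_apply, integral_add_compl hG (h.integrable ω), ← h.eq_integral,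
        hT.apply])
    (h.part_le G) (h.part_le Gᶜ)
    (by
      rw [← ENNReal.toReal_add (h.setLIntegral_mass_ne_top _) (h.setLIntegral_mass_ne_top _),
        lintegral_add_compl _ hG, ← h.mass_eq, hT.mass_eq])
  exact ⟨ρ, h1, h2, h3, by rw [h4, ENNReal.ofReal_toReal (h.setLIntegral_mass_ne_top _)]⟩

end IsGoodDecomposition

/-! ### Reweighting a measure on a countable partition -/

/-- The measure `∑ₖ κₖ η⌞Gₖ`. -/
def reweight {X ι : Type*} [MeasurableSpace X] (η : Measure X) (G : ι → Set X) (κ : ι → ℝ≥0) :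
    Measure X := Measure.sum fun k => κ k • η.restrict (G k)

section reweight

variable {X ι : Type*} [MeasurableSpace X] {η : Measure X} {G : ι → Set X}
  {κ : ι → ℝ≥0}

lemma reweight_one [Countable ι] (hG : ∀ k, MeasurableSet (G k))
    (hd : Pairwise (Function.onFun Disjoint G))
    (hcover : ∀ᵐ z ∂η, z ∈ ⋃ k, G k) : reweight η G 1 = η := by
  simp only [reweight, Pi.one_apply, one_smul]
  rw [← Measure.restrict_iUnion hd hG]
  exact Measure.restrict_eq_self_of_ae_mem hcover

lemma lintegral_reweight (f : X → ℝ≥0∞) :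
    ∫⁻ z, f z ∂(reweight η G κ) = ∑' k, κ k * ∫⁻ z in G k, f z ∂η := by
  simp only [reweight, lintegral_sum_measure]
  exact tsum_congr fun k => lintegral_smul_measure _ _

lemma reweight_apply {E : Set X} (hE : MeasurableSet E) :
    reweight η G κ E = ∑' k, κ k * η (E ∩ G k) := by
  rw [reweight, Measure.sum_apply _ hE]
  refine tsum_congr fun k => ?_
  rw [Measure.smul_apply, Measure.restrict_apply hE]
  rfl

lemma reweight_absolutelyContinuous : reweight η G κ ≪ η :=
  Measure.absolutelyContinuous_sum_left fun k =>
    (Measure.smul_absolutelyContinuous (c := κ k)).trans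
      Measure.restrict_le_self.absolutelyContinuous

lemma reweight_restrict (hG : ∀ k, MeasurableSet (G k))
    (hd : Pairwise (Function.onFun Disjoint G)) (k : ι) :
    (reweight η G κ).restrict (G k) = κ k • η.restrict (G k) := by
  ext E hE
  rw [Measure.restrict_apply hE, reweight_apply (hE.inter (hG k)), tsum_eq_single k,
    Measure.smul_apply, Measure.restrict_apply hE, inter_assoc, inter_self]
  · rfl
  · intro k' hk'
    rw [inter_assoc, (hd hk'.symm).inter_eq, inter_empty, measure_empty, mul_zero]

end reweight

lemma measurableSet_curvesFromTo (a b : Euc d) : MeasurableSet (curvesFromTo a b) :=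
  (Curve.measurable_start (measurableSet_singleton a)).inter
    (Curve.measurable_finish (measurableSet_singleton b))

/-- The boundary of the part of a decomposition into curves from `a` to `b`. -/
lemma IsGoodDecomposition.integral_curvesFromTo {T : OneCurrent d} {η : Measure (Curve d)}
    (h : IsGoodDecomposition T η) (a b : Euc d) (f : ZeroForm d) :
    ∫ γ in curvesFromTo a b, γ.current (TestFunction.fderivCLM ℝ ⊤ ⊤ f) ∂η =
      (η (curvesFromTo a b)).toReal * (f b - f a) := by
  have h1 : ∀ᵐ γ ∂(η.restrict (curvesFromTo a b)),
      γ.current (TestFunction.fderivCLM ℝ ⊤ ⊤ f) = f b - f a := by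
    filter_upwards [ae_restrict_of_ae h.simple, ae_restrict_mem (measurableSet_curvesFromTo a b)]
      with γ hγ hab
    rw [← boundary_apply, hγ.2.boundary_current hγ.1, hab.1, hab.2]
  rw [integral_congr_ae h1, integral_const, smul_eq_mul, measureReal_restrict_apply_univ,
    measureReal_def]

section atomic

variable {M N : ℕ∞} {x : Idx M → Euc d} {y : Idx N → Euc d}

/-- The sets `Γ_{xᵢ,yⱼ}`, indexed by pairs. -/
def cell (x : Idx M → Euc d) (y : Idx N → Euc d) (k : Idx M × Idx N) : Set (Curve d) :=
  curvesFromTo (x k.1) (y k.2)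

lemma measurableSet_cell (k : Idx M × Idx N) : MeasurableSet (cell x y k) :=
  measurableSet_curvesFromTo _ _

lemma pairwise_disjoint_cell (hx : Function.Injective x) (hy : Function.Injective y) :
    Pairwise (Function.onFun Disjoint (cell x y)) := by
  intro k l hkl
  refine Set.disjoint_left.2 fun γ h1 h2 => hkl ?_
  exact Prod.ext (hx (h1.1.symm.trans h2.1)) (hy (h1.2.symm.trans h2.2))

lemma atomicMeasure_apply (w : Idx M → ℝ≥0) {E : Set (Euc d)} (hE : MeasurableSet E) :
    atomicMeasure x w E = ∑' i, (w i : ℝ≥0∞) * E.indicator 1 (x i) := by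
  rw [atomicMeasure, Measure.sum_apply _ hE]
  refine tsum_congr fun i => ?_
  rw [Measure.smul_apply, Measure.dirac_apply' _ hE]
  rfl

lemma ae_atomicMeasure (w : Idx M → ℝ≥0) : ∀ᵐ p ∂(atomicMeasure x w), p ∈ range x := by
  have hm : MeasurableSet (range x)ᶜ := (countable_range x).measurableSet.compl
  refine ae_iff.2 ?_
  change atomicMeasure x w (range x)ᶜ = 0
  rw [atomicMeasure_apply w hm]
  simp

lemma map_start_reweight {η : Measure (Curve d)} (κ : Idx M × Idx N → ℝ≥0) {E : Set (Euc d)}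
    (hE : MeasurableSet E) : (reweight η (cell x y) κ).map Curve.start E =
      ∑' i, (∑' j, κ (i, j) * η (cell x y (i, j))) * E.indicator 1 (x i) := by
  rw [Measure.map_apply Curve.measurable_start hE,
    reweight_apply (Curve.measurable_start hE), ENNReal.tsum_prod']
  refine tsum_congr fun i => ?_
  rw [← ENNReal.tsum_mul_right]
  refine tsum_congr fun j => ?_
  by_cases hi : x i ∈ E
  · rw [indicator_of_mem hi, Pi.one_apply, mul_one]
    congr 2
    exact inter_eq_right.2 fun γ hγ => by rw [mem_preimage, hγ.1]; exact hi
  · rw [indicator_of_notMem hi, mul_zero]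
    have : Curve.start ⁻¹' E ∩ cell x y (i, j) = ∅ := by
      refine eq_empty_of_forall_notMem fun γ hγ => hi ?_
      rw [← hγ.2.1]; exact hγ.1
    rw [this, measure_empty, mul_zero]

lemma map_finish_reweight {η : Measure (Curve d)} (κ : Idx M × Idx N → ℝ≥0) {E : Set (Euc d)}
    (hE : MeasurableSet E) : (reweight η (cell x y) κ).map Curve.finish E =
      ∑' j, (∑' i, κ (i, j) * η (cell x y (i, j))) * E.indicator 1 (y j) := by
  rw [Measure.map_apply Curve.measurable_finish hE,
    reweight_apply (Curve.measurable_finish hE), ENNReal.tsum_prod', ENNReal.tsum_comm]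
  refine tsum_congr fun j => ?_
  rw [← ENNReal.tsum_mul_right]
  refine tsum_congr fun i => ?_
  by_cases hj : y j ∈ E
  · rw [indicator_of_mem hj, Pi.one_apply, mul_one]
    congr 2
    exact inter_eq_right.2 fun γ hγ => by rw [mem_preimage, hγ.2]; exact hj
  · rw [indicator_of_notMem hj, mul_zero]
    have : Curve.finish ⁻¹' E ∩ cell x y (i, j) = ∅ := by
      refine eq_empty_of_forall_notMem fun γ hγ => hj ?_
      rw [← hγ.2.2]; exact hγ.1
    rw [this, measure_empty, mul_zero]

variable {m' : Idx M → ℝ≥0} {m : Idx N → ℝ≥0} {η : Measure (Curve d)}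
  {A : Matrix (Idx M) (Idx N) ℝ≥0}

lemma IsRepresentingMatrix.ae_mem_cell (hA : IsRepresentingMatrix x y m' m η A) :
    ∀ᵐ γ ∂η, γ ∈ ⋃ k, cell x y k := by
  have h1 : ∀ᵐ γ ∂η, γ.start ∈ range x :=
    ae_of_ae_map Curve.measurable_start.aemeasurable (hA.map_start ▸ ae_atomicMeasure m')
  have h2 : ∀ᵐ γ ∂η, γ.finish ∈ range y :=
    ae_of_ae_map Curve.measurable_finish.aemeasurable (hA.map_finish ▸ ae_atomicMeasure m)
  filter_upwards [h1, h2] with γ ⟨i, hi⟩ ⟨j, hj⟩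
  exact mem_iUnion.2 ⟨(i, j), hi.symm, hj.symm⟩

lemma IsRepresentingMatrix.reweight_one_eq (hA : IsRepresentingMatrix x y m' m η A)
    (hx : Function.Injective x) (hy : Function.Injective y) : reweight η (cell x y) 1 = η :=
  reweight_one measurableSet_cell (pairwise_disjoint_cell hx hy) hA.ae_mem_cell

lemma IsRepresentingMatrix.tsum_row (hA : IsRepresentingMatrix x y m' m η A)
    (hx : Function.Injective x) (hy : Function.Injective y) (i : Idx M) :
    ∑' j, (A i j : ℝ≥0∞) = m' i := by
  have hE := measurableSet_singleton (x i)
  have h1 := map_start_reweight (x := x) (y := y) (η := η) 1 hE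
  rw [hA.reweight_one_eq hx hy, hA.map_start, atomicMeasure_apply _ hE,
    tsum_eq_single i fun k hk => by simp [hx.ne hk],
    tsum_eq_single i fun k hk => by simp [hx.ne hk]] at h1
  simpa [cell, hA.entry] using h1.symm

lemma IsRepresentingMatrix.tsum_col (hA : IsRepresentingMatrix x y m' m η A)
    (hx : Function.Injective x) (hy : Function.Injective y) (j : Idx N) :
    ∑' i, (A i j : ℝ≥0∞) = m j := by
  have hE := measurableSet_singleton (y j)
  have h1 := map_finish_reweight (x := x) (y := y) (η := η) 1 hE
  rw [hA.reweight_one_eq hx hy, hA.map_finish, atomicMeasure_apply _ hE,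
    tsum_eq_single j fun k hk => by simp [hy.ne hk],
    tsum_eq_single j fun k hk => by simp [hy.ne hk]] at h1
  simpa [cell, hA.entry] using h1.symm

/-- If `B` has the marginals of `A` and `κ A = B` entrywise, then reweighting the cells by `κ`
gives a measure with representing matrix `B`. -/
lemma IsRepresentingMatrix.reweight (hA : IsRepresentingMatrix x y m' m η A)
    (hx : Function.Injective x) (hy : Function.Injective y) {B : Matrix (Idx M) (Idx N) ℝ≥0}
    (hrow : ∀ i, ∑' j, (B i j : ℝ≥0∞) = ∑' j, (A i j : ℝ≥0∞))
    (hcol : ∀ j, ∑' i, (B i j : ℝ≥0∞) = ∑' i, (A i j : ℝ≥0∞)) {κ : Idx M × Idx N → ℝ≥0}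
    (hκ : ∀ i j, κ (i, j) * A i j = B i j) :
    IsRepresentingMatrix x y m' m (TransportPath.reweight η (cell x y) κ) B := by
  have hκ' : ∀ i j, (κ (i, j) : ℝ≥0∞) * η (cell x y (i, j)) = B i j := fun i j => by
    rw [cell, hA.entry, ← hκ, ENNReal.coe_mul]
  refine ⟨?_, ?_, fun i j => ?_⟩
  · ext E hE
    rw [map_start_reweight κ hE, atomicMeasure_apply _ hE]
    simp_rw [hκ', hrow, hA.tsum_row hx hy]
  · ext E hE
    rw [map_finish_reweight κ hE, atomicMeasure_apply _ hE]
    simp_rw [hκ', hcol, hA.tsum_col hx hy]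
  · rw [← hκ', ← Measure.restrict_apply_univ (curvesFromTo (x i) (y j))]
    change (TransportPath.reweight η (cell x y) κ).restrict (cell x y (i, j)) univ = _
    rw [reweight_restrict measurableSet_cell (pairwise_disjoint_cell hx hy), Measure.smul_apply,
      Measure.restrict_apply_univ]
    rfl

end atomic

/-! ### Cycle-freeness -/

namespace IsRectifiableRep

variable {T : OneCurrent d} {C : Set (Euc d)} {θ : Euc d → ℝ} {ξ : Euc d → Euc d}

lemma locallyIntegrable_smul_orientation (h : IsRectifiableRep T C θ ξ) {ψ : Euc d → ℝ}
    (hψ : Measurable ψ) (hψ1 : ∀ p, |ψ p| ≤ 1) :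
    LocallyIntegrable (fun p => ψ p • ξ p) (massMeasure C θ) := by
  refine h.locallyIntegrable_orientation.mono
    (hψ.aestronglyMeasurable.smul h.aestronglyMeasurable_orientation)
    (Eventually.of_forall fun p => ?_)
  rw [norm_smul]
  exact mul_le_of_le_one_left (norm_nonneg _) (hψ1 p)

lemma integrable_mul_apply (h : IsRectifiableRep T C θ ξ) {ψ : Euc d → ℝ}
    (hψ : Measurable ψ) (hψ1 : ∀ p, |ψ p| ≤ 1) (ω : OneForm d) :
    Integrable (fun p => ψ p * ω p (ξ p)) (massMeasure C θ) := by
  simpa using OneForm.integrable_apply (h.locallyIntegrable_smul_orientation hψ hψ1) ω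

lemma ae_eq_zero_of_forall_form (h : IsRectifiableRep T C θ ξ) {ψ : Euc d → ℝ}
    (hψ : Measurable ψ) (hψ1 : ∀ p, |ψ p| ≤ 1)
    (h0 : ∀ ω : OneForm d, ∫ p, ψ p * ω p (ξ p) ∂(massMeasure C θ) = 0) :
    ∀ᵐ p ∂(massMeasure C θ), ψ p = 0 := by
  have h1 := TransportPath.ae_eq_zero_of_forall_form
    (h.locallyIntegrable_smul_orientation hψ hψ1) fun ω => by simpa using h0 ω
  filter_upwards [h1, h.ae_norm_orientation] with p hp hξ
  refine (smul_eq_zero.1 hp).resolve_right fun h => ?_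
  rw [h, norm_zero] at hξ
  exact zero_ne_one hξ

/-- In a cycle-free current `τ(C, θ, ξ)`, a weight `ψ` with `|ψ| ≤ 1` for which `τ(C, ψ θ, ξ)` has
no boundary is zero. -/
lemma ae_eq_zero_of_isCycleFree (h : IsRectifiableRep T C θ ξ) (hcf : IsCycleFree T)
    {ψ : Euc d → ℝ} (hψ : Measurable ψ) (hψ1 : ∀ p, |ψ p| ≤ 1)
    (h0 : ∀ f : ZeroForm d, ∫ p, ψ p * (TestFunction.fderivCLM ℝ ⊤ ⊤ f : OneForm d) p (ξ p)
      ∂(massMeasure C θ) = 0) :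
    ∀ᵐ p ∂(massMeasure C θ), ψ p = 0 := by
  obtain ⟨S, hS, hSω⟩ := h.exists_isOn hψ hψ1
  have hS0 : S = 0 := hcf S hS (by
    ext f
    rw [boundary_apply, hSω, h0]
    rfl)
  refine h.ae_eq_zero_of_forall_form hψ hψ1 fun ω => ?_
  rw [← hSω, hS0]
  rfl

end IsRectifiableRep

/-! ### Densities of the cells -/

section densities

variable {ι : Type*} {T : OneCurrent d} {C : Set (Euc d)} {θ : Euc d → ℝ}
  {ξ : Euc d → Euc d} {η : Measure (Curve d)} {G : ι → Set (Curve d)} {κ : ι → ℝ≥0}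
  {ρ : ι → Euc d → ℝ≥0}

lemma IsGoodDecomposition.integrable_reweight (h : IsGoodDecomposition T η)
    (hfin : ∫⁻ γ, mass γ.current ∂(reweight η G κ) ≠ ∞) (ω : OneForm d) :
    Integrable (fun γ : Curve d => γ.current ω) (reweight η G κ) := by
  obtain ⟨B, hB0, hB⟩ := ω.exists_bound
  refine ⟨(h.integrable ω).aestronglyMeasurable.mono_ac reweight_absolutelyContinuous, ?_⟩
  calc ∫⁻ γ, ‖γ.current ω‖ₑ ∂(reweight η G κ)
      ≤ ∫⁻ γ, ENNReal.ofReal (B + 1) * mass γ.current ∂(reweight η G κ) :=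
        lintegral_mono fun γ => enorm_apply_le_mass _ _ (by linarith)
          fun p => (hB p).trans (by linarith)
    _ = ENNReal.ofReal (B + 1) * ∫⁻ γ, mass γ.current ∂(reweight η G κ) :=
        lintegral_const_mul' _ _ ENNReal.ofReal_ne_top
    _ < ∞ := ENNReal.mul_lt_top ENNReal.ofReal_lt_top hfin.lt_top

lemma lintegral_tsum_density [Countable ι]
    (hρ : ∀ k, IsPartDensity η C θ ξ (G k) (ρ k)) :
    ∫⁻ p, ∑' k, (κ k : ℝ≥0∞) * ρ k p ∂(massMeasure C θ) =
      ∫⁻ γ, mass γ.current ∂(reweight η G κ) := by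
  rw [lintegral_tsum fun k => ((hρ k).measurable.coe_nnreal_ennreal.const_mul _).aemeasurable,
    lintegral_reweight]
  exact tsum_congr fun k => by
    rw [lintegral_const_mul _ (hρ k).measurable.coe_nnreal_ennreal, (hρ k).lintegral_eq]

/-- The current carried by the reweighted decomposition has the density `∑ₖ κₖ ρₖ`. -/
lemma IsGoodDecomposition.integral_reweight [Countable ι] (h : IsGoodDecomposition T η)
    (hT : IsRectifiableRep T C θ ξ) (hρ : ∀ k, IsPartDensity η C θ ξ (G k) (ρ k))
    (hfin : ∫⁻ γ, mass γ.current ∂(reweight η G κ) ≠ ∞) (ω : OneForm d) :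
    ∫ γ, γ.current ω ∂(reweight η G κ) =
      ∫ p, (∑' k, (κ k : ℝ≥0∞) * ρ k p).toReal * ω p (ξ p) ∂(massMeasure C θ) := by
  obtain ⟨B, hB0, hB⟩ := ω.exists_bound
  have hξω : ∀ᵐ p ∂(massMeasure C θ), ‖ω p (ξ p)‖ₑ ≤ ENNReal.ofReal B := by
    filter_upwards [hT.ae_norm_orientation] with p hp
    rw [← ofReal_norm]
    refine ENNReal.ofReal_le_ofReal (((ω p).le_opNorm _).trans ?_)
    rw [hp, mul_one]
    exact hB p
  have hωm : AEStronglyMeasurable (fun p => ω p (ξ p)) (massMeasure C θ) :=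
    (OneForm.integrable_apply hT.locallyIntegrable_orientation ω).aestronglyMeasurable
  have h1 : ∫ γ, γ.current ω ∂(reweight η G κ) =
      ∑' k, ∫ p, (κ k : ℝ) * (ρ k p * ω p (ξ p)) ∂(massMeasure C θ) := by
    refine (hasSum_integral_measure (h.integrable_reweight hfin ω)).tsum_eq.symm.trans
      (tsum_congr fun k => ?_)
    rw [integral_smul_nnreal_measure, (hρ k).integral_eq, integral_const_mul]
    rfl
  rw [h1, ← integral_tsum]
  · refine integral_congr_ae (Eventually.of_forall fun p => ?_)
    change ∑' k, (κ k : ℝ) * (ρ k p * ω p (ξ p)) =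
      (∑' k, (κ k : ℝ≥0∞) * ρ k p).toReal * ω p (ξ p)
    rw [ENNReal.tsum_toReal_eq fun k => ENNReal.mul_ne_top ENNReal.coe_ne_top ENNReal.coe_ne_top,
      ← tsum_mul_right]
    exact tsum_congr fun k => by simp [mul_assoc]
  · exact fun k => ((hρ k).measurable.coe_nnreal_real.aestronglyMeasurable.mul hωm).const_mul _
  · refine ne_top_of_le_ne_top (ENNReal.mul_ne_top (ENNReal.ofReal_ne_top (r := B)) hfin) ?_
    rw [← lintegral_tsum_density hρ,
      lintegral_tsum fun k => ((hρ k).measurable.coe_nnreal_ennreal.const_mul _).aemeasurable,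
      ← ENNReal.tsum_mul_left]
    refine ENNReal.tsum_le_tsum fun k => ?_
    rw [← lintegral_const_mul' _ _ ENNReal.ofReal_ne_top]
    refine lintegral_mono_ae ?_
    filter_upwards [hξω] with p hp
    rw [enorm_mul, enorm_mul, ← mul_assoc, mul_comm (ENNReal.ofReal B)]
    gcongr
    · simp
    · simp

end densities

/-- If `f ≤ g` have the same finite integral, then they have the same integral on each cell, so
also for the reweighted measure. No measurability is needed. -/
lemma lintegral_reweight_congr {X ι : Type*} [MeasurableSpace X] {η : Measure X} {G : ι → Set X}
    (h1 : reweight η G 1 = η) (κ : ι → ℝ≥0) {f g : X → ℝ≥0∞} (hfg : ∀ᵐ z ∂η, f z ≤ g z)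
    (heq : ∫⁻ z, f z ∂η = ∫⁻ z, g z ∂η) (hfin : ∫⁻ z, f z ∂η ≠ ∞) :
    ∫⁻ z, f z ∂(reweight η G κ) = ∫⁻ z, g z ∂(reweight η G κ) := by
  have hle : ∀ k, ∫⁻ z in G k, f z ∂η ≤ ∫⁻ z in G k, g z ∂η := fun k =>
    lintegral_mono_ae (ae_restrict_of_ae hfg)
  have hsum : ∀ u : X → ℝ≥0∞, ∑' k, ∫⁻ z in G k, u z ∂η = ∫⁻ z, u z ∂η := fun u => by
    conv_rhs => rw [← h1]
    rw [lintegral_reweight]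
    simp
  rw [lintegral_reweight, lintegral_reweight]
  refine tsum_congr fun k => ?_
  congr 1
  by_contra hne
  refine (ENNReal.tsum_lt_tsum (by rw [hsum]; exact hfin) hle ((hle k).lt_of_ne hne)).ne ?_
  rw [hsum, hsum, heq]

/-! ### Comparing densities -/

section compare

variable {T : OneCurrent d} {C : Set (Euc d)} {θ : Euc d → ℝ} {ξ : Euc d → Euc d}
  {η : Measure (Curve d)}

/-- Sending mass from `a` to `b` and from `a'` to `b'`, and the same amount back along the curves
from `a` to `b'` and from `a'` to `b`, gives a current without boundary. On a cycle-free `T` it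
vanishes, so the normalised densities of the four families of curves are modular. -/
lemma IsGoodDecomposition.ae_density_modular (h : IsGoodDecomposition T η)
    (hT : IsRectifiableRep T C θ ξ) (hcf : IsCycleFree T) {a a' b b' : Euc d}
    {c₁ c₂ c₃ c₄ : ℝ≥0} {ρ₁ ρ₂ ρ₃ ρ₄ : Euc d → ℝ≥0}
    (hc₁ : η (curvesFromTo a b) = c₁) (hc₂ : η (curvesFromTo a b') = c₂)
    (hc₃ : η (curvesFromTo a' b) = c₃) (hc₄ : η (curvesFromTo a' b') = c₄)
    (h₁ : 0 < c₁) (h₂ : 0 < c₂) (h₃ : 0 < c₃) (h₄ : 0 < c₄)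
    (hρ₁ : IsPartDensity η C θ ξ (curvesFromTo a b) ρ₁)
    (hρ₂ : IsPartDensity η C θ ξ (curvesFromTo a b') ρ₂)
    (hρ₃ : IsPartDensity η C θ ξ (curvesFromTo a' b) ρ₃)
    (hρ₄ : IsPartDensity η C θ ξ (curvesFromTo a' b') ρ₄) :
    ∀ᵐ p ∂(massMeasure C θ), ρ₁ p / c₁ + ρ₄ p / c₄ = ρ₂ p / c₂ + ρ₃ p / c₃ := by
  have h₁' : (0 : ℝ) < c₁ := h₁
  have h₂' : (0 : ℝ) < c₂ := h₂
  have h₃' : (0 : ℝ) < c₃ := h₃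
  have h₄' : (0 : ℝ) < c₄ := h₄
  have hpos : (0 : ℝ) < (c₁ : ℝ)⁻¹ + (c₄ : ℝ)⁻¹ + (c₂ : ℝ)⁻¹ + (c₃ : ℝ)⁻¹ := by positivity
  -- normalised such that the combination below is bounded by one
  obtain ⟨ε, hε, hεsum⟩ : ∃ ε : ℝ, 0 < ε ∧
      ε * (c₁ : ℝ)⁻¹ + ε * (c₄ : ℝ)⁻¹ + ε * (c₂ : ℝ)⁻¹ + ε * (c₃ : ℝ)⁻¹ = 1 :=
    ⟨_, inv_pos.2 hpos, by rw [← mul_add, ← mul_add, ← mul_add, inv_mul_cancel₀ hpos.ne']⟩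
  set ψ : Euc d → ℝ := fun p => ε * (c₁ : ℝ)⁻¹ * ρ₁ p + ε * (c₄ : ℝ)⁻¹ * ρ₄ p -
    (ε * (c₂ : ℝ)⁻¹ * ρ₂ p + ε * (c₃ : ℝ)⁻¹ * ρ₃ p) with hψ
  have hψm : Measurable ψ :=
    ((hρ₁.measurable.coe_nnreal_real.const_mul _).add
      (hρ₄.measurable.coe_nnreal_real.const_mul _)).sub
    ((hρ₂.measurable.coe_nnreal_real.const_mul _).add
      (hρ₃.measurable.coe_nnreal_real.const_mul _))
  have hψ1 : ∀ p, |ψ p| ≤ 1 := by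
    intro p
    have key : ∀ (c r : ℝ≥0), r ≤ 1 → 0 ≤ ε * (c : ℝ)⁻¹ * r ∧ ε * (c : ℝ)⁻¹ * r ≤ ε * (c : ℝ)⁻¹ :=
      fun c r hr => ⟨by positivity, mul_le_of_le_one_right (by positivity) hr⟩
    have k₁ := key c₁ _ (hρ₁.le_one p)
    have k₂ := key c₂ _ (hρ₂.le_one p)
    have k₃ := key c₃ _ (hρ₃.le_one p)
    have k₄ := key c₄ _ (hρ₄.le_one p)
    rw [abs_le]
    constructor <;> simp only [hψ] <;> linarith [k₁.1, k₁.2, k₂.1, k₂.2, k₃.1, k₃.2, k₄.1, k₄.2]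
  have hint : ∀ {G : Set (Curve d)} {ρ : Euc d → ℝ≥0}, IsPartDensity η C θ ξ G ρ →
      ∀ (s : ℝ) (ω : OneForm d),
        Integrable (fun p => s * (ρ p * ω p (ξ p))) (massMeasure C θ) := fun hρ s ω =>
    (hT.integrable_mul_apply hρ.measurable.coe_nnreal_real (fun p => by
      rw [NNReal.abs_eq]; exact_mod_cast hρ.le_one p) ω).const_mul s
  have hint₂ : ∀ {G G' : Set (Curve d)} {ρ ρ' : Euc d → ℝ≥0}, IsPartDensity η C θ ξ G ρ →
      IsPartDensity η C θ ξ G' ρ' → ∀ (s s' : ℝ) (ω : OneForm d),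
        Integrable (fun p => s * (ρ p * ω p (ξ p)) + s' * (ρ' p * ω p (ξ p)))
          (massMeasure C θ) := fun hρ hρ' s s' ω => (hint hρ s ω).add (hint hρ' s' ω)
  have hψ0 := hT.ae_eq_zero_of_isCycleFree hcf hψm hψ1 fun f => by
    set ω : OneForm d := TestFunction.fderivCLM ℝ ⊤ ⊤ f with hω
    have e : (fun p => ψ p * ω p (ξ p)) = fun p =>
        (ε * (c₁ : ℝ)⁻¹ * (ρ₁ p * ω p (ξ p)) + ε * (c₄ : ℝ)⁻¹ * (ρ₄ p * ω p (ξ p))) -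
        (ε * (c₂ : ℝ)⁻¹ * (ρ₂ p * ω p (ξ p)) + ε * (c₃ : ℝ)⁻¹ * (ρ₃ p * ω p (ξ p))) := by
      funext p
      simp only [hψ]
      ring
    rw [e, integral_sub (hint₂ hρ₁ hρ₄ _ _ _) (hint₂ hρ₂ hρ₃ _ _ _),
      integral_add (hint hρ₁ _ _) (hint hρ₄ _ _), integral_add (hint hρ₂ _ _) (hint hρ₃ _ _),
      integral_const_mul, integral_const_mul,
      integral_const_mul, integral_const_mul, ← hρ₁.integral_eq, ← hρ₂.integral_eq,
      ← hρ₃.integral_eq, ← hρ₄.integral_eq, hω,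
      h.integral_curvesFromTo, h.integral_curvesFromTo, h.integral_curvesFromTo,
      h.integral_curvesFromTo, hc₁, hc₂, hc₃, hc₄, ENNReal.coe_toReal, ENNReal.coe_toReal,
      ENNReal.coe_toReal, ENNReal.coe_toReal]
    field_simp
    ring
  filter_upwards [hψ0] with p hp
  rw [← NNReal.coe_inj]
  push_cast
  have hp' : ε * ((ρ₁ p : ℝ) / c₁ + ρ₄ p / c₄ - (ρ₂ p / c₂ + ρ₃ p / c₃)) = 0 := by
    rw [← hp]
    simp only [hψ]
    ring
  exact sub_eq_zero.1 ((mul_eq_zero.1 hp').resolve_left hε.ne')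

end compare

/-- The boundary of the current carried by a reweighted decomposition with prescribed marginals. -/
lemma IsGoodDecomposition.integral_fderiv {M N : ℕ∞} {x : Idx M → Euc d} {y : Idx N → Euc d}
    {m' : Idx M → ℝ≥0} {m : Idx N → ℝ≥0} {T : OneCurrent d} {η ν : Measure (Curve d)}
    {B : Matrix (Idx M) (Idx N) ℝ≥0} (h : IsGoodDecomposition T η)
    (hν : ν ≪ η) [IsFiniteMeasure ν] (hB : IsRepresentingMatrix x y m' m ν B) (f : ZeroForm d) :
    ∫ γ, γ.current (TestFunction.fderivCLM ℝ ⊤ ⊤ f) ∂ν =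
      ∫ p, f p ∂(atomicMeasure y m) - ∫ p, f p ∂(atomicMeasure x m') := by
  obtain ⟨c, hc⟩ := f.continuous.bounded_above_of_compact_support f.hasCompactSupport
  have hi : ∀ {g : Curve d → Euc d}, Measurable g → Integrable (fun γ => f (g γ)) ν := fun hg =>
    Integrable.of_bound (f.continuous.measurable.comp hg).aestronglyMeasurable c
      (Eventually.of_forall fun γ => hc _)
  rw [← hB.map_start, ← hB.map_finish,
    integral_map Curve.measurable_finish.aemeasurable f.continuous.aestronglyMeasurable,
    integral_map Curve.measurable_start.aemeasurable f.continuous.aestronglyMeasurable,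
    ← integral_sub (hi Curve.measurable_finish) (hi Curve.measurable_start)]
  refine integral_congr_ae ?_
  filter_upwards [hν.ae_le h.simple] with γ hγ
  rw [← boundary_apply, hγ.2.boundary_current hγ.1]

/-! ### Reweighting the cells of a good decomposition -/

section cells

variable {M N : ℕ∞} {x : Idx M → Euc d} {y : Idx N → Euc d} {m' : Idx M → ℝ≥0} {m : Idx N → ℝ≥0}
  {T : OneCurrent d} {C : Set (Euc d)} {θ : Euc d → ℝ} {ξ : Euc d → Euc d}
  {η : Measure (Curve d)} {A : Matrix (Idx M) (Idx N) ℝ≥0} {ρ : Idx M × Idx N → Euc d → ℝ≥0}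

lemma IsRepresentingMatrix.measure_univ_eq {ν : Measure (Curve d)}
    {B : Matrix (Idx M) (Idx N) ℝ≥0} (hA : IsRepresentingMatrix x y m' m η A)
    (hB : IsRepresentingMatrix x y m' m ν B) : ν univ = η univ := by
  have key : ∀ σ : Measure (Curve d), σ univ = σ.map Curve.start univ := fun σ => by
    rw [Measure.map_apply Curve.measurable_start MeasurableSet.univ, preimage_univ]
  rw [key, key, hA.map_start, hB.map_start]

/-- The cells exhaust `η`, so their densities add up to one. -/
lemma IsGoodDecomposition.ae_tsum_density_eq_one (h : IsGoodDecomposition T η)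
    (hT : IsRectifiableRep T C θ ξ) (hx : Function.Injective x) (hy : Function.Injective y)
    (hA : IsRepresentingMatrix x y m' m η A)
    (hρ : ∀ k, IsPartDensity η C θ ξ (cell x y k) (ρ k)) :
    ∀ᵐ p ∂(massMeasure C θ), ∑' k, (ρ k p : ℝ≥0∞) = 1 := by
  have hfin : IsFiniteMeasure (massMeasure C θ) :=
    ⟨by rw [← hT.mass_eq]; exact h.mass_ne_top.lt_top⟩
  have h1 := hA.reweight_one_eq hx hy
  have hmass : ∫⁻ γ, mass γ.current ∂(reweight η (cell x y) 1) ≠ ∞ := by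
    rw [h1, ← h.mass_eq]; exact h.mass_ne_top
  have hτfin : ∫⁻ p, ∑' k, (ρ k p : ℝ≥0∞) ∂(massMeasure C θ) ≠ ∞ := by
    have := lintegral_tsum_density (κ := 1) hρ
    simp only [Pi.one_apply, ENNReal.coe_one, one_mul] at this
    rwa [this]
  set τ : Euc d → ℝ≥0∞ := fun p => ∑' k, (ρ k p : ℝ≥0∞) with hτ
  have hτm : Measurable τ := Measurable.tsum fun k => (hρ k).measurable.coe_nnreal_ennreal
  have hτi : Integrable (fun p => (τ p).toReal) (massMeasure C θ) :=
    integrable_toReal_of_lintegral_ne_top hτm.aemeasurable hτfin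
  have hτξ : Integrable (fun p => (τ p).toReal • ξ p) (massMeasure C θ) := by
    refine hτi.mono' (hτi.aestronglyMeasurable.smul hT.aestronglyMeasurable_orientation) ?_
    filter_upwards [hT.ae_norm_orientation] with p hp
    rw [norm_smul, hp, mul_one, Real.norm_of_nonneg ENNReal.toReal_nonneg]
  have h0 := ae_eq_zero_of_forall_form
    (hT.locallyIntegrable_orientation.sub hτξ.locallyIntegrable) fun ω => by
      have e1 : T ω = ∫ p, (τ p).toReal * ω p (ξ p) ∂(massMeasure C θ) := by
        have := h.integral_reweight hT (κ := 1) hρ hmass ω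
        rw [h1, ← h.eq_integral] at this
        simpa using this
      have i1 := OneForm.integrable_apply hT.locallyIntegrable_orientation ω
      have i2 := OneForm.integrable_apply hτξ.locallyIntegrable ω
      simp only [Pi.sub_apply, map_sub]
      rw [integral_sub i1 i2, ← hT.apply, e1]
      simp
  filter_upwards [h0, hT.ae_norm_orientation] with p hp hξ
  have h2 : (1 - (τ p).toReal) • ξ p = 0 := by
    rw [sub_smul, one_smul]; exact hp
  have h3 : (τ p).toReal = 1 := by
    rcases smul_eq_zero.1 h2 with h | h
    · linarith
    · rw [h, norm_zero] at hξ
      exact absurd hξ zero_ne_one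
  exact (ENNReal.toReal_eq_one_iff _).1 h3

/-- If reweighting the cells keeps the marginals and does not increase the density, then the
difference between `T` and the reweighted current has no boundary and lies on `T`, so it vanishes
and the reweighted measure is again a good decomposition of `T`. -/
theorem IsGoodDecomposition.reweight (h : IsGoodDecomposition T η)
    (hT : IsRectifiableRep T C θ ξ) (hcf : IsCycleFree T) (hx : Function.Injective x)
    (hy : Function.Injective y) (hA : IsRepresentingMatrix x y m' m η A)
    (hρ : ∀ k, IsPartDensity η C θ ξ (cell x y k) (ρ k)) {κ : Idx M × Idx N → ℝ≥0}
    {B : Matrix (Idx M) (Idx N) ℝ≥0}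
    (hB : IsRepresentingMatrix x y m' m (TransportPath.reweight η (cell x y) κ) B)
    (hle : ∀ᵐ p ∂(massMeasure C θ), ∑' k, (κ k : ℝ≥0∞) * ρ k p ≤ 1) :
    IsGoodDecomposition T (TransportPath.reweight η (cell x y) κ) := by
  have hfin : IsFiniteMeasure (massMeasure C θ) :=
    ⟨by rw [← hT.mass_eq]; exact h.mass_ne_top.lt_top⟩
  have hη := h.finite
  set ν := TransportPath.reweight η (cell x y) κ with hν
  have hac : ν ≪ η := reweight_absolutelyContinuous
  have huniv : ν univ = η univ := hA.measure_univ_eq hB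
  have hνfin : IsFiniteMeasure ν := ⟨huniv ▸ measure_lt_top η univ⟩
  have hmass : ∫⁻ γ, mass γ.current ∂ν ≠ ∞ := by
    rw [hν, ← lintegral_tsum_density hρ]
    refine ne_top_of_le_ne_top (measure_ne_top (massMeasure C θ) univ)
      ((lintegral_mono_ae hle).trans ?_)
    rw [lintegral_one]
  -- `τ ≤ 1` holds almost everywhere only; truncation makes `1 - τ` an admissible weight
  set τ : Euc d → ℝ≥0∞ := fun p => ∑' k, (κ k : ℝ≥0∞) * ρ k p with hτ
  have hτm : Measurable τ :=
    Measurable.tsum fun k => (hρ k).measurable.coe_nnreal_ennreal.const_mul _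
  have hτle : ∀ᵐ p ∂(massMeasure C θ), (τ p).toReal ≤ 1 := hle.mono fun p hp => by
    simpa using ENNReal.toReal_mono ENNReal.one_ne_top hp
  have hψm : Measurable fun p => min (τ p).toReal 1 := hτm.ennreal_toReal.min measurable_const
  have hψ0 : ∀ p, 0 ≤ min (τ p).toReal 1 := fun p => le_min ENNReal.toReal_nonneg zero_le_one
  have hcurr : ∀ ω : OneForm d, ∫ γ, γ.current ω ∂ν =
      ∫ p, min (τ p).toReal 1 * ω p (ξ p) ∂(massMeasure C θ) := fun ω => by
    rw [hν, h.integral_reweight hT hρ hmass]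
    refine integral_congr_ae ?_
    filter_upwards [hτle] with p hp
    rw [min_eq_left hp]
  have hzero := hT.ae_eq_zero_of_isCycleFree hcf (ψ := fun p => 1 - min (τ p).toReal 1)
    (measurable_const.sub hψm)
    (fun p => abs_le.2 ⟨by linarith [min_le_right (τ p).toReal 1], by linarith [hψ0 p]⟩) fun f => by
      simp only [sub_mul, one_mul]
      rw [integral_sub (OneForm.integrable_apply hT.locallyIntegrable_orientation _)
        (hT.integrable_mul_apply hψm (fun p => by
          rw [abs_of_nonneg (hψ0 p)]; exact min_le_right _ _) _), ← hcurr, ← hT.apply,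
        h.eq_integral, h.integral_fderiv hac hB,
        h.integral_fderiv Measure.AbsolutelyContinuous.rfl hA,
        sub_self]
  have hτ1 : ∀ᵐ p ∂(massMeasure C θ), τ p = 1 := by
    filter_upwards [hzero, hτle] with p hp hp'
    rw [min_eq_left hp'] at hp
    exact (ENNReal.toReal_eq_one_iff _).1 (by linarith)
  have hmass_eq : mass T = ∫⁻ γ, mass γ.current ∂ν := by
    rw [hν, ← lintegral_tsum_density hρ, lintegral_congr_ae hτ1, lintegral_one, hT.mass_eq]
  have hone := hA.reweight_one_eq hx hy
  refine ⟨h.normal, hνfin, h.integrable_reweight hmass, fun ω => ?_, hac.ae_le h.simple, hmass_eq,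
    ?_, ?_, by rw [huniv, h.mass_boundary_eq_two_mul]⟩
  · rw [hcurr, hT.apply]
    refine integral_congr_ae ?_
    filter_upwards [hτ1] with p hp
    simp [hp]
  · rw [hmass_eq]
    exact lintegral_reweight_congr hone κ (Eventually.of_forall mass_current_le)
      (h.mass_eq.symm.trans h.mass_eq_length) (h.mass_eq ▸ h.mass_ne_top)
  · have hconst : ∀ σ : Measure (Curve d), ∫⁻ _, 2 ∂σ = 2 * σ univ := fun σ => lintegral_const 2
    rw [hν, lintegral_reweight_congr hone κ (g := fun _ => 2)
      (h.simple.mono fun γ hγ => massZero_boundary_current_le hγ.2 hγ.1)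
      (by rw [hconst, ← h.mass_boundary_eq, h.mass_boundary_eq_two_mul])
      (by rw [← h.mass_boundary_eq, h.mass_boundary_eq_two_mul]
          exact ENNReal.mul_ne_top ENNReal.ofNat_ne_top (measure_ne_top _ _)),
      hconst, ← hν, huniv, h.mass_boundary_eq_two_mul]

/-- Redistributing the mass by the north-west corner coupling does not increase the density: it is
optimal for every cost with the Monge property, and by cycle-freeness the normalised densities have
that property at almost every point. -/
theorem IsGoodDecomposition.exists_isStairShapedMeasure (h : IsGoodDecomposition T η)
    (hT : IsRectifiable T) (hcf : IsCycleFree T) (hx : Function.Injective x)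
    (hy : Function.Injective y) (hA : IsRepresentingMatrix x y m' m η A) (hM : 1 ≤ M) (hN : 1 ≤ N)
    (hpos : ∀ i i' j j', i < i' → j < j' → 0 < A i j' → 0 < A i' j → 0 < A i j ∧ 0 < A i' j') :
    ∃ ν : Measure (Curve d), IsGoodDecomposition T ν ∧ IsStairShapedMeasure x y m' m ν ∧
      Precc x y ν η := by
  obtain ⟨C, θ, ξ, hT⟩ := hT
  have hη := h.finite
  choose ρ hρ using fun k : Idx M × Idx N =>
    h.exists_density hT (measurableSet_cell (x := x) (y := y) k)
  have hsum : ∑' i, ∑' j, (A i j : ℝ≥0∞) ≠ ∞ := by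
    have : ∑' i, ∑' j, (A i j : ℝ≥0∞) = η univ := by
      conv_rhs => rw [← hA.reweight_one_eq hx hy]
      rw [reweight_apply MeasurableSet.univ, ENNReal.tsum_prod']
      simp [cell, hA.entry]
    rw [this]
    exact measure_ne_top _ _
  obtain ⟨B, hstair, hrow, hcol, hBA, hopt⟩ := exists_isStairShapedMatrix hM hN hsum hpos
  -- where `A` vanishes the quotient is zero, as is `B`
  set κ : Idx M × Idx N → ℝ≥0 := fun k => B k.1 k.2 / A k.1 k.2 with hκ
  have hκA : ∀ i j, κ (i, j) * A i j = B i j := fun i j => by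
    by_cases h0 : A i j = 0
    · rw [h0, hBA i j h0, mul_zero]
    · exact div_mul_cancel₀ _ h0
  have hmod : ∀ᵐ p ∂(massMeasure C θ), ∀ i i' j j', 0 < A i j → 0 < A i j' → 0 < A i' j →
      0 < A i' j' → ρ (i, j) p / A i j + ρ (i', j') p / A i' j' =
        ρ (i, j') p / A i j' + ρ (i', j) p / A i' j := by
    refine ae_all_iff.2 fun i => ae_all_iff.2 fun i' => ae_all_iff.2 fun j => ae_all_iff.2 fun j' =>
      eventually_imp_distrib_left.2 fun h1 => eventually_imp_distrib_left.2 fun h2 =>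
      eventually_imp_distrib_left.2 fun h3 => eventually_imp_distrib_left.2 fun h4 => ?_
    exact h.ae_density_modular hT hcf (hA.entry i j) (hA.entry i j') (hA.entry i' j)
      (hA.entry i' j') h1 h2 h3 h4 (hρ (i, j)) (hρ (i, j')) (hρ (i', j)) (hρ (i', j'))
  have hle : ∀ᵐ p ∂(massMeasure C θ), ∑' k, (κ k : ℝ≥0∞) * ρ k p ≤ 1 := by
    filter_upwards [hmod, h.ae_tsum_density_eq_one hT hx hy hA hρ] with p hp h1
    have h2 := hopt (fun i j => ((ρ (i, j) p / A i j : ℝ≥0) : ℝ≥0∞))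
      fun i i' j j' _ _ a b c e => by exact_mod_cast (hp i i' j j' a b c e).le
    calc ∑' k, (κ k : ℝ≥0∞) * ρ k p
        = ∑' i, ∑' j, (B i j : ℝ≥0∞) * ((ρ (i, j) p / A i j : ℝ≥0) : ℝ≥0∞) := by
          rw [ENNReal.tsum_prod']
          refine tsum_congr fun i => tsum_congr fun j => ?_
          rw [← ENNReal.coe_mul, ← ENNReal.coe_mul, hκ, div_mul_eq_mul_div, mul_div_assoc]
      _ ≤ ∑' i, ∑' j, (A i j : ℝ≥0∞) * ((ρ (i, j) p / A i j : ℝ≥0) : ℝ≥0∞) := h2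
      _ ≤ ∑' i, ∑' j, (ρ (i, j) p : ℝ≥0∞) := by
          refine ENNReal.tsum_le_tsum fun i => ENNReal.tsum_le_tsum fun j => ?_
          rw [← ENNReal.coe_mul]
          refine ENNReal.coe_le_coe.2 ?_
          rcases eq_or_ne (A i j) 0 with h0 | h0
          · rw [h0, zero_mul]
            exact zero_le
          · exact (mul_div_cancel₀ _ h0).le
      _ = 1 := by rw [← h1, ENNReal.tsum_prod']
  have hB := hA.reweight hx hy hrow hcol hκA
  refine ⟨_, h.reweight hT hcf hx hy hA hρ hB hle, ⟨B, hB, hstair⟩,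
    fun i j => ⟨κ (i, j), fun ω => ?_⟩⟩
  change ∫ γ in cell x y (i, j), γ.current ω ∂_ = _
  rw [reweight_restrict measurableSet_cell (pairwise_disjoint_cell hx hy),
    integral_smul_nnreal_measure]
  rfl

end cells

end TransportPath

end

theorem mainTheorem6 {d : ℕ} {M N : ℕ∞}
    (x : TransportPath.Idx M → TransportPath.Euc d)
    (y : TransportPath.Idx N → TransportPath.Euc d)
    (hx : Function.Injective x) (hy : Function.Injective y)
    (m' : TransportPath.Idx M → ℝ≥0) (m : TransportPath.Idx N → ℝ≥0)
    (hm : ∑' i, (m' i : ℝ≥0∞) = ∑' j, (m j : ℝ≥0∞)) (hfin : ∑' i, (m' i : ℝ≥0∞) < ∞)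
    (T : TransportPath.OneCurrent d)
    (hT : TransportPath.IsTransportPath (TransportPath.atomicMeasure x m')
      (TransportPath.atomicMeasure y m) T)
    (hcf : TransportPath.IsCycleFree T)
    (ηA : Measure (TransportPath.Curve d)) (hηA : TransportPath.IsGoodDecomposition T ηA)
    (A : Matrix (TransportPath.Idx M) (TransportPath.Idx N) ℝ≥0)
    (hA : TransportPath.IsRepresentingMatrix x y m' m ηA A)
    (K : ℕ∞) (p : ℕ → ℕ × ℕ) (q : ℕ → ℕ∞ × ℕ∞)
    (hblocks : TransportPath.IsPositiveBlockChain A K p q) :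
    (∃ ηB : Measure (TransportPath.Curve d), TransportPath.IsGoodDecomposition T ηB ∧
      TransportPath.IsStairShapedMeasure x y m' m ηB ∧ TransportPath.Precc x y ηB ηA) ∧
    TransportPath.IsStairShapedPath x y m' m T := by
  obtain ⟨h1, h2, h3, h4⟩ := hblocks.corners 1 le_rfl (by simpa using hblocks.one_le)
  rw [hblocks.first, Nat.cast_one] at h1 h3
  obtain ⟨ηB, hgood, hstair, hprec⟩ := hηA.exists_isStairShapedMeasure hT.1 hcf hx hy hA
    (h1.trans h2) (h3.trans h4) fun i i' j j' hi hj => hblocks.pos_of_antidiagonal hi hj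
  exact ⟨⟨ηB, hgood, hstair, hprec⟩, hT, ηB, hgood, hstair⟩
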